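/- Let $n>2$ be an integer and let $B$ be the open unit ball of $\mathbb R^n$. A $C^2$ function $f:B\to\mathbb C$ is called $H$-harmonic if $\Delta_h f(x):=(1-|x|^2)\big[(1-|x|^2)\Delta f(x)+2(n-2)\langle x,\nabla f(x)\rangle\big]=0$ on $B$. For $m\ge0$ let $\mathbf H^m$ be the space of functions continuous on $\overline B$, $H$-harmonic on $B$, whose restriction to the unit sphere $\partial B$ is the restriction of a harmonic polynomial homogeneous of degree $m$. Let $\langle f,g\rangle_{\partial B}=\int_{\partial B}f\overline g\,d\sigma$ with $\sigma$ the normalized surface measure, and put $$I_m^\circ:=\begin{cases}(n-1)_m/\Gamma(m)&n\text{ even},\\ 2(n-1)_m/\Gamma(m)&n\text{ odd},\end{cases}\qquad (n-1)_m=(n-1)n\cdots(n+m-2),\qquad I_0^\circ:=0 .$$ Let $\mathcal H_\circ$ be the space of functions $f=\sum_m f_m$ on $B$ (pointwise sum) with $f_m\in\mathbf H^m$ and $\sum_m I_m^\circ\|f_m\|^2_{\partial B}<\infty$, let $\langle f,g\rangle_\circ=\sum_m I_m^\circ\langle f_m,g_m\rangle_{\partial B}$, and let $\mathcal H_{\circ,0}=\{f\in\mathcal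 H_\circ: f(0)=0\}$. Theorem. The reproducing kernel of $\mathcal H_{\circ,0}$ (the function $K$ on $B\times B$ with $K(\cdot,y)\in\mathcal H_{\circ,0}$ and $f(y)=\langle f,K(\cdot,y)\rangle_\circ$ for all $y\in B$, $f\in\mathcal H_{\circ,0}$) exists, is unique, and equals $$K(x,y)=\kappa_n\big[f_n(|x|^2)+f_n(|y|^2)-f_n(|\phi_y(x)|^2)\big],\qquad \kappa_n=\begin{cases}\dfrac{2(n-1)}n&n\text{ even},\\[2mm] \dfrac{n-1}n&n\text{ odd},\end{cases}$$ where $$\phi_a(x)=\frac{a|x-a|^2+(1-|a|^2)(a-x)}{1-2\langle x,a\rangle+|x|^2|a|^2},\qquad f_n(x)=\int_0^x(1-t)^{n-2}\,{}_2F_1\!\left(n,\tfrac n2;1+\tfrac n2;t\right)dt .$$ Moreover, for $-1<x<1$, $$f_n(x)=\frac{n-2}{2(n-1)}\,x\;{}_3F_2\!\left(2-\tfrac n2,1,1;2,1+\tfrac n2;x\right)+\frac n{2(n-1)}\log\frac1{1-x}.$$ -/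

import Mathlib

open MeasureTheory Metric
open scoped ComplexConjugate

noncomputable section

namespace HHarmonic

/-- Euclidean `n`-space. -/
abbrev E (n : ℕ) : Type := EuclideanSpace ℝ (Fin n)

/-- The open unit ball of `ℝⁿ`. -/
abbrev unitBall (n : ℕ) : Set (E n) := ball (0 : E n) 1

/-- The quantity `[x,a]² = 1 - 2⟨x,a⟩ + |x|²|a|²`. -/
def bracketSq {n : ℕ} (x a : E n) : ℝ :=
  1 - 2 * inner ℝ x a + ‖x‖ ^ 2 * ‖a‖ ^ 2

/-- The Moebius transformation `φ_a` of the unit ball interchanging `0` and `a`. -/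
def moebius {n : ℕ} (a x : E n) : E n :=
  (bracketSq x a)⁻¹ • (‖x - a‖ ^ 2 • a + (1 - ‖a‖ ^ 2) • (a - x))

/-- The hyperbolic Laplacian
`(1-|x|²) [(1-|x|²) Δ f(x) + 2 (n-2) ⟨x, ∇ f(x)⟩]`; here `⟨x, ∇ f(x)⟩` is the derivative of `f`
at `x` in the direction `x`. -/
def hypLaplacian {n : ℕ} (f : E n → ℂ) (x : E n) : ℂ :=
  ((1 - ‖x‖ ^ 2 : ℝ) : ℂ) *
    (((1 - ‖x‖ ^ 2 : ℝ) : ℂ) * Laplacian.laplacian f x + 2 * ((n : ℂ) - 2) * fderiv ℝ f x x)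

/-- `f` is hyperbolic-harmonic on the unit ball. -/
def IsHHarmonic {n : ℕ} (f : E n → ℂ) : Prop :=
  ContDiffOn ℝ 2 f (unitBall n) ∧ ∀ x ∈ unitBall n, hypLaplacian f x = 0

/-- The polynomial `p` on `ℝⁿ` is harmonic and homogeneous of degree `m`. -/
def IsHarmonicHomogeneous {n : ℕ} (m : ℕ) (p : MvPolynomial (Fin n) ℂ) : Prop :=
  p.IsHomogeneous m ∧ ∑ i, MvPolynomial.pderiv i (MvPolynomial.pderiv i p) = 0

/-- The space of solid `H`-harmonics of degree `m`: functions continuous on the closed unit ball,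
`H`-harmonic on the open ball, whose restriction to the unit sphere is the restriction of a
harmonic homogeneous polynomial of degree `m`. (Values outside the closed ball are irrelevant.) -/
def solidHarmonics (n m : ℕ) : Set (E n → ℂ) :=
  {f | ContinuousOn f (closedBall 0 1) ∧ IsHHarmonic f ∧
    ∃ p : MvPolynomial (Fin n) ℂ, IsHarmonicHomogeneous m p ∧
      ∀ ζ ∈ sphere (0 : E n) 1, f ζ = MvPolynomial.eval (fun i => ((ζ i : ℝ) : ℂ)) p}

/-- The inner product `∫ f ḡ dσ` with respect to the normalized surface measure `σ` of the unit
sphere (an average with respect to surface measure). -/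
def sphereInner {n : ℕ} (f g : E n → ℂ) : ℂ :=
  ⨍ ζ : sphere (0 : E n) 1, f ζ * conj (g ζ) ∂((volume : Measure (E n)).toSphere)

/-- The squared norm `∫ |f|² dσ` with respect to the normalized surface measure. -/
def sphereNormSq {n : ℕ} (f : E n → ℂ) : ℝ :=
  ⨍ ζ : sphere (0 : E n) 1, ‖f ζ‖ ^ 2 ∂((volume : Measure (E n)).toSphere)

/-- The weights `I_m`: `(n-1)_m / Γ(m)` for `n` even and `2 (n-1)_m / Γ(m)` for `n` odd, which is
`0` for `m = 0`, where `1/Γ(0) = 0`. -/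
def weight (n m : ℕ) : ℝ :=
  if m = 0 then 0
  else (if Even n then 1 else 2) * (ascPochhammer ℝ m).eval ((n : ℝ) - 1) / Real.Gamma m

/-- `f = ∑ f_m` on the unit ball, with `f_m` a solid `H`-harmonic of degree `m` and with
`∑ I_m ‖f_m‖² < ∞`. -/
structure IsDirichletExpansion {n : ℕ} (f : E n → ℂ) (F : ℕ → E n → ℂ) : Prop where
  mem : ∀ m, F m ∈ solidHarmonics n m
  hasSum : ∀ x ∈ unitBall n, HasSum (fun m => F m x) (f x)
  summable : Summable fun m => weight n m * sphereNormSq (F m)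

/-- The `H`-harmonic Dirichlet space. (Only the values on the unit ball matter.) -/
def dirichletSpace (n : ℕ) : Set (E n → ℂ) :=
  {f | ∃ F, IsDirichletExpansion f F}

/-- The subspace of functions vanishing at the origin. -/
def dirichletSpaceZero (n : ℕ) : Set (E n → ℂ) :=
  {f | f ∈ dirichletSpace n ∧ f 0 = 0}

/-- `c` is the (semi-)inner product `∑ I_m ⟨f_m, g_m⟩` of the functions `f = ∑ f_m` and
`g = ∑ g_m`. -/
def HasDirichletInner {n : ℕ} (f g : E n → ℂ) (c : ℂ) : Prop :=
  ∀ F G, IsDirichletExpansion f F → IsDirichletExpansion g G →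
    HasSum (fun m => (weight n m : ℂ) * sphereInner (F m) (G m)) c

/-- `K` is the reproducing kernel of the space of functions in the Dirichlet space that vanish at
the origin: `K(·,y)` belongs to the space, and `f(y) = ⟨f, K(·,y)⟩` for all `f` in the space. -/
def IsReproducingKernel {n : ℕ} (K : E n → E n → ℂ) : Prop :=
  ∀ y ∈ unitBall n, (fun x => K x y) ∈ dirichletSpaceZero n ∧
    ∀ f ∈ dirichletSpaceZero n, HasDirichletInner f (fun x => K x y) (f y)

/-- The hypergeometric series `₃F₂(a, b, c; d, e; x)`. -/
def hyp32 (a b c d e x : ℝ) : ℝ :=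
  ∑' k : ℕ, (ascPochhammer ℝ k).eval a * (ascPochhammer ℝ k).eval b * (ascPochhammer ℝ k).eval c /
    ((ascPochhammer ℝ k).eval d * (ascPochhammer ℝ k).eval e * (k.factorial : ℝ)) * x ^ k

/-- `f_n(x) = ∫₀ˣ (1-t)^(n-2) ₂F₁(n, n/2; 1+n/2; t) dt`. -/
def fn (n : ℕ) (x : ℝ) : ℝ :=
  ∫ t in (0 : ℝ)..x,
    (1 - t) ^ (n - 2) * ordinaryHypergeometric (n : ℝ) ((n : ℝ) / 2) (1 + (n : ℝ) / 2) t

end HHarmonic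

end

/-! Put l = n/2 - 1. For p harmonic and homogeneous of degree m, separation of variables turns
Δ_h(h(|x|²) p(x)) = 0 into a hypergeometric equation whose solution regular at 0 is S_m = ₂F₁(m, -l;
m+l+1; ·). The series converges absolutely up to t = 1, with Gauss's value S_m(1) = (l+1)_m /
(2l+1)_m > 0. By the maximum principle the functions S_m(|x|²) p(x) / S_m(1) exhaust the space of
degree m (`eqOn_solidExt`). Let Z_m be the zonal harmonic equal to 1 at coinciding unit vectors and
d_m the dimension of the spherical harmonics of degree m. Zonal harmonics reproduce boundary
polynomials, so the kernel has to be the sum over m ≥ 1 of d_m S_m(|x|²) S_m(|y|²) Z_m(x, y) / (I_m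
S_m(1)²). The content of the theorem is the sum of this series.

Up to a constant factor f_n(t) is -log(1-t) + g(t), with g (`regPart`) continuous up to t = 1
(`fn_eq_regPart`). The function f_n(|x|²) has constant hyperbolic Laplacian; by Moebius invariance
so has f_n(|φ_y(x)|²), hence their difference is H-harmonic (verified by direct computation in
`isHHarmonic_kernelExt`). Because 1 - |φ_y(x)|² = (1-|x|²)(1-|y|²)/[x,y]², the three logarithms
collapse to -log [x,y]² and the closed form extends continuously to |x| = 1, where it is g(|y|²) -
log|x-y|².

These boundary values are expanded by writing -log(1 - 2r cos θ + r²) as the sum of 2 cos(Nθ) r^N /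
N and each cosine as a combination of zonal harmonics (`sum_cosTerm_eq_cos`). Collecting degree m
gives a constant times S_m(r²) r^m Z_m; degree 0 gives -g(r²), which cancels g(|y|²). The constants
agree with the weights (`weight_mul_eq_one`), and the maximum principle carries uniform convergence
from the sphere into the ball (`hasSum_solidExt_kernelPoly`).

The inner product does not depend on the chosen expansions, since the boundary values of the
components are determined by f (`IsDirichletExpansion.eqOn_sphere`). Degree 0 has weight 0, which is
harmless because f(0) = 0 forces f_0 = 0. Uniqueness of the kernel is the usual symmetry argument.
-/

namespace HHarmonic

open Filter Topology Set

/-! ### Real power series on (-1, 1) and their derivatives -/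

/-- The real power series `∑ aₖ tᵏ` converges absolutely on `(-1, 1)`. -/
def ConvergesInside (a : ℕ → ℝ) : Prop :=
  ∀ r : ℝ, 0 ≤ r → r < 1 → Summable fun k => |a k| * r ^ k

/-- The sum `∑ aₖ tᵏ`. -/
noncomputable def powerSum (a : ℕ → ℝ) (t : ℝ) : ℝ := ∑' k, a k * t ^ k

/-- The coefficients of the derivative of a power series. -/
def derivCoeff (a : ℕ → ℝ) (k : ℕ) : ℝ := (k + 1) * a (k + 1)

theorem ConvergesInside.hasSum {a : ℕ → ℝ} (ha : ConvergesInside a) {t : ℝ} (ht : |t| < 1) :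
    HasSum (fun k => a k * t ^ k) (powerSum a t) := by
  apply Summable.hasSum
  apply Summable.of_norm
  simpa [abs_mul, abs_pow] using ha |t| (abs_nonneg t) ht

/-- At a radius ρ strictly between r and 1 the terms are bounded, so the factor k is absorbed by the
geometric decay of (r/ρ)^k. -/
theorem ConvergesInside.natMul {a : ℕ → ℝ} (ha : ConvergesInside a) :
    ConvergesInside (fun k => (k : ℝ) * a k) := by
  intro r hr0 hr1
  obtain ⟨ρ, hρ1, hρ2⟩ := exists_between hr1
  have hρ0 : 0 < ρ := lt_of_le_of_lt hr0 hρ1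
  obtain ⟨M, hM⟩ : ∃ M, ∀ k, |a k| * ρ ^ k ≤ M := by
    have h := (ha ρ hρ0.le hρ2).tendsto_atTop_zero.bddAbove_range
    obtain ⟨M, hM⟩ := h
    exact ⟨M, fun k => hM ⟨k, rfl⟩⟩
  have hq : ‖r / ρ‖ < 1 := by
    rw [Real.norm_eq_abs, abs_of_nonneg (by positivity), div_lt_one hρ0]; exact hρ1
  have hs := (summable_pow_mul_geometric_of_norm_lt_one 1 hq).mul_left M
  refine Summable.of_nonneg_of_le (fun k => by positivity) (fun k => ?_) hs
  have e : |(k : ℝ) * a k| * r ^ k = (|a k| * ρ ^ k) * ((k : ℝ) * (r / ρ) ^ k) := by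
    rw [abs_mul, Nat.abs_cast, div_pow]
    field_simp
  rw [e, pow_one]
  exact mul_le_mul_of_nonneg_right (hM k) (by positivity)

theorem ConvergesInside.shift {a : ℕ → ℝ} (ha : ConvergesInside a) :
    ConvergesInside (fun k => a (k + 1)) := by
  intro r hr0 hr1
  rcases hr0.eq_or_lt with rfl | hr
  · refine summable_of_ne_finset_zero (s := {0}) fun k hk => ?_
    have : k ≠ 0 := by simpa using hk
    simp [this]
  · have h := ((summable_nat_add_iff 1).2 (ha r hr0 hr1)).mul_left r⁻¹
    refine h.congr fun k => ?_
    field_simp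
    ring

theorem ConvergesInside.derivCoeff {a : ℕ → ℝ} (ha : ConvergesInside a) :
    ConvergesInside (derivCoeff a) := by
  have := ha.natMul.shift
  convert this using 2 with k
  simp [HHarmonic.derivCoeff]

theorem ConvergesInside.const_mul {a : ℕ → ℝ} (ha : ConvergesInside a) (c : ℝ) :
    ConvergesInside (fun k => c * a k) := fun r h0 h1 =>
  ((ha r h0 h1).mul_left |c|).congr fun k => by rw [abs_mul, mul_assoc]

theorem ConvergesInside.add {a b : ℕ → ℝ} (ha : ConvergesInside a) (hb : ConvergesInside b) :
    ConvergesInside (fun k => a k + b k) := fun r h0 h1 =>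
  Summable.of_nonneg_of_le (fun k => by positivity)
    (fun k => by
      rw [← add_mul]; exact mul_le_mul_of_nonneg_right (abs_add_le _ _) (pow_nonneg h0 k))
    ((ha r h0 h1).add (hb r h0 h1))

theorem powerSum_zero (a : ℕ → ℝ) : powerSum a 0 = a 0 := by
  rw [powerSum, tsum_eq_single 0]
  · simp
  · intro k hk; simp [hk]

/-- The factor t undoes the index shift of differentiation, so that differential equations below can
be checked coefficient by coefficient. -/
theorem mul_powerSum_derivCoeff {a : ℕ → ℝ} (ha : ConvergesInside a) {t : ℝ} (ht : |t| < 1) :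
    t * powerSum (derivCoeff a) t = powerSum (fun k => (k : ℝ) * a k) t := by
  have h := (ha.derivCoeff.hasSum ht).mul_left t
  have h2 : HasSum (fun k : ℕ => ((k : ℝ) * a k) * t ^ k)
      (t * powerSum (derivCoeff a) t + ((0 : ℕ) : ℝ) * a 0 * t ^ 0) := by
    rw [← Finset.sum_range_one (fun k : ℕ => ((k : ℝ) * a k) * t ^ k)]
    rw [← hasSum_nat_add_iff 1]
    refine h.congr_fun fun k => ?_
    simp only [derivCoeff]; push_cast; ring
  have h3 : powerSum (fun k => (k : ℝ) * a k) t = _ := h2.tsum_eq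
  rw [h3]
  simp

theorem hasDerivAt_powerSum {a : ℕ → ℝ} (ha : ConvergesInside a) {t : ℝ} (ht : |t| < 1) :
    HasDerivAt (powerSum a) (powerSum (derivCoeff a) t) t := by
  obtain ⟨r, hr1, hr2⟩ := exists_between ht
  have hr0 : 0 < r := lt_of_le_of_lt (abs_nonneg t) hr1
  have hsum : Summable fun k : ℕ => |(k : ℝ) * a k| * r ^ k * r⁻¹ :=
    (ha.natMul r hr0.le hr2).mul_right _
  have key := hasDerivAt_tsum_of_isPreconnected (u := fun k : ℕ => |(k : ℝ) * a k| * r ^ k * r⁻¹)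
    (g := fun (k : ℕ) s => a k * s ^ k) (g' := fun (k : ℕ) s => a k * (k * s ^ (k - 1))) (t := Ioo (-r) r)
    (y₀ := 0) (y := t) hsum isOpen_Ioo isPreconnected_Ioo
    (fun k s _ => (hasDerivAt_pow k s).const_mul _) ?_ (by simp [hr0]) ?_ (abs_lt.1 hr1)
  · have h := ha.natMul.shift.hasSum ht
    have h' := ((hasSum_nat_add_iff (f := fun k : ℕ => a k * (k * t ^ (k - 1))) 1).1
      (h.congr_fun fun k => by simp only [add_tsub_cancel_right]; ring)).tsum_eq
    rw [h'] at key
    have e : powerSum (derivCoeff a) t = powerSum (fun k => ((k + 1 : ℕ) : ℝ) * a (k + 1)) t +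
        ∑ i ∈ Finset.range 1, a i * (i * t ^ (i - 1)) := by
      simp [powerSum, derivCoeff]
    rw [e]
    exact key
  · intro k s hs
    have hs' : |s| ≤ r := (abs_lt.2 hs).le
    rcases k with _ | k
    · simp
    · rw [Real.norm_eq_abs, abs_mul, abs_mul, abs_mul, abs_pow, pow_succ, add_tsub_cancel_right]
      have : |s| ^ k ≤ r ^ k := pow_le_pow_left₀ (abs_nonneg s) hs' k
      calc |a (k + 1)| * (|((k + 1 : ℕ) : ℝ)| * |s| ^ k)
          ≤ |a (k + 1)| * (|((k + 1 : ℕ) : ℝ)| * r ^ k) := by gcongr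
        _ = _ := by field_simp
  · simpa using (ha.hasSum (t := 0) (by simp)).summable

theorem contDiffOn_powerSum (N : ℕ) : ∀ {a : ℕ → ℝ}, ConvergesInside a →
    ContDiffOn ℝ N (powerSum a) (Ioo (-1) 1) := by
  induction N with
  | zero =>
    intro a ha
    simp only [CharP.cast_eq_zero, contDiffOn_zero]
    exact fun t ht => (hasDerivAt_powerSum ha (abs_lt.2 ht)).continuousAt.continuousWithinAt
  | succ N ih =>
    intro a ha
    have : ((N + 1 : ℕ) : WithTop ℕ∞) = (N : WithTop ℕ∞) + 1 := by push_cast; rfl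
    rw [this, contDiffOn_succ_iff_deriv_of_isOpen isOpen_Ioo]
    refine ⟨fun t ht => (hasDerivAt_powerSum ha (abs_lt.2 ht)).differentiableAt.differentiableWithinAt,
      by simp, ?_⟩
    exact (ih ha.derivCoeff).congr fun t ht => (hasDerivAt_powerSum ha (abs_lt.2 ht)).deriv

theorem continuousOn_powerSum_Icc {a : ℕ → ℝ} (ha : Summable fun k => |a k|) :
    ContinuousOn (powerSum a) (Icc (-1) 1) := by
  refine continuousOn_tsum (fun k => by fun_prop) ha fun k t ht => ?_
  rw [Real.norm_eq_abs, abs_mul, abs_pow]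
  exact mul_le_of_le_one_right (abs_nonneg _) (pow_le_one₀ (abs_nonneg _) (abs_le.2 ht))

theorem convergesInside_of_summable {a : ℕ → ℝ} (ha : Summable fun k => |a k|) :
    ConvergesInside a := fun r h0 h1 =>
  Summable.of_nonneg_of_le (fun k => by positivity)
    (fun k => mul_le_of_le_one_right (abs_nonneg _) (pow_le_one₀ h0 h1.le)) ha

/-! ### Rising factorials and binomial coefficients -/

/-- The rising factorial `(a)ₖ` of a real number. -/
noncomputable def poch (a : ℝ) (k : ℕ) : ℝ := (ascPochhammer ℝ k).eval a

@[simp] theorem poch_zero (a : ℝ) : poch a 0 = 1 := by simp [poch]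

theorem poch_succ (a : ℝ) (k : ℕ) : poch a (k + 1) = poch a k * (a + k) := by
  rw [poch, ascPochhammer_succ_eval, poch]

theorem poch_succ_left (a : ℝ) (k : ℕ) : poch a (k + 1) = a * poch (a + 1) k := by
  induction k with
  | zero => simp [poch_succ]
  | succ k ih => rw [poch_succ, ih, poch_succ]; push_cast; ring

theorem poch_pos {a : ℝ} (ha : 0 < a) (k : ℕ) : 0 < poch a k := ascPochhammer_pos _ _ ha

theorem poch_nonneg {a : ℝ} (ha : 0 ≤ a) (k : ℕ) : 0 ≤ poch a k := by
  induction k with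
  | zero => simp
  | succ k ih => rw [poch_succ]; positivity

theorem poch_one (k : ℕ) : poch 1 k = k.factorial := by
  simp [poch, ascPochhammer_eval_one]

theorem poch_add (a : ℝ) (m k : ℕ) : poch a (m + k) = poch a m * poch (a + m) k := by
  induction k with
  | zero => simp
  | succ k ih => rw [← add_assoc, poch_succ, ih, poch_succ]; push_cast; ring

theorem poch_mono {a b : ℝ} (ha : 0 ≤ a) (hab : a ≤ b) (k : ℕ) : poch a k ≤ poch b k := by
  induction k with
  | zero => simp
  | succ k ih =>
    rw [poch_succ, poch_succ]
    exact mul_le_mul ih (by linarith) (by positivity) (poch_nonneg (ha.trans hab) k)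

/-- The coefficient `(-l)ₖ / k!` of the binomial series `(1 - t)^l`. -/
noncomputable def binCoeff (l : ℝ) (k : ℕ) : ℝ := poch (-l) k / k.factorial

@[simp] theorem binCoeff_zero (l : ℝ) : binCoeff l 0 = 1 := by simp [binCoeff]

theorem binCoeff_succ (l : ℝ) (k : ℕ) :
    (k + 1) * binCoeff l (k + 1) = (k - l) * binCoeff l k := by
  rw [binCoeff, binCoeff, poch_succ, Nat.factorial_succ]
  push_cast
  field_simp
  ring

/-- The recurrence gives (k+1)|b_{k+1}| = |k-l| |b_k|, so k|b_k| is nonincreasing once k ≥ l and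
only finitely many values matter. The bound 1 ≤ C lets the same constant control the term k = 0. -/
theorem exists_natMul_abs_binCoeff_le {l : ℝ} (hl : 0 < l) :
    ∃ C : ℝ, 1 ≤ C ∧ ∀ k : ℕ, k * |binCoeff l k| ≤ C := by
  obtain ⟨N, hN⟩ := exists_nat_ge l
  have hdec : ∀ k : ℕ, N ≤ k → ((k + 1 : ℕ) : ℝ) * |binCoeff l (k + 1)| ≤ k * |binCoeff l k| := by
    intro k hk
    have hk' : l ≤ k := hN.trans (by exact_mod_cast hk)
    have h := congrArg abs (binCoeff_succ l k)
    rw [abs_mul, abs_mul, abs_of_nonneg (by positivity : (0 : ℝ) ≤ k + 1),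
      abs_of_nonneg (by linarith : (0 : ℝ) ≤ k - l)] at h
    push_cast
    rw [h]
    gcongr
    linarith
  refine ⟨1 + ∑ i ∈ Finset.range (N + 1), (i : ℝ) * |binCoeff l i|, ?_, fun k => ?_⟩
  · have : 0 ≤ ∑ i ∈ Finset.range (N + 1), (i : ℝ) * |binCoeff l i| :=
      Finset.sum_nonneg fun i _ => by positivity
    linarith
  · have hmem : ∀ j ≤ N, (j : ℝ) * |binCoeff l j| ≤
        ∑ i ∈ Finset.range (N + 1), (i : ℝ) * |binCoeff l i| := fun j hj =>
      Finset.single_le_sum (f := fun i : ℕ => (i : ℝ) * |binCoeff l i|)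
        (fun i _ => by positivity) (Finset.mem_range.2 (by omega))
    rcases le_total k N with hk | hk
    · linarith [hmem k hk]
    · have : (k : ℝ) * |binCoeff l k| ≤ N * |binCoeff l N| := by
        induction k, hk using Nat.le_induction with
        | base => exact le_rfl
        | succ k hk ih => exact (hdec k hk).trans ih
      linarith [hmem N le_rfl]

/-- A constant `C` with `k |(-l)ₖ / k!| ≤ C` for all `k`. -/
noncomputable def binBound (l : ℝ) : ℝ :=
  open Classical in if h : 0 < l then (exists_natMul_abs_binCoeff_le h).choose else 1

theorem one_le_binBound {l : ℝ} (hl : 0 < l) : 1 ≤ binBound l := by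
  rw [binBound, dif_pos hl]; exact (exists_natMul_abs_binCoeff_le hl).choose_spec.1

theorem natMul_abs_binCoeff_le {l : ℝ} (hl : 0 < l) (k : ℕ) :
    k * |binCoeff l k| ≤ binBound l := by
  rw [binBound, dif_pos hl]; exact (exists_natMul_abs_binCoeff_le hl).choose_spec.2 k

theorem abs_binCoeff_le {l : ℝ} (hl : 0 < l) (k : ℕ) : |binCoeff l k| ≤ binBound l := by
  rcases k with _ | k
  · simpa using one_le_binBound hl
  · refine le_trans ?_ (natMul_abs_binCoeff_le hl (k + 1))
    have : (1 : ℝ) ≤ ((k + 1 : ℕ) : ℝ) := by push_cast; linarith [k.cast_nonneg (α := ℝ)]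
    exact le_mul_of_one_le_left (abs_nonneg _) this

theorem summable_abs_of_sq_mul_le {a : ℕ → ℝ} {C : ℝ} (h : ∀ k : ℕ, (k : ℝ) ^ 2 * |a k| ≤ C) :
    Summable fun k => |a k| := by
  have hs : Summable fun k : ℕ => C * (1 / (k : ℝ) ^ 2) :=
    (Real.summable_one_div_nat_pow.2 one_lt_two).mul_left C
  refine (summable_nat_add_iff 1).1 (Summable.of_nonneg_of_le (fun k => abs_nonneg _)
    (fun k => ?_) ((summable_nat_add_iff 1).2 hs))
  have hk : (0 : ℝ) < ((k + 1 : ℕ) : ℝ) ^ 2 := by positivity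
  rw [mul_one_div, le_div_iff₀ hk, mul_comm]
  exact h (k + 1)

/-! ### The radial functions ₂F₁(m, -l; m+l+1; t) -/

/-- The coefficients of the hypergeometric series `₂F₁(m, -l; m + l + 1; t)`. -/
noncomputable def hypCoeff (l : ℝ) (m k : ℕ) : ℝ := poch m k / poch (m + l + 1) k * binCoeff l k

@[simp] theorem hypCoeff_zero_right (l : ℝ) (m : ℕ) : hypCoeff l m 0 = 1 := by simp [hypCoeff]

theorem hypCoeff_succ {l : ℝ} (hl : 0 < l) (m k : ℕ) :
    (k + 1) * (m + l + 1 + k) * hypCoeff l m (k + 1) = (m + k) * (k - l) * hypCoeff l m k := by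
  have h1 : (m : ℝ) + l + 1 + k ≠ 0 := by positivity
  have h2 := (poch_pos (a := m + l + 1) (by positivity) k).ne'
  have h3 := binCoeff_succ l k
  rw [hypCoeff, hypCoeff, poch_succ, poch_succ]
  field_simp
  linear_combination poch m k * (m + k) * h3

/-- For l = 0 this is an equality, since (m)_k / (m+1)_k = m/(m+k). It supplies a second factor 1/k
beyond the decay of the binomial coefficients, whence absolute convergence at t = 1. -/
theorem add_mul_poch_le {l : ℝ} (hl : 0 < l) (m k : ℕ) :
    (m + k) * poch m k ≤ m * poch (m + l + 1) k := by
  induction k with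
  | zero => simp
  | succ k ih =>
    rw [poch_succ, poch_succ]
    push_cast
    have h1 : 0 ≤ poch (m + l + 1) k := poch_nonneg (by positivity) k
    calc ((m : ℝ) + (k + 1)) * (poch m k * (m + k)) = (m + k + 1) * ((m + k) * poch m k) := by ring
      _ ≤ (m + k + 1) * (m * poch (m + l + 1) k) := by gcongr
      _ ≤ (m + l + 1 + k) * (m * poch (m + l + 1) k) := by gcongr ?_ * _; linarith
      _ = _ := by ring

theorem abs_hypCoeff_le {l : ℝ} (hl : 0 < l) (m k : ℕ) : |hypCoeff l m k| ≤ |binCoeff l k| := by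
  rw [hypCoeff, abs_mul, abs_of_nonneg
    (div_nonneg (poch_nonneg (by positivity) k) (poch_nonneg (by positivity) k))]
  refine mul_le_of_le_one_left (abs_nonneg _) ?_
  rw [div_le_one (poch_pos (by positivity) k)]
  exact poch_mono (by positivity) (by linarith) k

theorem add_mul_abs_hypCoeff_le {l : ℝ} (hl : 0 < l) (m k : ℕ) :
    (m + k) * |hypCoeff l m k| ≤ m * |binCoeff l k| := by
  rw [hypCoeff, abs_mul, abs_of_nonneg
    (div_nonneg (poch_nonneg (by positivity) k) (poch_nonneg (by positivity) k)), ← mul_assoc]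
  refine mul_le_mul_of_nonneg_right ?_ (abs_nonneg _)
  rw [← mul_div_assoc, div_le_iff₀ (poch_pos (by positivity) k)]
  exact add_mul_poch_le hl m k

theorem sq_mul_abs_hypCoeff_le {l : ℝ} (hl : 0 < l) (m k : ℕ) :
    (k : ℝ) ^ 2 * |hypCoeff l m k| ≤ m * binBound l := by
  calc (k : ℝ) ^ 2 * |hypCoeff l m k| ≤ k * ((m + k) * |hypCoeff l m k|) := by
        rw [sq, mul_assoc]; gcongr; linarith [m.cast_nonneg (α := ℝ)]
    _ ≤ k * (m * |binCoeff l k|) :=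
        mul_le_mul_of_nonneg_left (add_mul_abs_hypCoeff_le hl m k) k.cast_nonneg
    _ = m * (k * |binCoeff l k|) := by ring
    _ ≤ _ := by gcongr; exact natMul_abs_binCoeff_le hl k

theorem summable_abs_hypCoeff {l : ℝ} (hl : 0 < l) (m : ℕ) :
    Summable fun k => |hypCoeff l m k| :=
  summable_abs_of_sq_mul_le (sq_mul_abs_hypCoeff_le hl m)

/-- The hypergeometric function `₂F₁(m, -l; m + l + 1; t)`. -/
noncomputable def hypSum (l : ℝ) (m : ℕ) : ℝ → ℝ := powerSum (hypCoeff l m)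

theorem convergesInside_hypCoeff {l : ℝ} (hl : 0 < l) (m : ℕ) :
    ConvergesInside (hypCoeff l m) := convergesInside_of_summable (summable_abs_hypCoeff hl m)

theorem hasSum_hypCoeff_one {l : ℝ} (hl : 0 < l) (m : ℕ) :
    HasSum (hypCoeff l m) (hypSum l m 1) := by
  have := (summable_abs_hypCoeff hl m).of_abs.hasSum
  simpa [hypSum, powerSum] using this

@[simp] theorem hypSum_zero_right (l : ℝ) (m : ℕ) : hypSum l m 0 = 1 := by
  simp [hypSum, powerSum_zero]

theorem hypSum_zero_left (l : ℝ) (t : ℝ) : hypSum l 0 t = 1 := by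
  rw [hypSum, powerSum, tsum_eq_single 0]
  · simp
  · intro k hk
    obtain ⟨k, rfl⟩ := Nat.exists_eq_succ_of_ne_zero hk
    simp [hypCoeff, poch_succ_left]

/-! ### Gauss's value at 1 and the hypergeometric equation -/

theorem hasSum_of_telescoping {u G : ℕ → ℝ} (hu : Summable u)
    (h : ∀ k, u k = G (k + 1) - G k) (hG : Tendsto G atTop (𝓝 0)) : HasSum u (-G 0) := by
  have h1 := hu.hasSum
  have h2 : Tendsto (fun N => ∑ k ∈ Finset.range N, u k) atTop (𝓝 (0 - G 0)) := by
    simp_rw [h, Finset.sum_range_sub]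
    exact hG.sub_const _
  rw [tendsto_nhds_unique h1.tendsto_sum_nat h2] at h1
  simpa using h1

theorem hypCoeff_succ_left {l : ℝ} (hl : 0 < l) (m k : ℕ) :
    m * (m + l + 1 + k) * hypCoeff l (m + 1) k = (m + k) * (m + l + 1) * hypCoeff l m k := by
  have h1 : (m : ℝ) + l + 1 + k ≠ 0 := by positivity
  have h2 := (poch_pos (a := m + l + 1) (by positivity) k).ne'
  have h4 := (poch_pos (a := m + l + 1 + 1) (by positivity) k).ne'
  have e1 : poch m k * (m + k) = m * poch (m + 1) k := by rw [← poch_succ, poch_succ_left]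
  have e2 : poch (m + l + 1) k * (m + l + 1 + k) = (m + l + 1) * poch (m + l + 1 + 1) k := by
    rw [← poch_succ, poch_succ_left]
  have e3 : (((m + 1 : ℕ) : ℝ) + l + 1) = m + l + 1 + 1 := by push_cast; ring
  rw [hypCoeff, hypCoeff, e3]
  push_cast
  field_simp
  linear_combination (binCoeff l k * m * poch (m + 1) k) * e2 -
    binCoeff l k * (m + l + 1) * poch (m + l + 1 + 1) k * e1

theorem tendsto_natMul_hypCoeff {l : ℝ} (hl : 0 < l) (m : ℕ) :
    Tendsto (fun k : ℕ => (k : ℝ) * hypCoeff l m k) atTop (𝓝 0) := by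
  have hb : ∀ k : ℕ, ‖(k : ℝ) * hypCoeff l m k‖ ≤ m * binBound l * (k : ℝ)⁻¹ := by
    intro k
    rcases k with _ | k
    · simp
    · have hk : (0 : ℝ) < ((k + 1 : ℕ) : ℝ) := by positivity
      rw [Real.norm_eq_abs, abs_mul, Nat.abs_cast, ← div_eq_mul_inv, le_div_iff₀ hk]
      have := sq_mul_abs_hypCoeff_le hl m (k + 1)
      calc _ = ((k + 1 : ℕ) : ℝ) ^ 2 * |hypCoeff l m (k + 1)| := by ring
        _ ≤ _ := this
  refine squeeze_zero_norm hb ?_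
  simpa using (tendsto_inv_atTop_nhds_zero_nat (𝕜 := ℝ)).const_mul (m * binBound l)

/-- Ratio of the coefficients `(-l)ₖ / (l+1)ₖ`. -/
noncomputable def pochRatio (l : ℝ) (k : ℕ) : ℝ := poch (-l) k / poch (l + 1) k

theorem pochRatio_succ {l : ℝ} (hl : 0 < l) (k : ℕ) :
    (l + 1 + k) * pochRatio l (k + 1) = (k - l) * pochRatio l k := by
  have h1 : l + 1 + k ≠ 0 := by positivity
  have h2 := (poch_pos (a := l + 1) (by positivity) k).ne'
  rw [pochRatio, pochRatio, poch_succ, poch_succ]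
  field_simp
  ring

theorem abs_pochRatio_le {l : ℝ} (hl : 0 < l) (k : ℕ) : |pochRatio l k| ≤ |binCoeff l k| := by
  rw [pochRatio, binCoeff, abs_div, abs_div, Nat.abs_cast,
    abs_of_pos (poch_pos (a := l + 1) (by positivity) k)]
  refine div_le_div_of_nonneg_left (abs_nonneg _) (by positivity) ?_
  rw [← poch_one]
  exact poch_mono zero_le_one (by linarith) k

theorem tendsto_pochRatio {l : ℝ} (hl : 0 < l) : Tendsto (pochRatio l) atTop (𝓝 0) := by
  have hb : ∀ k : ℕ, ‖pochRatio l (k + 1)‖ ≤ binBound l * ((k + 1 : ℕ) : ℝ)⁻¹ := by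
    intro k
    have hk : (0 : ℝ) < ((k + 1 : ℕ) : ℝ) := by positivity
    rw [Real.norm_eq_abs, ← div_eq_mul_inv, le_div_iff₀ hk]
    have := natMul_abs_binCoeff_le hl (k + 1)
    calc _ ≤ |binCoeff l (k + 1)| * ((k + 1 : ℕ) : ℝ) := 
          mul_le_mul_of_nonneg_right (abs_pochRatio_le hl _) hk.le
      _ ≤ _ := by linarith
  rw [← tendsto_add_atTop_iff_nat 1]
  refine squeeze_zero_norm hb ?_
  simpa using ((tendsto_add_atTop_iff_nat 1).2
    (tendsto_inv_atTop_nhds_zero_nat (𝕜 := ℝ))).const_mul (binBound l)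

/-- For m = 1 the coefficients simplify to (l+1)(-l)_k / (l+1)_{k+1}, which telescope through the
ratios (-l)_k / (l+1)_k. This is the base case not covered by the certificate used for m ≥ 1. -/
theorem hypSum_one_one {l : ℝ} (hl : 0 < l) : (2 * l + 1) * hypSum l 1 1 = l + 1 := by
  have h := (hasSum_hypCoeff_one hl 1).mul_left (2 * l + 1)
  have h2 := hasSum_of_telescoping h.summable (G := fun k => -(l + 1) * pochRatio l k) ?_ ?_
  · rw [h.unique h2]; simp [pochRatio]
  · intro k
    have h1 : l + 1 + k ≠ 0 := by positivity
    have hp := (poch_pos (a := l + 1) (by positivity) k).ne'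
    have hp' := (poch_pos (a := 1 + l + 1) (by positivity) k).ne'
    have hf : (k.factorial : ℝ) ≠ 0 := by positivity
    have e2 : poch (l + 1) k * (l + 1 + k) = (l + 1) * poch (1 + l + 1) k := by
      rw [← poch_succ, poch_succ_left]; ring_nf
    have e : (l + 1 + k) * hypCoeff l 1 k = (l + 1) * pochRatio l k := by
      rw [hypCoeff, pochRatio, binCoeff, Nat.cast_one, poch_one]
      field_simp
      linear_combination poch (-l) k * e2
    have e3 := pochRatio_succ hl k
    have : (l + 1 + k) * ((2 * l + 1) * hypCoeff l 1 k) =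
        (l + 1 + k) * (-(l + 1) * pochRatio l (k + 1) - -(l + 1) * pochRatio l k) := by
      linear_combination (2 * l + 1) * e + (l + 1) * e3
    exact mul_left_cancel₀ h1 this
  · simpa using (tendsto_pochRatio hl).const_mul (-(l + 1))

/-- The difference of the two sides is summed termwise by a telescoping certificate: with c_k the
coefficients for m, it is the increment of -(m+l+1)/m · k c_k. The certificate vanishes at k = 0 and
at infinity; it divides by m, so m = 0 is separate. -/
theorem hypSum_one_succ {l : ℝ} (hl : 0 < l) (m : ℕ) :
    (m + 2 * l + 1) * hypSum l (m + 1) 1 = (m + l + 1) * hypSum l m 1 := by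
  rcases m.eq_zero_or_pos with rfl | hm
  · simpa [hypSum_zero_left] using hypSum_one_one hl
  have h := ((hasSum_hypCoeff_one hl (m + 1)).mul_left (m + 2 * l + 1)).sub
    ((hasSum_hypCoeff_one hl m).mul_left (m + l + 1))
  have hm0 : (m : ℝ) ≠ 0 := by positivity
  have h2 := hasSum_of_telescoping h.summable
    (G := fun k => -(m + l + 1) / m * (k * hypCoeff l m k)) ?_ ?_
  · have := h.unique h2
    simp only [CharP.cast_eq_zero, zero_mul, mul_zero, neg_zero] at this
    linarith
  · intro k
    have h1 : (m : ℝ) + l + 1 + k ≠ 0 := by positivity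
    have e1 := hypCoeff_succ hl m k
    have e2 := hypCoeff_succ_left hl m k
    have : m * (m + l + 1 + k) * ((m + 2 * l + 1) * hypCoeff l (m + 1) k -
        (m + l + 1) * hypCoeff l m k) = m * (m + l + 1 + k) *
        (-(m + l + 1) / m * ((k + 1 : ℕ) * hypCoeff l m (k + 1)) -
          -(m + l + 1) / m * (k * hypCoeff l m k)) := by
      have hc : m * (-(m + l + 1) / m) = -(m + l + 1) := by field_simp
      push_cast
      linear_combination (m + 2 * l + 1) * e2 + (m + l + 1) * e1 - (m + l + 1 + k) *
        ((k + 1) * hypCoeff l m (k + 1) - k * hypCoeff l m k) * hc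
    exact mul_left_cancel₀ (by positivity) this
  · simpa using (tendsto_natMul_hypCoeff hl m).const_mul (-(m + l + 1) / m)

/-- Gauss's evaluation at `1`. -/
theorem hypSum_one {l : ℝ} (hl : 0 < l) (m : ℕ) :
    hypSum l m 1 = poch (l + 1) m / poch (2 * l + 1) m := by
  induction m with
  | zero => simp [hypSum_zero_left]
  | succ m ih =>
    have h := hypSum_one_succ hl m
    have h1 : (m : ℝ) + 2 * l + 1 ≠ 0 := by positivity
    have h2 := (poch_pos (a := 2 * l + 1) (by positivity) m).ne'
    have h3 : 2 * l + 1 + m ≠ 0 := by positivity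
    rw [ih] at h
    rw [poch_succ, poch_succ]
    field_simp at h ⊢
    linear_combination h

theorem hypSum_one_pos {l : ℝ} (hl : 0 < l) (m : ℕ) : 0 < hypSum l m 1 := by
  rw [hypSum_one hl]
  exact div_pos (poch_pos (by positivity) m) (poch_pos (by positivity) m)

theorem continuousOn_hypSum {l : ℝ} (hl : 0 < l) (m : ℕ) :
    ContinuousOn (hypSum l m) (Icc (-1) 1) := continuousOn_powerSum_Icc (summable_abs_hypCoeff hl m)

theorem contDiffOn_hypSum {l : ℝ} (hl : 0 < l) (m : ℕ) :
    ContDiffOn ℝ 2 (hypSum l m) (Ioo (-1) 1) := contDiffOn_powerSum 2 (convergesInside_hypCoeff hl m)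

/-- The hypergeometric differential equation. -/
theorem hypSum_ode {l : ℝ} (hl : 0 < l) (m : ℕ) {t : ℝ} (ht : |t| < 1) :
    t * (1 - t) * powerSum (derivCoeff (derivCoeff (hypCoeff l m))) t +
      ((m + l + 1) - (m - l + 1) * t) * powerSum (derivCoeff (hypCoeff l m)) t
      + m * l * hypSum l m t = 0 := by
  have ha := convergesInside_hypCoeff hl m
  set a := hypCoeff l m with hadef
  have h1 := mul_powerSum_derivCoeff ha ht
  have h2 := mul_powerSum_derivCoeff ha.derivCoeff ht
  -- With S the sum of the series, the coefficients (k-1) a_k belong to tS' - S, whose derivative is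
  -- tS''; this expresses t²S'' without shifting indices twice.
  have ha' : ConvergesInside fun k : ℕ => (k : ℝ) * a k + (-1) * a k :=
    ha.natMul.add (ha.const_mul (-1))
  have h3 := mul_powerSum_derivCoeff ha' ht
  have e3 : derivCoeff (fun k : ℕ => (k : ℝ) * a k + (-1) * a k) =
      fun k : ℕ => (k : ℝ) * derivCoeff a k := by
    funext k; simp only [derivCoeff]; push_cast; ring
  rw [e3, ← h2] at h3
  have hs := (((ha.derivCoeff.natMul.hasSum ht).add
    ((ha.derivCoeff.hasSum ht).mul_left (m + l + 1))).sub
    ((ha'.natMul.hasSum ht).add ((ha.natMul.hasSum ht).mul_left (m - l + 1)))).add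
    ((ha.hasSum ht).mul_left (m * l))
  have h0 : HasSum (fun _ : ℕ => (0 : ℝ)) 0 := hasSum_zero
  have := hs.unique (h0.congr_fun fun k => ?_)
  · rw [← h2, ← h3, ← h1] at this
    rw [hypSum]
    linear_combination this
  · have e := hypCoeff_succ hl m k
    rw [← hadef] at e
    simp only [derivCoeff]
    linear_combination t ^ k * e

/-! ### The regular part of the kernel profile -/

/-- The coefficients of `∑_{k ≥ 1} -(-l)ₖ / ((l+1)ₖ k) tᵏ`. -/
noncomputable def regCoeff (l : ℝ) (k : ℕ) : ℝ := -(pochRatio l k / k)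

@[simp] theorem regCoeff_zero (l : ℝ) : regCoeff l 0 = 0 := by simp [regCoeff]

/-- The part of the kernel profile that is continuous up to `1`. -/
noncomputable def regPart (l : ℝ) : ℝ → ℝ := powerSum (regCoeff l)

@[simp] theorem regPart_zero (l : ℝ) : regPart l 0 = 0 := by simp [regPart, powerSum_zero]

theorem summable_abs_regCoeff {l : ℝ} (hl : 0 < l) : Summable fun k => |regCoeff l k| := by
  refine summable_abs_of_sq_mul_le (C := binBound l) fun k => ?_
  rcases k with _ | k
  · simpa using zero_le_one.trans (one_le_binBound hl)
  · rw [regCoeff, abs_neg, abs_div, Nat.abs_cast]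
    have hk : (0 : ℝ) < ((k + 1 : ℕ) : ℝ) := by positivity
    calc _ = ((k + 1 : ℕ) : ℝ) * |pochRatio l (k + 1)| := by field_simp
      _ ≤ ((k + 1 : ℕ) : ℝ) * |binCoeff l (k + 1)| :=
          mul_le_mul_of_nonneg_left (abs_pochRatio_le hl _) hk.le
      _ ≤ _ := natMul_abs_binCoeff_le hl _

theorem convergesInside_regCoeff {l : ℝ} (hl : 0 < l) : ConvergesInside (regCoeff l) :=
  convergesInside_of_summable (summable_abs_regCoeff hl)

theorem continuousOn_regPart {l : ℝ} (hl : 0 < l) : ContinuousOn (regPart l) (Icc (-1) 1) :=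
  continuousOn_powerSum_Icc (summable_abs_regCoeff hl)

theorem contDiffOn_regPart {l : ℝ} (hl : 0 < l) : ContDiffOn ℝ 2 (regPart l) (Ioo (-1) 1) :=
  contDiffOn_powerSum 2 (convergesInside_regCoeff hl)

theorem derivCoeff_regCoeff (l : ℝ) (k : ℕ) : derivCoeff (regCoeff l) k = -pochRatio l (k + 1) := by
  have : ((k : ℝ) + 1) ≠ 0 := by positivity
  rw [derivCoeff, regCoeff]; push_cast; field_simp

/-- The two-term recurrence of the derivative's coefficients b_k cancels every positive power of t;
the right side is the surviving constant term (l+1) b_0 = l. -/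
theorem regPart_ode {l : ℝ} (hl : 0 < l) {t : ℝ} (ht : |t| < 1) :
    t * (1 - t) * powerSum (derivCoeff (derivCoeff (regCoeff l))) t +
      (2 * l * t + (l + 1) * (1 - t)) * powerSum (derivCoeff (regCoeff l)) t = l := by
  have ha := (convergesInside_regCoeff hl).derivCoeff
  set b := derivCoeff (regCoeff l) with hb
  have hbk : ∀ k : ℕ, (l + 1 + k + 1) * b (k + 1) = (k + 1 - l) * b k := by
    intro k
    have := pochRatio_succ hl (k + 1)
    rw [hb, derivCoeff_regCoeff, derivCoeff_regCoeff]
    push_cast at this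
    linear_combination -this
  have hb0 : (l + 1) * b 0 = l := by
    have := pochRatio_succ hl 0
    rw [hb, derivCoeff_regCoeff]
    simp only [pochRatio, poch_zero, CharP.cast_eq_zero] at this ⊢
    linear_combination -this
  have h1 := mul_powerSum_derivCoeff ha ht
  have hs1 := (ha.natMul.hasSum ht).add ((ha.hasSum ht).mul_left (l + 1))
  have hs2 := ((ha.natMul.hasSum ht).add ((ha.hasSum ht).mul_left (1 - l))).mul_left t
  have hs1' := (hasSum_nat_add_iff' 1).2 hs1
  have := hs1'.unique (hs2.congr_fun fun k => ?_)
  · rw [← h1] at this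
    simp only [Finset.range_one, Finset.sum_singleton, CharP.cast_eq_zero, zero_mul, pow_zero,
      mul_one, zero_add] at this
    linear_combination this + hb0
  · have e := hbk k
    push_cast
    linear_combination t ^ (k + 1) * e

theorem regPart_eq_hyp32 {l : ℝ} (hl : 0 < l) {x : ℝ} :
    regPart l x = l / (l + 1) * x * hyp32 (1 - l) 1 1 2 (l + 2) x := by
  have h0 : regPart l x = ∑' k : ℕ, regCoeff l (k + 1) * x ^ (k + 1) := by
    -- No bound on x is needed: where the series diverges, both sums take the default value 0.
    by_cases hs : Summable fun k => regCoeff l k * x ^ k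
    · rw [regPart, powerSum, hs.tsum_eq_zero_add]; simp
    · rw [regPart, powerSum, tsum_eq_zero_of_not_summable hs, tsum_eq_zero_of_not_summable]
      rwa [summable_nat_add_iff 1 (f := fun k => regCoeff l k * x ^ k)]
  rw [h0, hyp32, ← tsum_mul_left]
  refine tsum_congr fun k => ?_
  change _ = _ * (poch (1 - l) k * poch 1 k * poch 1 k / (poch 2 k * poch (l + 2) k * _) * _)
  have h2 : poch 2 k = (k + 1).factorial := by
    have := poch_succ_left 1 k
    rw [poch_one] at this
    rw [this]; norm_num
  rw [h2, regCoeff, pochRatio, poch_succ_left, poch_succ_left, poch_one, Nat.factorial_succ]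
  have h3 := (poch_pos (a := l + 2) (by positivity) k).ne'
  rw [show l + 1 + 1 = l + 2 by ring, show -l + 1 = 1 - l by ring]
  push_cast
  field_simp
  ring

/-! ### Evaluation of f_n -/

/-- The integrand hypergeometric function as a power series. -/
theorem ordinaryHypergeometric_ode {n : ℕ} {l : ℝ} (hl : 0 < l) (hn : (n : ℝ) = 2 * (l + 1)) :
    ∃ a : ℕ → ℝ, ConvergesInside a ∧
      (∀ t, ordinaryHypergeometric (n : ℝ) (l + 1) (l + 2) t = powerSum a t) ∧
      ∀ t, |t| < 1 → (l + 1) * powerSum a t + t * powerSum (derivCoeff a) t =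
        (l + 1) * (1 / (1 - t) ^ n) := by
  obtain ⟨p, rfl⟩ : ∃ p, n = p + 1 := by
    refine Nat.exists_eq_succ_of_ne_zero fun h => ?_
    subst h; push_cast at hn; linarith
  have hch : ∀ k, poch ((p + 1 : ℕ) : ℝ) k / k.factorial = ((k + p).choose p : ℝ) := by
    intro k
    rw [poch, ascPochhammer_nat_eq_natCast_ascFactorial, Nat.ascFactorial_eq_factorial_mul_choose,
      Nat.add_comm p k, Nat.choose_symm_add]
    push_cast
    field_simp
  -- Since (l+1)_k / (l+2)_k = (l+1)/(l+1+k) and (n)_k / k! is the coefficient of (1-t)^(-n), the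
  -- operator (l+1) + t d/dt sends the series to (l+1)(1-t)^(-n).
  let a : ℕ → ℝ := fun k => (l + 1) / (l + 1 + k) * ((k + p).choose p : ℝ)
  have hk : ∀ k : ℕ, (l + 1 + k) * a k = (l + 1) * ((k + p).choose p : ℝ) := fun k => by
    simp only [a]; field_simp
  have ha : ConvergesInside a := by
    intro r h0 h1
    have hs := (hasSum_choose_mul_geometric_of_norm_lt_one (𝕜 := ℝ) p (r := r)
      (by rwa [Real.norm_eq_abs, abs_of_nonneg h0])).summable
    refine Summable.of_nonneg_of_le (fun k => by positivity) (fun k => ?_) hs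
    have : (l + 1) / (l + 1 + k) ≤ 1 := by
      rw [div_le_one (by positivity)]; linarith [k.cast_nonneg (α := ℝ)]
    refine mul_le_mul_of_nonneg_right ?_ (by positivity)
    rw [abs_of_nonneg (by positivity)]
    exact mul_le_of_le_one_left (by positivity) this
  refine ⟨a, ha, fun t => ?_, fun t ht => ?_⟩
  · rw [ordinaryHypergeometric_eq_tsum, powerSum]
    refine tsum_congr fun k => ?_
    rw [smul_eq_mul]
    congr 1
    change _ * poch _ k * poch (l + 1) k * (poch (l + 2) k)⁻¹ = _
    have e2 : poch (l + 1) k * (l + 1 + k) = (l + 1) * poch (l + 2) k := by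
      rw [← poch_succ, poch_succ_left]; ring_nf
    have h3 := (poch_pos (a := l + 2) (by positivity) k).ne'
    simp only [a]
    rw [← hch k]
    field_simp
    linear_combination poch ((p + 1 : ℕ) : ℝ) k * e2
  · rw [mul_powerSum_derivCoeff ha ht]
    have hs := ((ha.hasSum ht).mul_left (l + 1)).add (ha.natMul.hasSum ht)
    have hs2 := (hasSum_choose_mul_geometric_of_norm_lt_one (𝕜 := ℝ) p (r := t) ht).mul_left (l + 1)
    refine hs.unique (hs2.congr_fun fun k => ?_)
    linear_combination t ^ k * hk k

/-- Both sides solve the same inhomogeneous first-order linear equation, singular at 0. Their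
difference D solves the homogeneous one, whose nonzero solutions blow up at 0, whereas D is regular
there. -/
theorem one_sub_pow_mul_ordinaryHypergeometric {n : ℕ} {l : ℝ} (hl : 0 < l) (hn2 : 2 ≤ n)
    (hn : (n : ℝ) = 2 * (l + 1)) {t : ℝ} (ht : |t| < 1) :
    (1 - t) ^ (n - 2) * ordinaryHypergeometric (n : ℝ) (l + 1) (l + 2) t =
      (l + 1) / (2 * l + 1) * (1 / (1 - t) + powerSum (derivCoeff (regCoeff l)) t) := by
  obtain ⟨a, ha, hF, hode⟩ := ordinaryHypergeometric_ode hl hn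
  have hr := (convergesInside_regCoeff hl).derivCoeff
  set c := derivCoeff (regCoeff l) with hc
  obtain ⟨p, rfl⟩ : ∃ p, n = p + 2 := ⟨n - 2, by omega⟩
  have hp : (p : ℝ) = 2 * l := by push_cast at hn; linarith
  simp only [add_tsub_cancel_right]
  have hl1 : 2 * l + 1 ≠ 0 := by positivity
  let D : ℝ → ℝ := fun s => (1 - s) ^ p * powerSum a s -
    (l + 1) / (2 * l + 1) * (1 / (1 - s) + powerSum c s)
  let D' : ℝ → ℝ := fun s => (p * (1 - s) ^ (p - 1) * (0 - 1) * powerSum a s +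
    (1 - s) ^ p * powerSum (derivCoeff a) s) -
    (l + 1) / (2 * l + 1) * (1 / (1 - s) ^ 2 + powerSum (derivCoeff c) s)
  have hD : ∀ s, |s| < 1 → HasDerivAt D (D' s) s := by
    intro s hs
    have h1 : 1 - s ≠ 0 := by have := (abs_lt.1 hs).2; linarith
    have hd1 : HasDerivAt (fun s : ℝ => 1 - s) (0 - 1) s :=
      (hasDerivAt_const s (1 : ℝ)).sub (hasDerivAt_id s)
    have hd2 : HasDerivAt (fun s : ℝ => 1 / (1 - s)) (1 / (1 - s) ^ 2) s := by
      simp only [one_div]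
      exact (hd1.inv h1).congr_deriv (by norm_num)
    exact ((hd1.pow p).mul (hasDerivAt_powerSum ha hs)).sub
      ((hd2.add (hasDerivAt_powerSum hr hs)).const_mul _)
  have hD0 : ∀ s, |s| < 1 → s * (1 - s) * D' s + (2 * l * s + (l + 1) * (1 - s)) * D s = 0 := by
    intro s hs
    have h1 : 1 - s ≠ 0 := by have := (abs_lt.1 hs).2; linarith
    have e1 := hode s hs
    have e2 := regPart_ode hl hs
    rw [← hc] at e2
    have e3 : (1 - s) * (p * (1 - s) ^ (p - 1)) = 2 * l * (1 - s) ^ p := by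
      rcases p with _ | p
      · simp at hp; linarith
      · rw [hp, add_tsub_cancel_right, pow_succ]; ring
    have e4 : (1 - s) ^ (p + 1) * (1 / (1 - s) ^ (p + 2)) = 1 / (1 - s) := by
      field_simp
      ring
    have e5 : (1 - s) * (1 / (1 - s)) = 1 := by field_simp
    have e6 : (1 - s) * (1 / (1 - s) ^ 2) = 1 / (1 - s) := by field_simp
    have e7 : (l + 1) / (2 * l + 1) * (2 * l + 1) = l + 1 := by field_simp
    simp only [D, D']
    rw [pow_succ] at e4
    linear_combination (1 - s) ^ p * (1 - s) * e1 + (l + 1) * e4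
      - (l + 1) / (2 * l + 1) * e2 - s * powerSum a s * e3
      - (l + 1) / (2 * l + 1) * s * e6 + (l + 1) / (2 * l + 1) * l * e5
      - (1 / (1 - s)) * e7
  have hz : ∀ s, |s| < 1 → D s = 0 := by
    intro s hs
    rcases eq_or_ne s 0 with rfl | hs0
    · have := hD0 0 hs
      simp only [zero_mul, mul_zero, zero_add, sub_zero, mul_one] at this
      exact (mul_eq_zero.1 this).resolve_left (by positivity)
    -- Multiplying D by the integrating factor s^(l+1) (1-s)^(-2l) gives a constant. The square is
    -- used, with p = 2l, to keep integer exponents for odd n and negative s; the constant is 0 by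
    -- its value at s = 0.
    · have hd : ∀ s, |s| < 1 →
          HasDerivAt (fun s => s ^ (p + 2) * D s ^ 2 / (1 - s) ^ (2 * p)) 0 s := by
        clear_value D D'
        intro s hs
        have h1 : 1 - s ≠ 0 := by have := (abs_lt.1 hs).2; linarith
        have hd1 : HasDerivAt (fun s : ℝ => 1 - s) (0 - 1) s :=
          (hasDerivAt_const s (1 : ℝ)).sub (hasDerivAt_id s)
        have h2 := (((hasDerivAt_pow (p + 2) s).mul ((hD s hs).pow 2)).div
          (hd1.pow (2 * p)) (pow_ne_zero _ h1))
        refine h2.congr_deriv ?_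
        rw [div_eq_zero_iff]
        left
        refine (mul_eq_zero.1 (?_ : (1 - s) * _ = 0)).resolve_left h1
        have e3 : (1 - s) * ((2 * p : ℕ) * (1 - s) ^ (2 * p - 1)) =
            2 * p * (1 - s) ^ (2 * p) := by
          rcases p with _ | p
          · simp
          · rw [show 2 * (p + 1) - 1 = 2 * p + 1 by omega, show 2 * (p + 1) = 2 * p + 1 + 1 by omega]
            push_cast; ring
        have e := hD0 s hs
        simp only [Pi.mul_apply, Pi.pow_apply, show p + 2 - 1 = p + 1 by omega, show 2 - 1 = 1 by omega, pow_one]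
        push_cast at e3 ⊢
        rw [hp] at e3 ⊢
        linear_combination (s ^ (p + 2) * D s ^ 2) * e3 +
          2 * s ^ (p + 1) * D s * (1 - s) ^ (2 * p) * e
      have key := isOpen_Ioo.is_const_of_deriv_eq_zero isPreconnected_Ioo
        (fun s hs => (hd s (abs_lt.2 hs)).differentiableAt.differentiableWithinAt)
        (fun s hs => (hd s (abs_lt.2 hs)).deriv) (abs_lt.1 hs) (abs_lt.1 (by simp : |(0 : ℝ)| < 1))
      have h1 : 1 - s ≠ 0 := by have := (abs_lt.1 hs).2; linarith
      simpa [hs0, h1] using key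
  have := hz t ht
  simp only [D] at this
  rw [hF]
  linarith

theorem fn_eq_regPart {n : ℕ} {l : ℝ} (hl : 0 < l) (hn2 : 2 ≤ n)
    (hn : (n : ℝ) = 2 * (l + 1)) {x : ℝ} (hx : |x| < 1) :
    fn n x = (l + 1) / (2 * l + 1) * (-Real.log (1 - x) + regPart l x) := by
  have hsub : ∀ t ∈ uIcc 0 x, |t| < 1 := by
    intro t ht
    rw [abs_lt] at hx ⊢
    rcases le_total 0 x with h | h
    · rw [uIcc_of_le h] at ht; constructor <;> linarith [ht.1, ht.2]
    · rw [uIcc_of_ge h] at ht; constructor <;> linarith [ht.1, ht.2]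
  have hr := (convergesInside_regCoeff hl)
  rw [fn, intervalIntegral.integral_congr (g := fun t => (l + 1) / (2 * l + 1) *
    (1 / (1 - t) + powerSum (derivCoeff (regCoeff l)) t))]
  · rw [intervalIntegral.integral_eq_sub_of_hasDerivAt
      (f := fun t => (l + 1) / (2 * l + 1) * (-Real.log (1 - t) + regPart l t))]
    · simp
    · intro t ht
      have h := hsub t ht
      have h1 : 1 - t ≠ 0 := by have := (abs_lt.1 h).2; linarith
      have hd1 : HasDerivAt (fun s : ℝ => 1 - s) (0 - 1) t :=
        (hasDerivAt_const t (1 : ℝ)).sub (hasDerivAt_id t)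
      have := ((hd1.log h1).neg.add (hasDerivAt_powerSum hr h)).const_mul ((l + 1) / (2 * l + 1))
      refine this.congr_deriv ?_
      ring
    · apply ContinuousOn.intervalIntegrable
      intro t ht
      have h := hsub t ht
      have h1 : 1 - t ≠ 0 := by have := (abs_lt.1 h).2; linarith
      have h2 := (hasDerivAt_powerSum hr.derivCoeff h).continuousAt
      have h3 : ContinuousAt (fun t : ℝ => 1 / (1 - t)) t := by fun_prop (disch := exact h1)
      exact ((h3.add h2).const_mul _).continuousWithinAt
  · intro t ht
    have e := one_sub_pow_mul_ordinaryHypergeometric hl hn2 hn (hsub t ht)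
    have e1 : (n : ℝ) / 2 = l + 1 := by linarith
    simp only [e1]
    rw [show 1 + (l + 1) = l + 2 by ring]
    exact e

/-! ### Second-order jets along lines -/

section TwoJet

variable {F : Type*} [NormedAddCommGroup F] [NormedSpace ℝ F]

/-- `f` is differentiable near `0` with value `a`, derivative `b` and second derivative `c` at
`0`. -/
def HasTwoJet (f : ℝ → F) (a b c : F) : Prop :=
  f 0 = a ∧ ∃ f' : ℝ → F, (∀ᶠ s in 𝓝 0, HasDerivAt f (f' s) s) ∧ f' 0 = b ∧ HasDerivAt f' c 0

theorem HasTwoJet.continuousAt {f : ℝ → F} {a b c : F} (h : HasTwoJet f a b c) :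
    ContinuousAt f 0 := by
  obtain ⟨-, f', h1, -, -⟩ := h
  exact h1.self_of_nhds.continuousAt

theorem HasTwoJet.add {f g : ℝ → F} {a b c a' b' c' : F} (hf : HasTwoJet f a b c)
    (hg : HasTwoJet g a' b' c') : HasTwoJet (fun s => f s + g s) (a + a') (b + b') (c + c') := by
  obtain ⟨rfl, f', h1, rfl, h3⟩ := hf
  obtain ⟨rfl, g', k1, rfl, k3⟩ := hg
  exact ⟨rfl, fun s => f' s + g' s, by filter_upwards [h1, k1] with s x y using x.add y, rfl,
    h3.add k3⟩

theorem HasTwoJet.sub {f g : ℝ → F} {a b c a' b' c' : F} (hf : HasTwoJet f a b c)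
    (hg : HasTwoJet g a' b' c') : HasTwoJet (fun s => f s - g s) (a - a') (b - b') (c - c') := by
  obtain ⟨rfl, f', h1, rfl, h3⟩ := hf
  obtain ⟨rfl, g', k1, rfl, k3⟩ := hg
  exact ⟨rfl, fun s => f' s - g' s, by filter_upwards [h1, k1] with s x y using x.sub y, rfl,
    h3.sub k3⟩

theorem hasTwoJet_const (a : F) : HasTwoJet (fun _ => a) a 0 0 :=
  ⟨rfl, fun _ => 0, Eventually.of_forall fun s => hasDerivAt_const s a, rfl,
    hasDerivAt_const _ _⟩

theorem HasTwoJet.clm {G : Type*} [NormedAddCommGroup G] [NormedSpace ℝ G] (T : F →L[ℝ] G)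
    {f : ℝ → F} {a b c : F} (hf : HasTwoJet f a b c) :
    HasTwoJet (fun s => T (f s)) (T a) (T b) (T c) := by
  obtain ⟨rfl, f', h1, rfl, h3⟩ := hf
  exact ⟨rfl, fun s => T (f' s), by
    filter_upwards [h1] with s x using T.hasFDerivAt.comp_hasDerivAt s x, rfl,
    T.hasFDerivAt.comp_hasDerivAt _ h3⟩

theorem HasTwoJet.unique {f : ℝ → F} {a b c a' b' c' : F} (hf : HasTwoJet f a b c)
    (hg : HasTwoJet f a' b' c') : b = b' ∧ c = c' := by
  obtain ⟨rfl, f', h1, rfl, h3⟩ := hf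
  obtain ⟨-, g', k1, rfl, k3⟩ := hg
  have : f' =ᶠ[𝓝 0] g' := by filter_upwards [h1, k1] with s x y using x.unique y
  exact ⟨this.self_of_nhds, h3.unique (k3.congr_of_eventuallyEq this)⟩

theorem HasTwoJet.mul {A : Type*} [NormedCommRing A] [NormedAlgebra ℝ A] {f g : ℝ → A}
    {a b c a' b' c' : A} (hf : HasTwoJet f a b c) (hg : HasTwoJet g a' b' c') :
    HasTwoJet (fun s => f s * g s) (a * a') (b * a' + a * b') (c * a' + 2 * (b * b') + a * c') := by
  obtain ⟨rfl, f', h1, rfl, h3⟩ := hf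
  obtain ⟨rfl, g', k1, rfl, k3⟩ := hg
  refine ⟨rfl, fun s => f' s * g s + f s * g' s, by
    filter_upwards [h1, k1] with s x y using x.mul y, rfl, ?_⟩
  refine ((h3.mul k1.self_of_nhds).add (h1.self_of_nhds.mul k3)).congr_deriv ?_
  ring

theorem HasTwoJet.comp {φ φ' : ℝ → ℝ} {φ'' : ℝ} {f : ℝ → ℝ} {a b c : ℝ}
    (hφ : ∀ᶠ t in 𝓝 a, HasDerivAt φ (φ' t) t) (hφ' : HasDerivAt φ' φ'' a)
    (hf : HasTwoJet f a b c) :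
    HasTwoJet (fun s => φ (f s)) (φ a) (φ' a * b) (φ'' * b ^ 2 + φ' a * c) := by
  have hc := hf.continuousAt
  obtain ⟨rfl, f', h1, rfl, h3⟩ := hf
  refine ⟨rfl, fun s => φ' (f s) * f' s, ?_, rfl, ?_⟩
  · filter_upwards [h1, hc.eventually hφ] with s x y using y.comp s x
  · refine ((hφ'.comp 0 h1.self_of_nhds).mul h3).congr_deriv ?_
    simp only [Function.comp_apply]
    ring

theorem hasTwoJet_quadratic (a b c : ℝ) :
    HasTwoJet (fun s : ℝ => a + b * s + c * s ^ 2) a b (2 * c) := by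
  refine ⟨by simp, fun s => b + 2 * c * s, Eventually.of_forall fun s => ?_, by simp, ?_⟩
  · refine ((((hasDerivAt_id s).const_mul b).const_add a).add
      ((hasDerivAt_pow 2 s).const_mul c)).congr_deriv ?_
    simp; ring
  · simpa using (((hasDerivAt_id (0 : ℝ)).const_mul (2 * c)).const_add b)

/-- If c were positive, 0 would also be a local minimum, so f would be locally constant and c would
vanish. -/
theorem HasTwoJet.of_isLocalMax {f : ℝ → ℝ} {a b c : ℝ} (hf : HasTwoJet f a b c)
    (h : IsLocalMax f 0) : b = 0 ∧ c ≤ 0 := by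
  have hc := hf.continuousAt
  obtain ⟨rfl, f', h1, rfl, h3⟩ := hf
  have hb : f' 0 = 0 := h.hasDerivAt_eq_zero h1.self_of_nhds
  refine ⟨hb, ?_⟩
  by_contra! hpos
  have hd : deriv f =ᶠ[𝓝 0] f' := by filter_upwards [h1] with s x using x.deriv
  have hdd : deriv (deriv f) 0 = c := (h3.congr_of_eventuallyEq hd).deriv
  have hmin := isLocalMin_of_deriv_deriv_pos (f := f) (x₀ := 0) (by rw [hdd]; exact hpos)
    (by rw [hd.self_of_nhds, hb]) hc
  have heq : f =ᶠ[𝓝 0] fun _ => f 0 := by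
    filter_upwards [h, hmin] with s x y using le_antisymm x y
  have h4 : deriv f =ᶠ[𝓝 0] fun _ => 0 := by
    refine heq.deriv.trans (Eventually.of_forall fun s => ?_)
    simp
  have h5 : deriv (deriv f) 0 = 0 := by rw [h4.deriv_eq]; simp
  linarith

/-- This links jets to the Fréchet derivatives in the definition of the operator. With uniqueness of
jets, the hyperbolic Laplacian can be computed from one-variable calculus along coordinate lines. -/
theorem hasTwoJet_line {V : Type*} [NormedAddCommGroup V] [NormedSpace ℝ V] {f : V → F} {x : V}
    (hf : ContDiffAt ℝ 2 f x) (v : V) :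
    HasTwoJet (fun s : ℝ => f (x + s • v)) (f x) (fderiv ℝ f x v)
      (iteratedFDeriv ℝ 2 f x ![v, v]) := by
  have hline : ∀ s : ℝ, HasDerivAt (fun s : ℝ => x + s • v) v s := fun s => by
    simpa using ((hasDerivAt_id s).smul_const v).const_add x
  have hcont : Tendsto (fun s : ℝ => x + s • v) (𝓝 0) (𝓝 x) := by
    simpa using (hline 0).continuousAt.tendsto
  refine ⟨by simp, fun s => fderiv ℝ f (x + s • v) v, ?_, by simp, ?_⟩
  · have h1 : ∀ᶠ z in 𝓝 x, DifferentiableAt ℝ f z :=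
      (hf.eventually (by simp)).mono fun z hz => hz.differentiableAt two_ne_zero
    filter_upwards [hcont.eventually h1] with s hs
    exact hs.hasFDerivAt.comp_hasDerivAt s (hline s)
  · have h2 : DifferentiableAt ℝ (fderiv ℝ f) x :=
      (hf.fderiv_right (m := 1) (by norm_num)).differentiableAt one_ne_zero
    have h3 : HasFDerivAt (fderiv ℝ f) (fderiv ℝ (fderiv ℝ f) x) (x + (0 : ℝ) • v) := by
      simpa using h2.hasFDerivAt
    have h4 := h3.comp_hasDerivAt 0 (hline 0)
    have h5 := (ContinuousLinearMap.apply ℝ F v).hasFDerivAt.comp_hasDerivAt 0 h4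
    rw [iteratedFDeriv_two_apply]
    exact h5

end TwoJet

/-! ### The hyperbolic Laplacian in coordinates and the maximum principle -/

/-- The standard unit vectors. -/
noncomputable def stdVec {n : ℕ} (i : Fin n) : E n := EuclideanSpace.single i 1

theorem stdVec_apply {n : ℕ} (i j : Fin n) : (stdVec i : E n) j = if j = i then 1 else 0 := by
  simp [stdVec]

theorem sum_smul_stdVec {n : ℕ} (x : E n) : ∑ i, x i • (stdVec i : E n) = x := by
  ext j
  simp [stdVec_apply]

theorem laplacian_eq_sum {n : ℕ} (f : E n → ℂ) (x : E n) :
    Laplacian.laplacian f x = ∑ i, iteratedFDeriv ℝ 2 f x ![stdVec i, stdVec i] := by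
  have := congrFun (InnerProductSpace.laplacian_eq_iteratedFDeriv_orthonormalBasis f
    (EuclideanSpace.basisFun (Fin n) ℝ)) x
  simpa [stdVec] using this

theorem fderiv_self_eq_sum {n : ℕ} (f : E n → ℂ) (x : E n) :
    fderiv ℝ f x x = ∑ i, (x i : ℂ) * fderiv ℝ f x (stdVec i) := by
  conv_lhs => rw [← sum_smul_stdVec x]
  rw [map_sum, sum_smul_stdVec]
  simp

theorem hypLaplacian_eq_sum {n : ℕ} {f : E n → ℂ} {x : E n} (hf : ContDiffAt ℝ 2 f x)
    {b c : Fin n → ℂ} (h : ∀ i, HasTwoJet (fun s : ℝ => f (x + s • stdVec i)) (f x) (b i) (c i)) :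
    hypLaplacian f x = ((1 - ‖x‖ ^ 2 : ℝ) : ℂ) *
      (((1 - ‖x‖ ^ 2 : ℝ) : ℂ) * ∑ i, c i + 2 * ((n : ℂ) - 2) * ∑ i, (x i : ℂ) * b i) := by
  rw [hypLaplacian, laplacian_eq_sum, fderiv_self_eq_sum]
  have := fun i => (hasTwoJet_line hf (stdVec i)).unique (h i)
  simp_rw [fun i => (this i).1, fun i => (this i).2]

theorem normSq_add_smul_stdVec {n : ℕ} (x : E n) (i : Fin n) (s : ℝ) :
    ‖x + s • stdVec i‖ ^ 2 = ‖x‖ ^ 2 + (2 * x i) * s + 1 * s ^ 2 := by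
  rw [norm_add_sq_real, norm_smul, inner_smul_right]
  simp [stdVec, EuclideanSpace.inner_single_right]
  ring

theorem hasTwoJet_normSq {n : ℕ} (x : E n) (i : Fin n) :
    HasTwoJet (fun s : ℝ => ‖x + s • stdVec i‖ ^ 2) (‖x‖ ^ 2) (2 * x i) 2 := by
  simp_rw [normSq_add_smul_stdVec]
  simpa using hasTwoJet_quadratic (‖x‖ ^ 2) (2 * x i) 1

theorem sum_sq_eq_normSq {n : ℕ} (x : E n) : ∑ i, x i ^ 2 = ‖x‖ ^ 2 := by
  rw [EuclideanSpace.norm_sq_eq]; simp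

theorem sum_mul_eq_inner {n : ℕ} (x y : E n) : ∑ i, x i * y i = inner ℝ x y := by
  simp [PiLp.inner_apply, mul_comm]

theorem IsHHarmonic.contDiffAt {n : ℕ} {f : E n → ℂ} (hf : IsHHarmonic f) {x : E n}
    (hx : x ∈ unitBall n) : ContDiffAt ℝ 2 f x :=
  hf.1.contDiffAt (isOpen_ball.mem_nhds hx)

theorem one_sub_normSq_pos {n : ℕ} {x : E n} (hx : x ∈ unitBall n) : 0 < 1 - ‖x‖ ^ 2 := by
  have h : ‖x‖ < 1 := by simpa using hx
  nlinarith [norm_nonneg x]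

/-- Weak maximum principle for the real part. -/
theorem IsHHarmonic.re_le {n : ℕ} (hn : 2 < n) {f : E n → ℂ} (hf : IsHHarmonic f)
    (hc : ContinuousOn f (closedBall 0 1)) {M : ℝ} (hM : ∀ ζ ∈ sphere (0 : E n) 1, (f ζ).re ≤ M)
    {x : E n} (hx : x ∈ closedBall (0 : E n) 1) : (f x).re ≤ M := by
  refine le_of_forall_pos_le_add fun ε hε => ?_
  -- The perturbation makes the inequality strict: at an interior maximum of v, Re f has gradient
  -- -2εz and pure second derivatives at most -2ε. Then the Laplacian part is strictly negative and,
  -- as n > 2, the gradient part is nonpositive, contradicting H-harmonicity.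
  let v : E n → ℝ := fun x => (f x).re + ε * ‖x‖ ^ 2
  have hv : ContinuousOn v (closedBall 0 1) :=
    (Complex.continuous_re.comp_continuousOn hc).add (by fun_prop)
  obtain ⟨z, hz, hmax⟩ := (isCompact_closedBall (0 : E n) 1).exists_isMaxOn ⟨x, hx⟩ hv
  have hxz : v x ≤ v z := hmax hx
  have hfv : (f x).re ≤ v x := by simp only [v]; nlinarith [sq_nonneg ‖x‖]
  suffices v z ≤ M + ε by linarith
  by_cases hzb : z ∈ ball (0 : E n) 1
  · exfalso
    have hloc : IsLocalMax v z := by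
      filter_upwards [isOpen_ball.mem_nhds hzb] with w hw using hmax (ball_subset_closedBall hw)
    have hA := one_sub_normSq_pos hzb
    have hcd := hf.contDiffAt hzb
    have key : ∀ i, (fderiv ℝ f z (stdVec i)).re = -(2 * ε * z i) ∧
        (iteratedFDeriv ℝ 2 f z ![stdVec i, stdVec i]).re ≤ -(2 * ε) := by
      intro i
      have j1 := (hasTwoJet_line hcd (stdVec i)).clm Complex.reCLM
      have j2 := (hasTwoJet_const ε).mul (hasTwoJet_normSq z i)
      have j := (j1.add j2).of_isLocalMax ?_
      · simp only [Complex.reCLM_apply] at j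
        constructor <;> linarith [j.1, j.2]
      · have ht : Tendsto (fun s : ℝ => z + s • (stdVec i : E n)) (𝓝 0) (𝓝 z) := by
          have : ContinuousAt (fun s : ℝ => z + s • (stdVec i : E n)) 0 := by fun_prop
          simpa [ContinuousAt] using this
        filter_upwards [ht.eventually hloc] with s hs
        simpa [v] using hs
    have h0 := hf.2 z hzb
    rw [hypLaplacian_eq_sum hcd (fun i => hasTwoJet_line hcd (stdVec i))] at h0
    have hA' : ((1 - ‖z‖ ^ 2 : ℝ) : ℂ) ≠ 0 := by exact_mod_cast hA.ne'
    have h1 := congrArg Complex.re ((mul_eq_zero.1 h0).resolve_left hA')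
    have e1 : (2 * ((n : ℂ) - 2)) = ((2 * ((n : ℝ) - 2) : ℝ) : ℂ) := by push_cast; ring
    rw [e1, Complex.add_re, Complex.re_ofReal_mul, Complex.re_ofReal_mul, Complex.re_sum,
      Complex.re_sum] at h1
    simp_rw [Complex.re_ofReal_mul, fun i => (key i).1] at h1
    have s1 : ∑ i, (iteratedFDeriv ℝ 2 f z ![stdVec i, stdVec i]).re ≤ ∑ _i : Fin n, -(2 * ε) :=
      Finset.sum_le_sum fun i _ => (key i).2
    have s2 : ∑ i, z i * -(2 * ε * z i) = -(2 * ε) * ‖z‖ ^ 2 := by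
      rw [← sum_sq_eq_normSq, Finset.mul_sum]
      exact Finset.sum_congr rfl fun i _ => by ring
    rw [s2] at h1
    simp only [Finset.sum_const, Finset.card_univ, Fintype.card_fin, nsmul_eq_mul] at s1
    have hn' : (2 : ℝ) < n := by exact_mod_cast hn
    have s3 := mul_le_mul_of_nonneg_left s1 hA.le
    have s4 : 0 < (1 - ‖z‖ ^ 2) * (n * (2 * ε)) := by positivity
    have s5 : 0 ≤ 2 * ((n : ℝ) - 2) * (2 * ε * ‖z‖ ^ 2) := by
      have : (0 : ℝ) ≤ n - 2 := by linarith
      positivity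
    simp only [Complex.zero_re] at h1
    nlinarith
  · have hzs : ‖z‖ = 1 := by
      have h1 : ‖z‖ ≤ 1 := by simpa using hz
      have h2 : ¬ ‖z‖ < 1 := by simpa using hzb
      linarith
    have := hM z (by simpa using hzs)
    simp only [v, hzs]
    linarith

theorem IsHHarmonic.sub {n : ℕ} {f g : E n → ℂ} (hf : IsHHarmonic f) (hg : IsHHarmonic g) :
    IsHHarmonic (fun x => f x - g x) := by
  refine ⟨hf.1.sub hg.1, fun x hx => ?_⟩
  have h1 := hf.contDiffAt hx
  have h2 := hg.contDiffAt hx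
  have e1 := hf.2 x hx
  have e2 := hg.2 x hx
  rw [hypLaplacian_eq_sum h1 fun i => hasTwoJet_line h1 (stdVec i)] at e1
  rw [hypLaplacian_eq_sum h2 fun i => hasTwoJet_line h2 (stdVec i)] at e2
  rw [hypLaplacian_eq_sum (h1.sub h2)
    fun i => (hasTwoJet_line h1 (stdVec i)).sub (hasTwoJet_line h2 (stdVec i))]
  simp only [mul_sub, Finset.sum_sub_distrib]
  linear_combination e1 - e2

theorem IsHHarmonic.const_mul {n : ℕ} {f : E n → ℂ} (hf : IsHHarmonic f) (k : ℂ) :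
    IsHHarmonic (fun x => k * f x) := by
  refine ⟨contDiffOn_const.mul hf.1, fun x hx => ?_⟩
  have h1 := hf.contDiffAt hx
  have e1 := hf.2 x hx
  rw [hypLaplacian_eq_sum h1 fun i => hasTwoJet_line h1 (stdVec i)] at e1
  rw [hypLaplacian_eq_sum (contDiffAt_const.mul h1)
    fun i => (hasTwoJet_const k).mul (hasTwoJet_line h1 (stdVec i))]
  simp only [zero_mul, mul_zero, zero_add, mul_left_comm _ k, ← Finset.mul_sum]
  linear_combination k * e1

/-- Maximum principle for the modulus. -/
theorem IsHHarmonic.norm_le {n : ℕ} (hn : 2 < n) {f : E n → ℂ} (hf : IsHHarmonic f)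
    (hc : ContinuousOn f (closedBall 0 1)) {M : ℝ} (hM : ∀ ζ ∈ sphere (0 : E n) 1, ‖f ζ‖ ≤ M)
    {x : E n} (hx : x ∈ closedBall (0 : E n) 1) : ‖f x‖ ≤ M := by
  by_cases h0 : f x = 0
  · have : Nontrivial (E n) := by
      have : Nonempty (Fin n) := ⟨⟨0, by omega⟩⟩
      infer_instance
    obtain ⟨ζ, hζ⟩ := (NormedSpace.sphere_nonempty (x := (0 : E n)) (r := 1)).2 zero_le_one
    rw [h0, norm_zero]
    exact (norm_nonneg _).trans (hM ζ hζ)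
  have hne : (‖f x‖ : ℂ) ≠ 0 := by exact_mod_cast (norm_pos_iff.2 h0).ne'
  -- Rotation by this unimodular constant makes the value at x equal to its modulus, reducing to the
  -- real part.
  let k : ℂ := conj (f x) / ‖f x‖
  have hk : ‖k‖ = 1 := by
    simp only [k, norm_div, RCLike.norm_conj, Complex.norm_real, norm_norm]
    exact div_self (norm_pos_iff.2 h0).ne'
  have h := (hf.const_mul k).re_le hn (continuousOn_const.mul hc) (M := M) (fun ζ hζ => ?_) hx
  · have e : k * f x = (‖f x‖ : ℂ) := by
      simp only [k]
      rw [div_mul_eq_mul_div, Complex.conj_mul', sq, mul_div_assoc, div_self hne, mul_one]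
    simpa [e] using h
  · refine (Complex.re_le_norm _).trans ?_
    rw [norm_mul, hk, one_mul]
    exact hM ζ hζ

theorem IsHHarmonic.eqOn_of_eqOn_sphere {n : ℕ} (hn : 2 < n) {f g : E n → ℂ}
    (hf : IsHHarmonic f) (hfc : ContinuousOn f (closedBall 0 1)) (hg : IsHHarmonic g)
    (hgc : ContinuousOn g (closedBall 0 1)) (h : ∀ ζ ∈ sphere (0 : E n) 1, f ζ = g ζ) :
    ∀ x ∈ closedBall (0 : E n) 1, f x = g x := fun x hx => by
  have := (hf.sub hg).norm_le hn (hfc.sub hgc) (M := 0) (fun ζ hζ => by simp [h ζ hζ]) hx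
  exact sub_eq_zero.1 (norm_le_zero_iff.1 this)

/-! ### Harmonic polynomials and solid H-harmonics -/

/-- Evaluation of a complex polynomial at a point of Euclidean space. -/
noncomputable def polyEval {n : ℕ} (p : MvPolynomial (Fin n) ℂ) (x : E n) : ℂ :=
  MvPolynomial.eval (fun i => ((x i : ℝ) : ℂ)) p

@[simp] theorem polyEval_C {n : ℕ} (a : ℂ) (x : E n) :
    polyEval (MvPolynomial.C a) x = a := by simp [polyEval]

@[simp] theorem polyEval_X {n : ℕ} (i : Fin n) (x : E n) :
    polyEval (MvPolynomial.X i) x = (x i : ℂ) := by simp [polyEval]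

@[simp] theorem polyEval_add {n : ℕ} (p q : MvPolynomial (Fin n) ℂ) (x : E n) :
    polyEval (p + q) x = polyEval p x + polyEval q x := by simp [polyEval]

@[simp] theorem polyEval_sub {n : ℕ} (p q : MvPolynomial (Fin n) ℂ) (x : E n) :
    polyEval (p - q) x = polyEval p x - polyEval q x := by simp [polyEval]

@[simp] theorem polyEval_mul {n : ℕ} (p q : MvPolynomial (Fin n) ℂ) (x : E n) :
    polyEval (p * q) x = polyEval p x * polyEval q x := by simp [polyEval]

@[simp] theorem polyEval_sum {n : ℕ} {ι : Type*} (s : Finset ι) (p : ι → MvPolynomial (Fin n) ℂ)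
    (x : E n) : polyEval (∑ i ∈ s, p i) x = ∑ i ∈ s, polyEval (p i) x := by simp [polyEval]

@[simp] theorem polyEval_pow {n : ℕ} (p : MvPolynomial (Fin n) ℂ) (k : ℕ) (x : E n) :
    polyEval (p ^ k) x = polyEval p x ^ k := by simp [polyEval]

@[simp] theorem polyEval_zero {n : ℕ} (x : E n) :
    polyEval (0 : MvPolynomial (Fin n) ℂ) x = 0 := by simp [polyEval]

@[simp] theorem polyEval_one {n : ℕ} (x : E n) :
    polyEval (1 : MvPolynomial (Fin n) ℂ) x = 1 := by simp [polyEval]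

@[simp] theorem polyEval_natCast {n : ℕ} (k : ℕ) (x : E n) :
    polyEval (k : MvPolynomial (Fin n) ℂ) x = k := by simp [polyEval]

theorem contDiff_polyEval {n : ℕ} (p : MvPolynomial (Fin n) ℂ) {k : WithTop ℕ∞} :
    ContDiff ℝ k (polyEval p) := by
  induction p using MvPolynomial.induction_on with
  | C a =>
    have : polyEval (MvPolynomial.C a) = fun _ : E n => a := by ext x; simp
    rw [this]; exact contDiff_const
  | add p q hp hq =>
    have : polyEval (p + q) = fun x : E n => polyEval p x + polyEval q x := by ext x; simp
    rw [this]; exact hp.add hq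
  | mul_X p i hp =>
    have h : ContDiff ℝ k fun x : E n => ((x i : ℝ) : ℂ) :=
      Complex.ofRealCLM.contDiff.comp (by fun_prop)
    have : polyEval (p * MvPolynomial.X i) = fun x : E n => polyEval p x * (x i : ℂ) := by
      ext x; simp
    rw [this]; exact hp.mul h

theorem hasDerivAt_polyEval_line {n : ℕ} (p : MvPolynomial (Fin n) ℂ) (x : E n) (i : Fin n)
    (s : ℝ) : HasDerivAt (fun s : ℝ => polyEval p (x + s • stdVec i))
      (polyEval (MvPolynomial.pderiv i p) (x + s • stdVec i)) s := by
  induction p using MvPolynomial.induction_on with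
  | C a => simpa using hasDerivAt_const s a
  | add p q hp hq =>
    simp only [polyEval_add, map_add]
    exact hp.add hq
  | mul_X p j hp =>
    have h1 : HasDerivAt (fun s : ℝ => (((x + s • stdVec i : E n) j : ℝ) : ℂ))
        (((if j = i then 1 else 0 : ℝ)) : ℂ) s := by
      refine HasDerivAt.ofReal_comp ?_
      have := ((hasDerivAt_id s).mul_const ((stdVec i : E n) j)).const_add (x j)
      simpa [stdVec_apply] using this
    have := hp.mul h1
    simp only [polyEval_mul, polyEval_X, MvPolynomial.pderiv_mul, polyEval_add,
      MvPolynomial.pderiv_X]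
    refine this.congr_deriv ?_
    rcases eq_or_ne j i with rfl | hji
    · simp
    · simp [hji]

theorem hasTwoJet_polyEval {n : ℕ} (p : MvPolynomial (Fin n) ℂ) (x : E n) (i : Fin n) :
    HasTwoJet (fun s : ℝ => polyEval p (x + s • stdVec i)) (polyEval p x)
      (polyEval (MvPolynomial.pderiv i p) x)
      (polyEval (MvPolynomial.pderiv i (MvPolynomial.pderiv i p)) x) := by
  refine ⟨by simp, _, Eventually.of_forall fun s => hasDerivAt_polyEval_line p x i s, by simp, ?_⟩
  simpa using hasDerivAt_polyEval_line (MvPolynomial.pderiv i p) x i 0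

theorem sum_mul_polyEval_pderiv {n m : ℕ} {p : MvPolynomial (Fin n) ℂ} (hp : p.IsHomogeneous m)
    (x : E n) :
    ∑ i, (x i : ℂ) * polyEval (MvPolynomial.pderiv i p) x = m * polyEval p x := by
  have := congrArg (fun q => polyEval q x) hp.sum_X_mul_pderiv
  simpa [polyEval] using this

theorem polyEval_smul {n m : ℕ} {p : MvPolynomial (Fin n) ℂ} (hp : p.IsHomogeneous m)
    (r : ℝ) (x : E n) : polyEval p (r • x) = (r : ℂ) ^ m * polyEval p x := by
  rw [polyEval, polyEval, MvPolynomial.eval_eq, MvPolynomial.eval_eq, Finset.mul_sum]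
  refine Finset.sum_congr rfl fun d hd => ?_
  have h := hp (MvPolynomial.mem_support_iff.1 hd)
  have e : (r : ℂ) ^ m = ∏ i ∈ d.support, (r : ℂ) ^ d i := by
    rw [Finset.prod_pow_eq_pow_sum, ← h]
    simp [Finsupp.weight_apply, Finsupp.sum]
  rw [e]
  simp only [PiLp.smul_apply, smul_eq_mul, Complex.ofReal_mul, mul_pow, Finset.prod_mul_distrib]
  ring

/-- The solid `H`-harmonic with boundary values `p`. -/
noncomputable def solidExt {n : ℕ} (l : ℝ) (m : ℕ) (p : MvPolynomial (Fin n) ℂ) (x : E n) : ℂ :=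
  ((hypSum l m (‖x‖ ^ 2) / hypSum l m 1 : ℝ) : ℂ) * polyEval p x

theorem eventually_hasDerivAt_powerSum {a : ℕ → ℝ} (ha : ConvergesInside a) {t : ℝ}
    (ht : |t| < 1) : ∀ᶠ s in 𝓝 t, HasDerivAt (powerSum a) (powerSum (derivCoeff a) s) s := by
  filter_upwards [(isOpen_Ioo (a := (-1 : ℝ)) (b := 1)).mem_nhds (abs_lt.1 ht)] with s hs
  exact hasDerivAt_powerSum ha (abs_lt.2 hs)

theorem abs_normSq_lt_one {n : ℕ} {x : E n} (hx : x ∈ unitBall n) : |‖x‖ ^ 2| < 1 := by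
  rw [abs_of_nonneg (sq_nonneg _)]
  linarith [one_sub_normSq_pos hx]

/-- By Δp = 0 and Euler's identity, applying the operator to h(|x|²) p gives 4(1-|x|²) p times the
left side of the hypergeometric equation for h at t = |x|². -/
theorem isHHarmonic_hypSum_mul {n : ℕ} {l : ℝ} (hl : 0 < l) (hn : (n : ℝ) = 2 * (l + 1)) {m : ℕ}
    {p : MvPolynomial (Fin n) ℂ} (hp : IsHarmonicHomogeneous m p) :
    IsHHarmonic (fun x => (hypSum l m (‖x‖ ^ 2) : ℂ) * polyEval p x) := by
  have hcd : ContDiffOn ℝ 2 (fun x : E n => (hypSum l m (‖x‖ ^ 2) : ℂ) * polyEval p x)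
      (unitBall n) := by
    refine ContDiffOn.mul ?_ (contDiff_polyEval p).contDiffOn
    refine Complex.ofRealCLM.contDiff.comp_contDiffOn ?_
    exact (contDiffOn_hypSum hl m).comp (contDiff_norm_sq ℝ).contDiffOn
      fun x hx => abs_lt.1 (abs_normSq_lt_one hx)
  refine ⟨hcd, fun x hx => ?_⟩
  have ht := abs_normSq_lt_one hx
  have ha := convergesInside_hypCoeff hl m
  have jet := fun i => ((HasTwoJet.comp (eventually_hasDerivAt_powerSum ha ht)
    (hasDerivAt_powerSum ha.derivCoeff ht) (hasTwoJet_normSq x i)).clm Complex.ofRealCLM).mul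
    (hasTwoJet_polyEval p x i)
  rw [hypLaplacian_eq_sum (hcd.contDiffAt (isOpen_ball.mem_nhds hx)) jet]
  have hode := hypSum_ode hl m ht
  simp only [Complex.ofRealCLM_apply]
  set s1 := powerSum (derivCoeff (hypCoeff l m)) (‖x‖ ^ 2)
  set s2 := powerSum (derivCoeff (derivCoeff (hypCoeff l m))) (‖x‖ ^ 2)
  change _ * (_ * ∑ i, ((((s2 * (2 * x i) ^ 2 + s1 * 2 : ℝ) : ℂ) * polyEval p x +
    2 * (((s1 * (2 * x i) : ℝ) : ℂ) * polyEval (MvPolynomial.pderiv i p) x)) +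
    (hypSum l m (‖x‖ ^ 2) : ℂ) * polyEval (MvPolynomial.pderiv i (MvPolynomial.pderiv i p)) x) + 2 * ((n : ℂ) - 2) *
    ∑ i, (x i : ℂ) * (((s1 * (2 * x i) : ℝ) : ℂ) * polyEval p x +
      (hypSum l m (‖x‖ ^ 2) : ℂ) * polyEval (MvPolynomial.pderiv i p) x)) = 0
  have S1 : ∑ i, (x i : ℂ) ^ 2 = (‖x‖ : ℂ) ^ 2 := by exact_mod_cast sum_sq_eq_normSq x
  have S2 := sum_mul_polyEval_pderiv hp.1 x
  have S3 : ∑ i, polyEval (MvPolynomial.pderiv i (MvPolynomial.pderiv i p)) x = 0 := by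
    rw [← polyEval_sum, hp.2, polyEval_zero]
  have e1 : ∑ i, ((((s2 * (2 * x i) ^ 2 + s1 * 2 : ℝ) : ℂ) * polyEval p x +
    2 * (((s1 * (2 * x i) : ℝ) : ℂ) * polyEval (MvPolynomial.pderiv i p) x)) +
    (hypSum l m (‖x‖ ^ 2) : ℂ) * polyEval (MvPolynomial.pderiv i (MvPolynomial.pderiv i p)) x) =
    (4 * s2 * ∑ i, (x i : ℂ) ^ 2 + n * (2 * s1)) * polyEval p x +
    4 * s1 * ∑ i, (x i : ℂ) * polyEval (MvPolynomial.pderiv i p) x +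
    hypSum l m (‖x‖ ^ 2) * ∑ i, polyEval (MvPolynomial.pderiv i (MvPolynomial.pderiv i p)) x := by
    have hnc : (n : ℂ) * (2 * s1) = ∑ _i : Fin n, (2 * s1 : ℂ) := by simp
    rw [hnc, Finset.mul_sum, ← Finset.sum_add_distrib, Finset.sum_mul, Finset.mul_sum,
      Finset.mul_sum, ← Finset.sum_add_distrib, ← Finset.sum_add_distrib]
    refine Finset.sum_congr rfl fun i _ => ?_
    push_cast; ring
  have e2 : ∑ i, (x i : ℂ) * (((s1 * (2 * x i) : ℝ) : ℂ) * polyEval p x +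
      (hypSum l m (‖x‖ ^ 2) : ℂ) * polyEval (MvPolynomial.pderiv i p) x) =
      2 * s1 * polyEval p x * ∑ i, (x i : ℂ) ^ 2 +
      hypSum l m (‖x‖ ^ 2) * ∑ i, (x i : ℂ) * polyEval (MvPolynomial.pderiv i p) x := by
    rw [Finset.mul_sum, Finset.mul_sum, ← Finset.sum_add_distrib]
    refine Finset.sum_congr rfl fun i _ => ?_
    push_cast; ring
  rw [e1, e2, S1, S2, S3]
  have hode' : ((‖x‖ ^ 2 * (1 - ‖x‖ ^ 2) * s2 + ((m + l + 1) - (m - l + 1) * ‖x‖ ^ 2) * s1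
      + m * l * hypSum l m (‖x‖ ^ 2) : ℝ) : ℂ) = 0 := by exact_mod_cast hode
  have hnl : (n : ℂ) = 2 * (l + 1) := by exact_mod_cast hn
  rw [hnl]
  push_cast at hode' ⊢
  linear_combination (1 - (‖x‖ : ℂ) ^ 2) * 4 * polyEval p x * hode'

theorem solidExt_mem {n : ℕ} {l : ℝ} (hl : 0 < l) (hn : (n : ℝ) = 2 * (l + 1)) {m : ℕ}
    {p : MvPolynomial (Fin n) ℂ} (hp : IsHarmonicHomogeneous m p) :
    solidExt l m p ∈ solidHarmonics n m := by
  refine ⟨?_, ?_, p, hp, fun ζ hζ => ?_⟩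
  · refine ContinuousOn.mul ?_ (contDiff_polyEval p (k := 0)).continuous.continuousOn
    refine Complex.continuous_ofReal.comp_continuousOn (ContinuousOn.div_const ?_ _)
    refine (continuousOn_hypSum hl m).comp (by fun_prop) fun x hx => ?_
    have : ‖x‖ ≤ 1 := by simpa using hx
    constructor <;> nlinarith [norm_nonneg x]
  · have := (isHHarmonic_hypSum_mul hl hn hp).const_mul ((hypSum l m 1)⁻¹ : ℝ)
    convert this using 2 with x
    rw [solidExt, div_eq_inv_mul]
    push_cast; ring
  · have h1 : ‖ζ‖ = 1 := by simpa using hζ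
    rw [solidExt, h1, one_pow, div_self (hypSum_one_pos hl m).ne']
    simp [polyEval]

/-- The explicit extension has the same boundary values, so the maximum principle identifies it with
f on the closed ball. Every later statement about components goes through this form. -/
theorem eqOn_solidExt {n : ℕ} (hn2 : 2 < n) {l : ℝ} (hl : 0 < l) (hn : (n : ℝ) = 2 * (l + 1))
    {m : ℕ} {f : E n → ℂ} (hf : f ∈ solidHarmonics n m) :
    ∃ p : MvPolynomial (Fin n) ℂ, IsHarmonicHomogeneous m p ∧
      ∀ x ∈ closedBall (0 : E n) 1, f x = solidExt l m p x := by
  obtain ⟨hc, hh, p, hp, he⟩ := hf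
  obtain ⟨gc, gh, -⟩ := solidExt_mem hl hn hp
  refine ⟨p, hp, hh.eqOn_of_eqOn_sphere hn2 hc gh gc fun ζ hζ => ?_⟩
  have h1 : ‖ζ‖ = 1 := by simpa using hζ
  rw [he ζ hζ, solidExt, h1, one_pow, div_self (hypSum_one_pos hl m).ne']
  simp [polyEval]

/-! ### The Moebius transformation and the closed form of the kernel -/

theorem bracketSq_comm {n : ℕ} (x y : E n) : bracketSq x y = bracketSq y x := by
  rw [bracketSq, bracketSq, real_inner_comm]; ring

theorem bracketSq_pos {n : ℕ} {x y : E n} (hx : x ∈ closedBall (0 : E n) 1)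
    (hy : y ∈ unitBall n) : 0 < bracketSq x y := by
  have hx' : ‖x‖ ≤ 1 := by simpa using hx
  have hy' : ‖y‖ < 1 := by simpa using hy
  have h1 := real_inner_le_norm x y
  have h2 : ‖x‖ * ‖y‖ < 1 := by nlinarith [norm_nonneg x, norm_nonneg y]
  rw [bracketSq]
  nlinarith [sq_nonneg (1 - ‖x‖ * ‖y‖)]

/-- The squared norm of the Moebius transformation, as a rational expression. -/
noncomputable def moebiusSq {n : ℕ} (y x : E n) : ℝ :=
  1 - (1 - ‖y‖ ^ 2) * ((1 - ‖x‖ ^ 2) * (bracketSq x y)⁻¹)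

theorem bracketSq_sub {n : ℕ} (x y : E n) :
    bracketSq x y - (1 - ‖y‖ ^ 2) * (1 - ‖x‖ ^ 2) = ‖x - y‖ ^ 2 := by
  rw [bracketSq, norm_sub_sq_real]; ring

theorem norm_moebius_sq {n : ℕ} {x y : E n} (h : 0 < bracketSq x y) :
    ‖moebius y x‖ ^ 2 = moebiusSq y x := by
  have e : ‖‖x - y‖ ^ 2 • y + (1 - ‖y‖ ^ 2) • (y - x)‖ ^ 2 = ‖x - y‖ ^ 2 * bracketSq x y := by
    rw [norm_add_sq_real, norm_smul, norm_smul, mul_pow, mul_pow, inner_smul_left,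
      inner_smul_right, norm_sub_rev y x, inner_sub_right, real_inner_self_eq_norm_sq,
      real_inner_comm x y]
    simp only [Real.norm_eq_abs, sq_abs, conj_trivial]
    rw [← bracketSq_sub, bracketSq]
    ring
  rw [moebius, norm_smul, mul_pow, e, ← bracketSq_sub, moebiusSq]
  simp only [norm_inv, Real.norm_eq_abs, abs_of_pos h]
  field_simp

theorem moebiusSq_nonneg {n : ℕ} {x y : E n} (h : 0 < bracketSq x y) : 0 ≤ moebiusSq y x := by
  rw [← norm_moebius_sq h]; positivity

theorem one_sub_moebiusSq {n : ℕ} (x y : E n) :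
    1 - moebiusSq y x = (1 - ‖y‖ ^ 2) * ((1 - ‖x‖ ^ 2) * (bracketSq x y)⁻¹) := by
  rw [moebiusSq]; ring

theorem moebiusSq_le_one {n : ℕ} {x y : E n} (hx : x ∈ closedBall (0 : E n) 1)
    (hy : y ∈ unitBall n) : moebiusSq y x ≤ 1 := by
  have h1 := one_sub_moebiusSq x y
  have h2 := one_sub_normSq_pos hy
  have h3 : 0 ≤ 1 - ‖x‖ ^ 2 := by
    have : ‖x‖ ≤ 1 := by simpa using hx
    nlinarith [norm_nonneg x]
  have h4 := bracketSq_pos hx hy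
  have : 0 ≤ 1 - moebiusSq y x := by rw [h1]; positivity
  linarith

theorem abs_moebiusSq_lt_one {n : ℕ} {x y : E n} (hx : x ∈ unitBall n) (hy : y ∈ unitBall n) :
    |moebiusSq y x| < 1 := by
  have h4 := bracketSq_pos (ball_subset_closedBall hx) hy
  rw [abs_of_nonneg (moebiusSq_nonneg h4)]
  have h1 := one_sub_moebiusSq x y
  have h2 := one_sub_normSq_pos hy
  have h3 := one_sub_normSq_pos hx
  have : 0 < 1 - moebiusSq y x := by rw [h1]; positivity
  linarith

/-- The kernel profile, extended continuously to the closed ball in the first variable. -/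
noncomputable def kernelExt {n : ℕ} (l : ℝ) (y x : E n) : ℝ :=
  regPart l (‖x‖ ^ 2) + regPart l (‖y‖ ^ 2) - regPart l (moebiusSq y x) -
    Real.log (bracketSq x y)

theorem continuous_bracketSq {n : ℕ} (y : E n) : Continuous fun x : E n => bracketSq x y := by
  unfold bracketSq; fun_prop

theorem contDiff_bracketSq {n : ℕ} (y : E n) : ContDiff ℝ 2 fun x : E n => bracketSq x y := by
  unfold bracketSq
  have h1 : ContDiff ℝ 2 fun x : E n => ‖x‖ ^ 2 := contDiff_norm_sq ℝ
  have h2 : ContDiff ℝ 2 fun x : E n => inner ℝ x y := contDiff_id.inner ℝ contDiff_const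
  exact (contDiff_const.sub (contDiff_const.mul h2)).add (h1.mul contDiff_const)

theorem continuousOn_kernelExt {n : ℕ} {l : ℝ} (hl : 0 < l) {y : E n} (hy : y ∈ unitBall n) :
    ContinuousOn (kernelExt l y) (closedBall 0 1) := by
  have hB := continuous_bracketSq y
  have hne : ∀ x ∈ closedBall (0 : E n) 1, bracketSq x y ≠ 0 := fun x hx => (bracketSq_pos hx hy).ne'
  have hm : ContinuousOn (moebiusSq y) (closedBall 0 1) := by
    unfold moebiusSq
    exact continuousOn_const.sub (continuousOn_const.mul
      (ContinuousOn.mul (by fun_prop) (hB.continuousOn.inv₀ hne)))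
  refine (((((continuousOn_regPart hl).comp (by fun_prop) ?_).add continuousOn_const).sub
    ((continuousOn_regPart hl).comp hm ?_)).sub (hB.continuousOn.log hne))
  · intro x hx
    have : ‖x‖ ≤ 1 := by simpa using hx
    constructor <;> nlinarith [norm_nonneg x]
  · intro x hx
    exact ⟨by linarith [moebiusSq_nonneg (bracketSq_pos hx hy)], moebiusSq_le_one hx hy⟩

/-- The logarithmic parts of the three profiles combine through 1 - |φ_y(x)|² =
(1-|x|²)(1-|y|²)/[x,y]², leaving only -log [x,y]², which is not singular at |x| = 1. -/
theorem kernelExt_eq_fn {n : ℕ} (hn2 : 2 < n) {l : ℝ} (hl : 0 < l) (hn : (n : ℝ) = 2 * (l + 1))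
    {x y : E n} (hx : x ∈ unitBall n) (hy : y ∈ unitBall n) :
    2 * ((n : ℝ) - 1) / n * (fn n (‖x‖ ^ 2) + fn n (‖y‖ ^ 2) - fn n (‖moebius y x‖ ^ 2)) =
      kernelExt l y x := by
  have hB := bracketSq_pos (ball_subset_closedBall hx) hy
  rw [norm_moebius_sq hB, fn_eq_regPart hl hn2.le hn (abs_normSq_lt_one hx),
    fn_eq_regPart hl hn2.le hn (abs_normSq_lt_one hy),
    fn_eq_regPart hl hn2.le hn (abs_moebiusSq_lt_one hx hy), kernelExt, one_sub_moebiusSq]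
  have h2 := one_sub_normSq_pos hy
  have h3 := one_sub_normSq_pos hx
  rw [Real.log_mul h2.ne' (by positivity), Real.log_mul h3.ne' (by positivity), Real.log_inv, hn]
  have : 2 * l + 1 ≠ 0 := by positivity
  field_simp
  ring

theorem kernelExt_comm {n : ℕ} {l : ℝ} (x y : E n) : kernelExt l y x = kernelExt l x y := by
  rw [kernelExt, kernelExt, moebiusSq, moebiusSq, bracketSq_comm x y]
  rw [mul_left_comm]
  ring

theorem hasTwoJet_bracketSq {n : ℕ} (x y : E n) (i : Fin n) :
    HasTwoJet (fun s : ℝ => bracketSq (x + s • stdVec i) y) (bracketSq x y)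
      (-2 * y i + 2 * ‖y‖ ^ 2 * x i) (2 * ‖y‖ ^ 2) := by
  have h : (fun s : ℝ => bracketSq (x + s • stdVec i) y) = fun s => bracketSq x y +
      (-2 * y i + 2 * ‖y‖ ^ 2 * x i) * s + ‖y‖ ^ 2 * s ^ 2 := by
    funext s
    rw [bracketSq, bracketSq, normSq_add_smul_stdVec, inner_add_left, inner_smul_left]
    simp [stdVec, EuclideanSpace.inner_single_left]
    ring
  rw [h]
  exact hasTwoJet_quadratic _ _ _

theorem eventually_hasDerivAt_inv {b : ℝ} (hb : b ≠ 0) :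
    ∀ᶠ t in 𝓝 b, HasDerivAt (fun t : ℝ => t⁻¹) (-(t ^ 2)⁻¹) t := by
  filter_upwards [isOpen_ne.mem_nhds hb] with t ht using hasDerivAt_inv ht

theorem hasDerivAt_neg_sq_inv {b : ℝ} (hb : b ≠ 0) :
    HasDerivAt (fun t : ℝ => -(t ^ 2)⁻¹) (2 / b ^ 3) b := by
  refine (((hasDerivAt_pow 2 b).inv (pow_ne_zero 2 hb)).neg).congr_deriv ?_
  simp only [Nat.cast_ofNat, Nat.add_one_sub_one, pow_one]
  field_simp

theorem eventually_hasDerivAt_log {b : ℝ} (hb : b ≠ 0) :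
    ∀ᶠ t in 𝓝 b, HasDerivAt Real.log t⁻¹ t := by
  filter_upwards [isOpen_ne.mem_nhds hb] with t ht using Real.hasDerivAt_log ht

/-- The profile F(t) = -log(1-t) + g(t) is such that F(|x|²) has constant hyperbolic Laplacian
4(2l+1); Moebius invariance makes this cancel against F(|φ_y(x)|²). Instead of proving invariance,
the computation reduces everything to |x|², |y|² and [x,y]² and uses the equation of g at |x|² and
at |φ_y(x)|². -/
theorem isHHarmonic_kernelExt {n : ℕ} {l : ℝ} (hl : 0 < l) (hn : (n : ℝ) = 2 * (l + 1))
    {y : E n} (hy : y ∈ unitBall n) : IsHHarmonic (fun x => (kernelExt l y x : ℂ)) := by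
  have hne : ∀ x ∈ unitBall n, bracketSq x y ≠ 0 :=
    fun x hx => (bracketSq_pos (ball_subset_closedBall hx) hy).ne'
  have hBc := (contDiff_bracketSq y).contDiffOn (s := unitBall n)
  have hnc : ContDiffOn ℝ 2 (fun x : E n => ‖x‖ ^ 2) (unitBall n) :=
    (contDiff_norm_sq ℝ).contDiffOn
  have hcd : ContDiffOn ℝ 2 (fun x => (kernelExt l y x : ℂ)) (unitBall n) := by
    refine Complex.ofRealCLM.contDiff.comp_contDiffOn ?_
    have hm : ContDiffOn ℝ 2 (moebiusSq y) (unitBall n) := by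
      unfold moebiusSq
      exact contDiffOn_const.sub (contDiffOn_const.mul
        ((contDiffOn_const.sub hnc).mul (hBc.inv hne)))
    exact ((((contDiffOn_regPart hl).comp hnc fun x hx => abs_lt.1 (abs_normSq_lt_one hx)).add
      contDiffOn_const).sub ((contDiffOn_regPart hl).comp hm
        fun x hx => abs_lt.1 (abs_moebiusSq_lt_one hx hy))).sub (hBc.log hne)
  refine ⟨hcd, fun x hx => ?_⟩
  have hB := hne x hx
  have ht := abs_normSq_lt_one hx
  have hu := abs_moebiusSq_lt_one hx hy
  have ha := convergesInside_regCoeff hl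
  have jX := hasTwoJet_normSq x
  have jB := hasTwoJet_bracketSq x y
  have ju := fun i => (hasTwoJet_const (1 : ℝ)).sub ((hasTwoJet_const (1 - ‖y‖ ^ 2)).mul
    (((hasTwoJet_const (1 : ℝ)).sub (jX i)).mul
      (HasTwoJet.comp (eventually_hasDerivAt_inv hB) (hasDerivAt_neg_sq_inv hB) (jB i))))
  have jet := fun i => ((((HasTwoJet.comp (eventually_hasDerivAt_powerSum ha ht)
    (hasDerivAt_powerSum ha.derivCoeff ht) (jX i)).add
    (hasTwoJet_const (regPart l (‖y‖ ^ 2)))).sub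
    (HasTwoJet.comp (eventually_hasDerivAt_powerSum ha hu)
    (hasDerivAt_powerSum ha.derivCoeff hu) (ju i))).sub
    (HasTwoJet.comp (eventually_hasDerivAt_log hB) (hasDerivAt_inv hB) (jB i))).clm
    Complex.ofRealCLM
  rw [hypLaplacian_eq_sum (hcd.contDiffAt (isOpen_ball.mem_nhds hx)) jet]
  simp only [Complex.ofRealCLM_apply]
  have hode1 := regPart_ode hl ht
  have hode2 := regPart_ode hl hu
  set h1 := powerSum (derivCoeff (regCoeff l)) (‖x‖ ^ 2)
  set h2 := powerSum (derivCoeff (derivCoeff (regCoeff l))) (‖x‖ ^ 2)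
  have hudef : moebiusSq y x = 1 - (1 - ‖y‖ ^ 2) * ((1 - ‖x‖ ^ 2) * (bracketSq x y)⁻¹) := rfl
  set k1 := powerSum (derivCoeff (regCoeff l)) (moebiusSq y x)
  set k2 := powerSum (derivCoeff (derivCoeff (regCoeff l))) (moebiusSq y x)
  set B := bracketSq x y with hBdef
  set X := ‖x‖ ^ 2 with hX
  set Y := ‖y‖ ^ 2 with hY
  have S1 : ∑ i, x i ^ 2 = X := sum_sq_eq_normSq x
  have S2 : ∑ i, x i * (-2 * y i + 2 * Y * x i) = B - 1 + X * Y := by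
    have e : ∀ i, x i * (-2 * y i + 2 * Y * x i) = -2 * (x i * y i) + 2 * Y * x i ^ 2 :=
      fun i => by ring
    simp_rw [e]
    rw [Finset.sum_add_distrib, ← Finset.mul_sum, ← Finset.mul_sum, S1, sum_mul_eq_inner, hBdef,
      bracketSq]
    ring
  have S3 : ∑ i, (-2 * y i + 2 * Y * x i) ^ 2 = 4 * Y * B := by
    have e : ∀ i, (-2 * y i + 2 * Y * x i) ^ 2 =
        4 * y i ^ 2 - 8 * Y * (x i * y i) + 4 * Y ^ 2 * x i ^ 2 := fun i => by ring
    simp_rw [e]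
    rw [Finset.sum_add_distrib, Finset.sum_sub_distrib, ← Finset.mul_sum, ← Finset.mul_sum,
      ← Finset.mul_sum, S1, sum_mul_eq_inner, sum_sq_eq_normSq, hBdef, bracketSq]
    ring
  set β : Fin n → ℝ := fun i => -2 * y i + 2 * Y * x i with hβ
  -- With β the gradient of x ↦ [x,y]², every summand is a combination of 1, x_i², x_i β_i and β_i²,
  -- whose sums over i are known in closed form.
  have lin : ∀ (c : Fin n → ℝ) (a0 a1 a2 a3 : ℝ),
      (∀ i, c i = a0 + a1 * x i ^ 2 + a2 * (x i * β i) + a3 * β i ^ 2) →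
      ∑ i, c i = n * a0 + a1 * X + a2 * (B - 1 + X * Y) + a3 * (4 * Y * B) := by
    intro c a0 a1 a2 a3 hc
    simp_rw [hc]
    rw [Finset.sum_add_distrib, Finset.sum_add_distrib, Finset.sum_add_distrib, ← Finset.mul_sum,
      ← Finset.mul_sum, ← Finset.mul_sum, S1, S2, S3]
    simp
  have e2 : ((2 : ℂ) * ((n : ℂ) - 2)) = ((2 * ((n : ℝ) - 2) : ℝ) : ℂ) := by push_cast; ring
  rw [e2]
  simp_rw [← Complex.ofReal_mul]
  rw [← Complex.ofReal_sum, ← Complex.ofReal_sum, ← Complex.ofReal_mul, ← Complex.ofReal_mul,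
    ← Complex.ofReal_add, ← Complex.ofReal_mul]
  rw [Complex.ofReal_eq_zero]
  simp only [zero_mul, mul_zero, zero_add, zero_sub, add_zero]
  rw [lin _ (h1 * 2 - k1 * (2 * (1 - Y) * B⁻¹ + (1 - Y) * (1 - X) * 2 * Y * B⁻¹ ^ 2) - 2 * Y * B⁻¹)
    (4 * h2 - k2 * (1 - Y) ^ 2 * 4 * B⁻¹ ^ 2)
    (-k2 * (1 - Y) ^ 2 * 4 * (1 - X) * B⁻¹ ^ 3 + k1 * 4 * (1 - Y) * B⁻¹ ^ 2)
    (-k2 * (1 - Y) ^ 2 * (1 - X) ^ 2 * B⁻¹ ^ 4 + k1 * 2 * (1 - Y) * (1 - X) * B⁻¹ ^ 3 + B⁻¹ ^ 2)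
    (fun i => ?_),
    lin _ 0 (2 * h1 - 2 * k1 * (1 - Y) * B⁻¹) (-k1 * (1 - Y) * (1 - X) * B⁻¹ ^ 2 - B⁻¹) 0
    (fun i => ?_)]
  · rw [hudef] at hode2
    rw [hn]
    have hBi : B * B⁻¹ = 1 := mul_inv_cancel₀ hB
    generalize B⁻¹ = b at hBi hode2 ⊢
    clear_value B h1 h2 k1 k2 X Y
    linear_combination 4 * (1 - X) * hode1 - 4 * (1 - X) * (1 - Y) * b * hode2 + (1 - X) *
      ((1 - X) * ((-k2 * (1 - Y) ^ 2 * 4 * (1 - X) * b ^ 2 + k1 * 4 * (1 - Y) * b) +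
        4 * Y * (-k2 * (1 - Y) ^ 2 * (1 - X) ^ 2 * b ^ 3 + k1 * 2 * (1 - Y) * (1 - X) * b ^ 2 + b)) +
      4 * l * (-k1 * (1 - Y) * (1 - X) * b - 1)) * hBi
  · simp only [hβ, ← inv_pow]; ring
  · simp only [hβ, ← inv_pow]; ring

/-! ### Integration over the sphere by Gaussian integrals -/

/-- The Gaussian weight. -/
noncomputable def gaussian {n : ℕ} (x : E n) : ℝ := Real.exp (-‖x‖ ^ 2)

/-- The radial moments `∫₀^∞ r^(n-1+d) exp(-r²) dr`. -/
noncomputable def radialMoment (n d : ℕ) : ℝ :=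
  ∫ r : Ioi (0 : ℝ), (r : ℝ) ^ d * Real.exp (-(r : ℝ) ^ 2) ∂(Measure.volumeIoiPow (n - 1))

theorem radialMoment_eq {n : ℕ} (hn : 0 < n) (d : ℕ) :
    radialMoment n d = 1 / 2 * Real.Gamma (((n : ℝ) + d) / 2) := by
  have h1 : radialMoment n d =
      ∫ r in Ioi (0 : ℝ), r ^ (n - 1) * (r ^ d * Real.exp (-r ^ 2)) := by
    simp only [radialMoment, Measure.volumeIoiPow, ENNReal.ofReal]
    rw [integral_withDensity_eq_integral_smul,
      integral_subtype_comap measurableSet_Ioi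
        fun a : ℝ => Real.toNNReal (a ^ (n - 1)) • (a ^ d * Real.exp (-a ^ 2)),
      setIntegral_congr_fun measurableSet_Ioi fun x hx => ?_]
    · rw [NNReal.smul_def, Real.coe_toNNReal _ (pow_nonneg hx.out.le _), smul_eq_mul]
    · exact (measurable_subtype_coe.pow_const _).real_toNNReal
  have h2 := integral_rpow_mul_exp_neg_rpow (p := 2) (q := (n : ℝ) + d - 1) two_pos
    (by have : (1 : ℝ) ≤ n := by exact_mod_cast hn
        linarith [d.cast_nonneg (α := ℝ)])
  rw [h1, show ((n : ℝ) + d) / 2 = ((n : ℝ) + d - 1 + 1) / 2 by ring, ← h2]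
  refine setIntegral_congr_fun measurableSet_Ioi fun x hx => ?_
  have hx' : (0 : ℝ) < x := hx
  have e : (n : ℝ) + d - 1 = ((n - 1 + d : ℕ) : ℝ) := by
    rw [Nat.cast_add, Nat.cast_sub hn]; push_cast; ring
  simp only [e, Real.rpow_natCast, Real.rpow_ofNat]
  rw [pow_add]; ring

theorem radialMoment_pos {n : ℕ} (hn : 0 < n) (d : ℕ) : 0 < radialMoment n d := by
  rw [radialMoment_eq hn]
  have := Real.Gamma_pos_of_pos (s := ((n : ℝ) + d) / 2) (by positivity)
  positivity

theorem radialMoment_add_two {n : ℕ} (hn : 0 < n) (d : ℕ) :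
    2 * radialMoment n (d + 2) = (n + d) * radialMoment n d := by
  rw [radialMoment_eq hn, radialMoment_eq hn]
  have : ((n : ℝ) + ((d + 2 : ℕ) : ℝ)) / 2 = ((n : ℝ) + d) / 2 + 1 := by push_cast; ring
  rw [this, Real.Gamma_add_one (by positivity)]
  ring

/-- In polar coordinates homogeneity separates the radial factor, so spherical means can be studied
through integrals over the whole space. -/
theorem integral_polyEval_mul_gaussian {n m : ℕ} (hn : 0 < n) {p : MvPolynomial (Fin n) ℂ}
    (hp : p.IsHomogeneous m) :
    ∫ x : E n, polyEval p x * (gaussian x : ℂ) =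
      (∫ ζ : sphere (0 : E n) 1, polyEval p ζ ∂(volume : Measure (E n)).toSphere) *
        radialMoment n m := by
  have : Nonempty (Fin n) := ⟨⟨0, hn⟩⟩
  calc
    ∫ x : E n, polyEval p x * (gaussian x : ℂ) =
        ∫ x : ({(0)}ᶜ : Set (E n)), polyEval p x * (gaussian (x : E n) : ℂ)
          ∂((volume : Measure (E n)).comap (↑)) := by
      rw [integral_subtype_comap (measurableSet_singleton _).compl
        fun x : E n => polyEval p x * (gaussian x : ℂ), restrict_compl_singleton]
    _ = ∫ z : sphere (0 : E n) 1 × Ioi (0 : ℝ), polyEval p z.1 *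
          (((z.2 : ℝ) ^ m * Real.exp (-(z.2 : ℝ) ^ 2) : ℝ) : ℂ)
          ∂((volume : Measure (E n)).toSphere.prod (.volumeIoiPow (n - 1))) := by
      have h := (volume : Measure (E n)).measurePreserving_homeomorphUnitSphereProd.integral_comp
        (Homeomorph.measurableEmbedding _) (fun z : sphere (0 : E n) 1 × Ioi (0 : ℝ) =>
          polyEval p z.1 * (((z.2 : ℝ) ^ m * Real.exp (-(z.2 : ℝ) ^ 2) : ℝ) : ℂ))
      rw [finrank_euclideanSpace, Fintype.card_fin] at h
      rw [← h]
      refine integral_congr_ae (Eventually.of_forall fun x => ?_)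
      have hx : (x : E n) ≠ 0 := x.2
      have hx' : ‖(x : E n)‖ ≠ 0 := norm_ne_zero_iff.2 hx
      simp only [homeomorphUnitSphereProd_apply_fst_coe, homeomorphUnitSphereProd_apply_snd_coe]
      rw [polyEval_smul hp, gaussian]
      push_cast
      have : (‖(x : E n)‖ : ℂ) ≠ 0 := by exact_mod_cast hx'
      rw [inv_pow]
      field_simp
    _ = _ := by
      rw [integral_prod_mul (f := fun ζ : sphere (0 : E n) 1 => polyEval p ζ)
        (g := fun r : Ioi (0 : ℝ) => (((r : ℝ) ^ m * Real.exp (-(r : ℝ) ^ 2) : ℝ) : ℂ)),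
        integral_complex_ofReal, radialMoment]

theorem integrable_norm_pow_mul_gaussian {n : ℕ} (hn : 0 < n) (d : ℕ) :
    Integrable fun x : E n => ‖x‖ ^ d * gaussian x := by
  have : Nonempty (Fin n) := ⟨⟨0, hn⟩⟩
  have h := (integrable_fun_norm_addHaar (volume : Measure (E n))
    (f := fun r : ℝ => r ^ d * Real.exp (-r ^ 2))).2 ?_
  · exact h
  · have h2 := integrableOn_rpow_mul_exp_neg_rpow (s := ((n - 1 + d : ℕ) : ℝ)) (p := 2)
      (by have := (n - 1 + d).cast_nonneg (α := ℝ); linarith) two_pos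
    rw [finrank_euclideanSpace, Fintype.card_fin]
    refine h2.congr_fun (fun x hx => ?_) measurableSet_Ioi
    simp only [Real.rpow_natCast, Real.rpow_ofNat, smul_eq_mul]
    rw [pow_add]; ring

theorem continuous_gaussian {n : ℕ} : Continuous (gaussian : E n → ℝ) := by
  unfold gaussian; fun_prop

theorem integrable_polyEval_mul_gaussian {n : ℕ} (hn : 0 < n) (p : MvPolynomial (Fin n) ℂ) :
    Integrable fun x : E n => polyEval p x * (gaussian x : ℂ) := by
  have hmeas : ∀ p : MvPolynomial (Fin n) ℂ, Continuous fun x : E n => polyEval p x * (gaussian x : ℂ) :=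
    fun p => (contDiff_polyEval p (k := 0)).continuous.mul
      (Complex.continuous_ofReal.comp continuous_gaussian)
  have hhom : ∀ (m : ℕ) (q : MvPolynomial (Fin n) ℂ), q.IsHomogeneous m →
      Integrable fun x : E n => polyEval q x * (gaussian x : ℂ) := by
    intro m q hq
    obtain ⟨C, hC⟩ := (isCompact_sphere (0 : E n) 1).exists_bound_of_continuousOn
      (contDiff_polyEval q (k := 0)).continuous.continuousOn
    have hC0 : 0 ≤ C := by
      have : Nonempty (Fin n) := ⟨⟨0, hn⟩⟩
      obtain ⟨ζ, hζ⟩ := (NormedSpace.sphere_nonempty (x := (0 : E n)) (r := 1)).2 zero_le_one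
      exact (norm_nonneg _).trans (hC ζ hζ)
    have hb : ∀ x : E n, x ≠ 0 → ‖polyEval q x‖ ≤ C * ‖x‖ ^ m := by
      intro x hx
      have hx' : ‖x‖ ≠ 0 := norm_ne_zero_iff.2 hx
      have h1 := hC (‖x‖⁻¹ • x) (by simp [norm_smul, hx'])
      have h2 := polyEval_smul hq ‖x‖ (‖x‖⁻¹ • x)
      rw [smul_smul, mul_inv_cancel₀ hx', one_smul] at h2
      rw [h2, norm_mul, norm_pow, Complex.norm_real, norm_norm, mul_comm]
      gcongr
    refine ((integrable_norm_pow_mul_gaussian hn m).const_mul C).mono'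
      (hmeas q).aestronglyMeasurable ?_
    have : Nonempty (Fin n) := ⟨⟨0, hn⟩⟩
    have hne : ∀ᵐ x : E n, x ≠ 0 := by simp [ae_iff]
    filter_upwards [hne] with x hx
    have hg : 0 < gaussian x := Real.exp_pos _
    rw [norm_mul, Complex.norm_real, Real.norm_eq_abs, abs_of_pos hg, ← mul_assoc]
    exact mul_le_mul_of_nonneg_right (hb x hx) hg.le
  have hs : (fun x : E n => polyEval p x * (gaussian x : ℂ)) = fun x =>
      ∑ i ∈ Finset.range (p.totalDegree + 1),
        polyEval (MvPolynomial.homogeneousComponent i p) x * (gaussian x : ℂ) := by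
    funext x
    conv_lhs => rw [← MvPolynomial.sum_homogeneousComponent p]
    rw [polyEval_sum, Finset.sum_mul]
  rw [hs]
  exact integrable_finsetSum _ fun i _ => hhom i _ (MvPolynomial.homogeneousComponent_isHomogeneous i p)

theorem hasDerivAt_gaussian_line {n : ℕ} (x : E n) (i : Fin n) :
    HasDerivAt (fun s : ℝ => (gaussian (x + s • stdVec i) : ℂ))
      (-2 * (x i : ℂ) * gaussian x) 0 := by
  have h : HasDerivAt (fun s : ℝ => gaussian (x + s • stdVec i)) (-2 * x i * gaussian x) 0 := by
    simp only [gaussian, normSq_add_smul_stdVec]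
    have h1 : HasDerivAt (fun s : ℝ => -(‖x‖ ^ 2 + 2 * x i * s + 1 * s ^ 2)) (-2 * x i) 0 := by
      have := ((((hasDerivAt_id (0 : ℝ)).const_mul (2 * x i)).const_add (‖x‖ ^ 2)).add
        ((hasDerivAt_pow 2 (0 : ℝ)).const_mul 1)).neg
      refine this.congr_deriv ?_
      simp
    refine h1.exp.congr_deriv ?_
    simp [mul_comm]
  refine h.ofReal_comp.congr_deriv ?_
  push_cast; rfl

/-- Integration by parts, with ∂_i exp(-|x|²) = -2 x_i exp(-|x|²). -/
theorem integral_pderiv_mul_gaussian {n : ℕ} (hn : 0 < n) (p : MvPolynomial (Fin n) ℂ)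
    (i : Fin n) :
    ∫ x : E n, polyEval (MvPolynomial.pderiv i p) x * (gaussian x : ℂ) =
      2 * ∫ x : E n, polyEval (MvPolynomial.X i * p) x * (gaussian x : ℂ) := by
  have h1 := integrable_polyEval_mul_gaussian hn (MvPolynomial.pderiv i p)
  have h2 := (integrable_polyEval_mul_gaussian hn (MvPolynomial.X i * p)).const_mul (-2)
  have h3 := integrable_polyEval_mul_gaussian hn p
  have key := integral_bilinear_hasLineDerivAt_right_eq_neg_left_of_integrable
    (μ := (volume : Measure (E n))) (f := polyEval p) (f' := polyEval (MvPolynomial.pderiv i p))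
    (g := fun x => (gaussian x : ℂ)) (g' := fun x => -2 * (x i : ℂ) * gaussian x)
    (v := stdVec i) (B := ContinuousLinearMap.mul ℝ ℂ) (by simpa using h1)
    (by
      refine h2.congr (Eventually.of_forall fun x => ?_)
      simp; ring) (by simpa using h3)
    (fun x _ => by
      have := hasDerivAt_polyEval_line p x i 0
      simpa [HasLineDerivAt] using this)
    (fun x _ => hasDerivAt_gaussian_line x i)
  simp only [ContinuousLinearMap.mul_apply'] at key
  have e : ∫ x : E n, polyEval p x * (-2 * (x i : ℂ) * gaussian x) =
      -2 * ∫ x : E n, polyEval (MvPolynomial.X i * p) x * (gaussian x : ℂ) := by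
    rw [← integral_const_mul]
    refine integral_congr_ae (Eventually.of_forall fun x => ?_)
    simp; ring
  rw [e] at key
  linear_combination key

/-- The mean of a polynomial over the unit sphere. -/
noncomputable def sphereMean {n : ℕ} (p : MvPolynomial (Fin n) ℂ) : ℂ :=
  ⨍ ζ : sphere (0 : E n) 1, polyEval p ζ ∂(volume : Measure (E n)).toSphere

theorem sphereMean_eq {n : ℕ} (p : MvPolynomial (Fin n) ℂ) :
    sphereMean p = ((((volume : Measure (E n)).toSphere.real univ)⁻¹ : ℝ) : ℂ) *
      ∫ ζ : sphere (0 : E n) 1, polyEval p ζ ∂(volume : Measure (E n)).toSphere := by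
  rw [sphereMean, average_eq, Complex.real_smul]

theorem continuous_polyEval_sphere {n : ℕ} (p : MvPolynomial (Fin n) ℂ) :
    Continuous fun ζ : sphere (0 : E n) 1 => polyEval p ζ :=
  (contDiff_polyEval p (k := 0)).continuous.comp continuous_subtype_val

theorem integrable_sphere_of_continuous {n : ℕ} {F : Type*} [NormedAddCommGroup F]
    {f : sphere (0 : E n) 1 → F} (hf : Continuous f) :
    Integrable f (volume : Measure (E n)).toSphere := by
  have : CompactSpace (sphere (0 : E n) 1) := isCompact_iff_compactSpace.1 (isCompact_sphere _ _)
  exact hf.integrable_of_hasCompactSupport (HasCompactSupport.of_compactSpace f)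

theorem sphereMean_add {n : ℕ} (p q : MvPolynomial (Fin n) ℂ) :
    sphereMean (p + q) = sphereMean p + sphereMean q := by
  simp only [sphereMean_eq, polyEval_add]
  rw [integral_add (integrable_sphere_of_continuous (continuous_polyEval_sphere p))
    (integrable_sphere_of_continuous (continuous_polyEval_sphere q)), mul_add]

theorem sphereMean_C_mul {n : ℕ} (a : ℂ) (p : MvPolynomial (Fin n) ℂ) :
    sphereMean (MvPolynomial.C a * p) = a * sphereMean p := by
  simp only [sphereMean_eq, polyEval_mul, polyEval_C]
  rw [integral_const_mul]; ring

theorem sphereMean_zero {n : ℕ} : sphereMean (0 : MvPolynomial (Fin n) ℂ) = 0 := by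
  simp [sphereMean_eq]

theorem sphereMean_sum {n : ℕ} {ι : Type*} (s : Finset ι) (p : ι → MvPolynomial (Fin n) ℂ) :
    sphereMean (∑ i ∈ s, p i) = ∑ i ∈ s, sphereMean (p i) := by
  classical
  induction s using Finset.induction_on with
  | empty => simp [sphereMean_zero]
  | insert a s ha ih => rw [Finset.sum_insert ha, Finset.sum_insert ha, sphereMean_add, ih]

theorem sphereMean_congr {n : ℕ} {p q : MvPolynomial (Fin n) ℂ}
    (h : ∀ ζ ∈ sphere (0 : E n) 1, polyEval p ζ = polyEval q ζ) : sphereMean p = sphereMean q := by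
  rw [sphereMean, sphereMean]
  congr 1
  funext ζ
  exact h ζ ζ.2

theorem toSphere_real_univ_pos {n : ℕ} (hn : 0 < n) :
    0 < (volume : Measure (E n)).toSphere.real univ := by
  rw [Measure.toSphere_real_apply_univ, finrank_euclideanSpace, Fintype.card_fin]
  have : 0 < (volume : Measure (E n)).real (ball 0 1) :=
    ENNReal.toReal_pos (measure_ball_pos _ _ one_pos).ne' measure_ball_lt_top.ne
  positivity

theorem sphereMean_C {n : ℕ} (hn : 0 < n) (a : ℂ) :
    sphereMean (MvPolynomial.C a : MvPolynomial (Fin n) ℂ) = a := by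
  have := toSphere_real_univ_pos hn
  have h2 : (((volume : Measure (E n)).toSphere.real univ : ℝ) : ℂ) ≠ 0 := by
    exact_mod_cast this.ne'
  simp only [sphereMean_eq, polyEval_C, integral_const, Complex.real_smul]
  push_cast
  field_simp

/-- The divergence theorem on the sphere, for homogeneous polynomials. -/
theorem sphereMean_pderiv {n m : ℕ} (hn : 0 < n) {p : MvPolynomial (Fin n) ℂ}
    (hp : p.IsHomogeneous m) (i : Fin n) :
    sphereMean (MvPolynomial.pderiv i p) = (n + m - 1) * sphereMean (MvPolynomial.X i * p) := by
  have hk := integral_pderiv_mul_gaussian hn p i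
  have hX : (MvPolynomial.X i * p).IsHomogeneous (1 + m) := (MvPolynomial.isHomogeneous_X ℂ i).mul hp
  rw [integral_polyEval_mul_gaussian hn hX] at hk
  rw [sphereMean_eq, sphereMean_eq]
  -- A constant p is separate: its derivative is 0, and the degree m - 1 required of the derivative
  -- would be truncated. Otherwise the radial moments of degrees m - 1 and m + 1 differ by the
  -- factor (n+m-1)/2.
  rcases m with _ | m
  · have h0 : MvPolynomial.pderiv i p = 0 := by
      have : p.totalDegree = 0 := Nat.le_zero.1 hp.totalDegree_le
      rw [MvPolynomial.totalDegree_eq_zero_iff_eq_C] at this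
      rw [this, MvPolynomial.pderiv_C]
    have hR : (radialMoment n (1 + 0) : ℂ) ≠ 0 := by exact_mod_cast (radialMoment_pos hn _).ne'
    simp only [h0, polyEval_zero, zero_mul, integral_zero] at hk ⊢
    have : (∫ ζ : sphere (0 : E n) 1, polyEval (MvPolynomial.X i * p) ζ
        ∂(volume : Measure (E n)).toSphere) = 0 := by
      have h2 := (mul_eq_zero.1 hk.symm).resolve_left two_ne_zero
      exact (mul_eq_zero.1 h2).resolve_right hR
    rw [this]; simp
  · have hd : (MvPolynomial.pderiv i p).IsHomogeneous m := by simpa using hp.pderiv (i := i)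
    rw [integral_polyEval_mul_gaussian hn hd, show 1 + (m + 1) = m + 2 by ring] at hk
    have hR : (radialMoment n m : ℂ) ≠ 0 := by exact_mod_cast (radialMoment_pos hn _).ne'
    have hr : (2 : ℂ) * radialMoment n (m + 2) = (n + m) * radialMoment n m := by
      exact_mod_cast radialMoment_add_two hn m
    refine mul_right_cancel₀ hR ?_
    push_cast
    linear_combination (((volume : Measure (E n)).toSphere.real univ : ℝ) : ℂ)⁻¹ * hk +
      (((volume : Measure (E n)).toSphere.real univ : ℝ) : ℂ)⁻¹ *
      (∫ ζ : sphere (0 : E n) 1, polyEval (MvPolynomial.X i * p) ζ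
        ∂(volume : Measure (E n)).toSphere) * hr

/-- As p is harmonic, the left side is the mean of the divergence of q∇p. The divergence theorem
turns it into a multiple of the mean of q times the radial derivative of p, and Euler's identity
finishes. -/
theorem sphereMean_grad_mul_grad {n m k : ℕ} (hn : 0 < n) {p q : MvPolynomial (Fin n) ℂ}
    (hp : IsHarmonicHomogeneous m p) (hq : IsHarmonicHomogeneous k q) :
    sphereMean (∑ i, MvPolynomial.pderiv i q * MvPolynomial.pderiv i p) =
      (n + m + k - 2) * m * sphereMean (q * p) := by
  rcases m with _ | m
  · have h0 : ∀ i, MvPolynomial.pderiv i p = 0 := by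
      have : p.totalDegree = 0 := Nat.le_zero.1 hp.1.totalDegree_le
      rw [MvPolynomial.totalDegree_eq_zero_iff_eq_C] at this
      intro i
      rw [this, MvPolynomial.pderiv_C]
    simp [h0, sphereMean_zero]
  have h1 : ∑ i, MvPolynomial.pderiv i q * MvPolynomial.pderiv i p =
      ∑ i, MvPolynomial.pderiv i (q * MvPolynomial.pderiv i p) := by
    simp_rw [MvPolynomial.pderiv_mul]
    rw [Finset.sum_add_distrib, ← Finset.mul_sum, hp.2, mul_zero, add_zero]
  have h2 : ∀ i, (q * MvPolynomial.pderiv i p).IsHomogeneous (k + m) := fun i => by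
    simpa using hq.1.mul (hp.1.pderiv (i := i))
  rw [h1, sphereMean_sum]
  simp_rw [fun i => sphereMean_pderiv hn (h2 i) i]
  rw [← Finset.mul_sum, ← sphereMean_sum]
  have h3 : sphereMean (∑ i, MvPolynomial.X i * (q * MvPolynomial.pderiv i p)) =
      (m + 1) * sphereMean (q * p) := by
    rw [← sphereMean_C_mul]
    refine sphereMean_congr fun ζ _ => ?_
    have := sum_mul_polyEval_pderiv hp.1 ζ
    simp only [polyEval_sum, polyEval_mul, polyEval_X, polyEval_C]
    push_cast at this
    rw [mul_left_comm, ← this, Finset.mul_sum]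
    exact Finset.sum_congr rfl fun i _ => by ring
  rw [h3]
  push_cast; ring

/-- The mean of ∇p·∇q is symmetric in p and q; comparing the two evaluations gives (n+m+k-2)(m-k)
times the mean of qp equal to 0. -/
theorem sphereMean_mul_eq_zero {n m k : ℕ} (hn : 2 < n) {p q : MvPolynomial (Fin n) ℂ}
    (hp : IsHarmonicHomogeneous m p) (hq : IsHarmonicHomogeneous k q) (hmk : m ≠ k) :
    sphereMean (q * p) = 0 := by
  have h1 := sphereMean_grad_mul_grad (by omega) hp hq
  have h2 := sphereMean_grad_mul_grad (by omega) hq hp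
  simp_rw [mul_comm (MvPolynomial.pderiv _ p), mul_comm p q] at h2
  rw [h1] at h2
  have h3 : ((n : ℂ) + m + k - 2) * ((m : ℂ) - k) * sphereMean (q * p) = 0 := by
    linear_combination h2
  have h4 : (n : ℂ) + m + k - 2 ≠ 0 := by
    have : (n : ℂ) + m + k - 2 = ((n + m + k - 2 : ℕ) : ℂ) := by
      rw [Nat.cast_sub (by omega)]; push_cast; ring
    rw [this, Nat.cast_ne_zero]; omega
  have h5 : (m : ℂ) - k ≠ 0 := sub_ne_zero.2 (by exact_mod_cast hmk)
  exact (mul_eq_zero.1 h3).resolve_left (mul_ne_zero h4 h5)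

/-! ### Zonal harmonics -/

/-- Zonal harmonics, normalized to take the value `1` at `(1, 1)`, as functions of `⟨x, y⟩` and
`|x|² |y|²`. -/
noncomputable def zonal (n : ℕ) : ℕ → ℝ → ℝ → ℝ
  | 0, _, _ => 1
  | 1, τ, _ => τ
  | m + 2, τ, ρ =>
    ((2 * m + n) * τ * zonal n (m + 1) τ ρ - (m + 1) * ρ * zonal n m τ ρ) / (m + n - 1)

theorem cast_add_sub_one_pos {n : ℕ} (hn : 2 < n) (m : ℕ) : (0 : ℝ) < m + n - 1 := by
  have : (2 : ℝ) < n := by exact_mod_cast hn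
  linarith [m.cast_nonneg (α := ℝ)]

theorem zonal_add_two {n : ℕ} (hn : 2 < n) (m : ℕ) (τ ρ : ℝ) :
    (m + n - 1) * zonal n (m + 2) τ ρ =
      (2 * m + n) * τ * zonal n (m + 1) τ ρ - (m + 1) * ρ * zonal n m τ ρ := by
  have := (cast_add_sub_one_pos hn m).ne'
  rw [zonal]
  field_simp

theorem zonal_mul_sq {n : ℕ} (r τ ρ : ℝ) (m : ℕ) :
    zonal n m (r * τ) (r ^ 2 * ρ) = r ^ m * zonal n m τ ρ := by
  induction m using Nat.twoStepInduction with
  | zero => simp [zonal]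
  | one => simp [zonal]
  | more m h0 h1 => rw [zonal, h0, h1, zonal]; ring

theorem zonal_one_one {n : ℕ} (hn : 2 < n) (m : ℕ) : zonal n m 1 1 = 1 := by
  induction m using Nat.twoStepInduction with
  | zero => simp [zonal]
  | one => simp [zonal]
  | more m h0 h1 =>
    have := (cast_add_sub_one_pos hn m).ne'
    rw [zonal, h0, h1, div_eq_one_iff_eq this]; ring

open MvPolynomial in
/-- The linear form `⟨·, y⟩`. -/
noncomputable def linForm {n : ℕ} (y : E n) : MvPolynomial (Fin n) ℂ := ∑ i, C (y i : ℂ) * X i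

open MvPolynomial in
/-- The polynomial `|x|²`. -/
noncomputable def normSqPoly (n : ℕ) : MvPolynomial (Fin n) ℂ := ∑ i, X i ^ 2

open MvPolynomial in
/-- The zonal harmonic with pole `y`. -/
noncomputable def zonalPoly {n : ℕ} (y : E n) : ℕ → MvPolynomial (Fin n) ℂ
  | 0 => 1
  | 1 => linForm y
  | m + 2 => C (((m + n - 1 : ℝ)⁻¹ : ℝ) : ℂ) * (((2 * m + n : ℕ) : MvPolynomial (Fin n) ℂ) *
      (linForm y * zonalPoly y (m + 1)) -
      ((m + 1 : ℕ) : MvPolynomial (Fin n) ℂ) * (C ((‖y‖ ^ 2 : ℝ) : ℂ) *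
        (normSqPoly n * zonalPoly y m)))

theorem polyEval_linForm {n : ℕ} (y x : E n) : polyEval (linForm y) x = (inner ℝ x y : ℝ) := by
  rw [linForm, ← sum_mul_eq_inner]
  simp [mul_comm]

theorem polyEval_normSqPoly {n : ℕ} (x : E n) :
    polyEval (normSqPoly n) x = ((‖x‖ ^ 2 : ℝ) : ℂ) := by
  rw [normSqPoly, ← sum_sq_eq_normSq]
  simp

theorem polyEval_zonalPoly {n : ℕ} (y x : E n) (m : ℕ) :
    polyEval (zonalPoly y m) x = (zonal n m (inner ℝ x y) (‖x‖ ^ 2 * ‖y‖ ^ 2) : ℝ) := by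
  induction m using Nat.twoStepInduction with
  | zero => simp [zonal, zonalPoly]
  | one => simp [zonal, zonalPoly, polyEval_linForm]
  | more m h0 h1 =>
    rw [zonalPoly, zonal]
    simp only [polyEval_mul, polyEval_C, polyEval_sub, polyEval_natCast, h0, h1,
      polyEval_linForm, polyEval_normSqPoly]
    push_cast
    ring

theorem zonalPoly_add_two {n : ℕ} (hn : 2 < n) (y : E n) (m : ℕ) :
    ((m : MvPolynomial (Fin n) ℂ) + (n : MvPolynomial (Fin n) ℂ) - 1) * zonalPoly y (m + 2) =
      (2 * (m : MvPolynomial (Fin n) ℂ) + (n : MvPolynomial (Fin n) ℂ)) * (linForm y * zonalPoly y (m + 1)) -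
      ((m : MvPolynomial (Fin n) ℂ) + 1) * (MvPolynomial.C ((‖y‖ ^ 2 : ℝ) : ℂ) * (normSqPoly n * zonalPoly y m)) := by
  have h := cast_add_sub_one_pos hn m
  have e : ((m : MvPolynomial (Fin n) ℂ) + (n : MvPolynomial (Fin n) ℂ) - 1) *
      MvPolynomial.C (((m + n - 1 : ℝ)⁻¹ : ℝ) : ℂ) = 1 := by
    have : (m : MvPolynomial (Fin n) ℂ) + (n : MvPolynomial (Fin n) ℂ) - 1 = MvPolynomial.C ((m + n - 1 : ℝ) : ℂ) := by
      simp
    rw [this, ← map_mul, ← Complex.ofReal_mul, mul_inv_cancel₀ h.ne']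
    simp
  rw [zonalPoly, ← mul_assoc, e, one_mul]
  push_cast
  rfl

theorem isHomogeneous_linForm {n : ℕ} (y : E n) : (linForm y).IsHomogeneous 1 :=
  MvPolynomial.IsHomogeneous.sum _ _ _ fun i _ => MvPolynomial.isHomogeneous_C_mul_X _ i

theorem isHomogeneous_normSqPoly (n : ℕ) : (normSqPoly n).IsHomogeneous 2 :=
  MvPolynomial.IsHomogeneous.sum _ _ _ fun i _ => MvPolynomial.isHomogeneous_X_pow i 2

theorem isHomogeneous_zonalPoly {n : ℕ} (y : E n) (m : ℕ) : (zonalPoly y m).IsHomogeneous m := by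
  induction m using Nat.twoStepInduction with
  | zero => exact MvPolynomial.isHomogeneous_one _ _
  | one => exact isHomogeneous_linForm y
  | more m h0 h1 =>
    rw [zonalPoly]
    have hc : ∀ k : ℕ, (k : MvPolynomial (Fin n) ℂ) = MvPolynomial.C (k : ℂ) := fun k => by simp
    rw [hc, hc]
    refine MvPolynomial.IsHomogeneous.C_mul (MvPolynomial.IsHomogeneous.sub
      (MvPolynomial.IsHomogeneous.C_mul ?_ _)
      (MvPolynomial.IsHomogeneous.C_mul (MvPolynomial.IsHomogeneous.C_mul ?_ _) _)) _
    · have := (isHomogeneous_linForm y).mul h1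
      rwa [show 1 + (m + 1) = m + 2 by ring] at this
    · have := (isHomogeneous_normSqPoly n).mul h0
      rwa [add_comm 2 m] at this

/-- The directional derivative along `y` on polynomials. -/
noncomputable def dirDeriv {n : ℕ} (y : E n) :
    Derivation ℂ (MvPolynomial (Fin n) ℂ) (MvPolynomial (Fin n) ℂ) :=
  ∑ i, (y i : ℂ) • MvPolynomial.pderiv i

theorem dirDeriv_apply {n : ℕ} (y : E n) (p : MvPolynomial (Fin n) ℂ) :
    dirDeriv y p = ∑ i, MvPolynomial.C (y i : ℂ) * MvPolynomial.pderiv i p := by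
  have h : ∀ s : Finset (Fin n), (∑ i ∈ s, (y i : ℂ) • MvPolynomial.pderiv i :
      Derivation ℂ (MvPolynomial (Fin n) ℂ) (MvPolynomial (Fin n) ℂ)) p =
      ∑ i ∈ s, MvPolynomial.C (y i : ℂ) * MvPolynomial.pderiv i p := by
    classical
    intro s
    induction s using Finset.induction_on with
    | empty => simp
    | insert a s ha ih =>
      rw [Finset.sum_insert ha, Finset.sum_insert ha, Derivation.add_apply, ih,
        Derivation.smul_apply, MvPolynomial.smul_eq_C_mul]
  exact h _

theorem dirDeriv_mul {n : ℕ} (y : E n) (p q : MvPolynomial (Fin n) ℂ) :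
    dirDeriv y (p * q) = dirDeriv y p * q + p * dirDeriv y q := by
  rw [Derivation.leibniz, smul_eq_mul, smul_eq_mul]; ring

@[simp] theorem dirDeriv_C {n : ℕ} (y : E n) (a : ℂ) : dirDeriv y (MvPolynomial.C a) = 0 :=
  (dirDeriv y).map_algebraMap a

theorem pderiv_linForm {n : ℕ} (y : E n) (i : Fin n) :
    MvPolynomial.pderiv i (linForm y) = MvPolynomial.C (y i : ℂ) := by
  classical
  simp [linForm, MvPolynomial.pderiv_X, Pi.single_apply]

theorem pderiv_normSqPoly {n : ℕ} (i : Fin n) :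
    MvPolynomial.pderiv i (normSqPoly n) = 2 * MvPolynomial.X i := by
  classical
  simp [normSqPoly, MvPolynomial.pderiv_X, Pi.single_apply]

theorem dirDeriv_linForm {n : ℕ} (y : E n) :
    dirDeriv y (linForm y) = MvPolynomial.C ((‖y‖ ^ 2 : ℝ) : ℂ) := by
  rw [dirDeriv_apply, ← sum_sq_eq_normSq]
  simp_rw [pderiv_linForm, ← map_mul]
  rw [← map_sum]
  congr 1
  push_cast
  exact Finset.sum_congr rfl fun i _ => by ring

theorem dirDeriv_normSqPoly {n : ℕ} (y : E n) :
    dirDeriv y (normSqPoly n) = 2 * linForm y := by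
  rw [dirDeriv_apply, linForm, Finset.mul_sum]
  refine Finset.sum_congr rfl fun i _ => ?_
  rw [pderiv_normSqPoly]; ring

theorem cast_add_sub_one_ne_zero {n : ℕ} (hn : 2 < n) (m : ℕ) :
    (m : MvPolynomial (Fin n) ℂ) + (n : MvPolynomial (Fin n) ℂ) - 1 ≠ 0 := by
  have : ((m + n - 1 : ℕ) : MvPolynomial (Fin n) ℂ) ≠ 0 := by
    rw [Nat.cast_ne_zero]; omega
  rwa [Nat.cast_sub (by omega), Nat.cast_add, Nat.cast_one] at this

/-- Obtained by differentiating the three-term recurrence along y and inducting. It is needed both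
for harmonicity and for the reproducing property. The factor m+n-1 of the recurrence is cleared by
cancelling in the domain of polynomials. -/
theorem dirDeriv_zonalPoly_succ {n : ℕ} (hn : 2 < n) (y : E n) (m : ℕ) :
    dirDeriv y (zonalPoly y (m + 1)) =
      ((m : MvPolynomial (Fin n) ℂ) + 1) * (MvPolynomial.C ((‖y‖ ^ 2 : ℝ) : ℂ) * zonalPoly y m) := by
  have hrec : ∀ m : ℕ, ((m : MvPolynomial (Fin n) ℂ) + (n : MvPolynomial (Fin n) ℂ) - 1) * dirDeriv y (zonalPoly y (m + 2)) =
      (2 * (m : MvPolynomial (Fin n) ℂ) + (n : MvPolynomial (Fin n) ℂ)) * (dirDeriv y (linForm y) * zonalPoly y (m + 1) +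
        linForm y * dirDeriv y (zonalPoly y (m + 1))) -
      ((m : MvPolynomial (Fin n) ℂ) + 1) * (MvPolynomial.C ((‖y‖ ^ 2 : ℝ) : ℂ) * (dirDeriv y (normSqPoly n) * zonalPoly y m +
        normSqPoly n * dirDeriv y (zonalPoly y m))) := by
    intro m
    have h := congrArg (dirDeriv y) (zonalPoly_add_two hn y m)
    simp only [map_sub, map_add, dirDeriv_mul, dirDeriv_C, Derivation.map_natCast,
      Derivation.map_one_eq_zero] at h
    have h2 : dirDeriv y (2 : MvPolynomial (Fin n) ℂ) = 0 := by
      exact_mod_cast Derivation.map_natCast (dirDeriv y) 2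
    rw [h2] at h
    linear_combination h
  induction m using Nat.twoStepInduction with
  | zero => simp [zonalPoly, dirDeriv_linForm]
  | one =>
    have h := hrec 0
    refine mul_left_cancel₀ (cast_add_sub_one_ne_zero hn 0) ?_
    rw [h]
    simp only [zonalPoly, dirDeriv_linForm, dirDeriv_normSqPoly, Derivation.map_one_eq_zero]
    push_cast
    ring
  | more m h0 h1 =>
    have h := hrec (m + 1)
    have h3 := zonalPoly_add_two hn y m
    rw [h0, h1, dirDeriv_linForm, dirDeriv_normSqPoly] at h
    refine mul_left_cancel₀ (cast_add_sub_one_ne_zero hn (m + 1)) ?_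
    rw [h]
    simp only [Nat.cast_add, Nat.cast_one]
    linear_combination (-(m + 2) * MvPolynomial.C ((‖y‖ ^ 2 : ℝ) : ℂ)) * h3

/-- The Laplacian on polynomials. -/
noncomputable def polyLaplacian {n : ℕ} (p : MvPolynomial (Fin n) ℂ) : MvPolynomial (Fin n) ℂ :=
  ∑ i, MvPolynomial.pderiv i (MvPolynomial.pderiv i p)

theorem polyLaplacian_sub {n : ℕ} (p q : MvPolynomial (Fin n) ℂ) :
    polyLaplacian (p - q) = polyLaplacian p - polyLaplacian q := by
  simp [polyLaplacian]

theorem polyLaplacian_mul {n : ℕ} (p q : MvPolynomial (Fin n) ℂ) :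
    polyLaplacian (p * q) = polyLaplacian p * q +
      2 * ∑ i, MvPolynomial.pderiv i p * MvPolynomial.pderiv i q + p * polyLaplacian q := by
  simp only [polyLaplacian, MvPolynomial.pderiv_mul, map_add, Finset.sum_mul, Finset.mul_sum,
    ← Finset.sum_add_distrib]
  exact Finset.sum_congr rfl fun i _ => by ring

theorem polyLaplacian_C_mul {n : ℕ} (a : ℂ) (p : MvPolynomial (Fin n) ℂ) :
    polyLaplacian (MvPolynomial.C a * p) = MvPolynomial.C a * polyLaplacian p := by
  simp [polyLaplacian, Finset.mul_sum]

theorem polyLaplacian_natCast_mul {n : ℕ} (a : ℕ) (p : MvPolynomial (Fin n) ℂ) :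
    polyLaplacian ((a : MvPolynomial (Fin n) ℂ) * p) = (a : MvPolynomial (Fin n) ℂ) * polyLaplacian p := by
  have := polyLaplacian_C_mul (a : ℂ) p
  simpa using this

theorem polyLaplacian_linForm_mul {n : ℕ} (y : E n) (p : MvPolynomial (Fin n) ℂ) :
    polyLaplacian (linForm y * p) = 2 * dirDeriv y p + linForm y * polyLaplacian p := by
  rw [polyLaplacian_mul, dirDeriv_apply]
  simp [polyLaplacian, pderiv_linForm]

theorem polyLaplacian_normSqPoly_mul {n m : ℕ} {p : MvPolynomial (Fin n) ℂ}
    (hp : p.IsHomogeneous m) :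
    polyLaplacian (normSqPoly n * p) = (2 * (n : MvPolynomial (Fin n) ℂ) + 4 * (m : MvPolynomial (Fin n) ℂ)) * p + normSqPoly n * polyLaplacian p := by
  have h1 : polyLaplacian (normSqPoly n) = 2 * (n : MvPolynomial (Fin n) ℂ) := by
    simp only [polyLaplacian, pderiv_normSqPoly, MvPolynomial.pderiv_mul,
      MvPolynomial.pderiv_X_self]
    have : ∀ i : Fin n, MvPolynomial.pderiv i (2 : MvPolynomial (Fin n) ℂ) = 0 := fun i => by
      exact_mod_cast Derivation.map_natCast (MvPolynomial.pderiv i) 2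
    simp [this, mul_comm]
  have h2 : ∑ i, MvPolynomial.pderiv i (normSqPoly n) * MvPolynomial.pderiv i p = 2 * ((m : MvPolynomial (Fin n) ℂ) * p) := by
    have := hp.sum_X_mul_pderiv
    rw [nsmul_eq_mul] at this
    rw [← this, Finset.mul_sum]
    exact Finset.sum_congr rfl fun i _ => by rw [pderiv_normSqPoly]; ring
  rw [polyLaplacian_mul, h1, h2]; ring

/-- The two terms of the recurrence contribute (2m+n)·2(m+1)|y|² Z_m and (m+1)|y|²(2n+4m) Z_m, which
cancel. -/
theorem polyLaplacian_zonalPoly {n : ℕ} (hn : 2 < n) (y : E n) (m : ℕ) :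
    polyLaplacian (zonalPoly y m) = 0 := by
  induction m using Nat.twoStepInduction with
  | zero => simp [polyLaplacian, zonalPoly]
  | one =>
    have := polyLaplacian_linForm_mul y 1
    rw [mul_one] at this
    simpa [zonalPoly, polyLaplacian] using this
  | more m h0 h1 =>
    rw [zonalPoly, polyLaplacian_C_mul, polyLaplacian_sub, polyLaplacian_natCast_mul,
      polyLaplacian_natCast_mul, polyLaplacian_C_mul, polyLaplacian_linForm_mul,
      polyLaplacian_normSqPoly_mul (isHomogeneous_zonalPoly y m), h0, h1,
      dirDeriv_zonalPoly_succ hn]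
    push_cast
    ring

theorem isHarmonicHomogeneous_zonalPoly {n : ℕ} (hn : 2 < n) (y : E n) (m : ℕ) :
    IsHarmonicHomogeneous m (zonalPoly y m) :=
  ⟨isHomogeneous_zonalPoly y m, polyLaplacian_zonalPoly hn y m⟩

/-- The commutator of two derivations is a derivation, and this one vanishes on the variables. -/
theorem pderiv_comm {n : ℕ} (i j : Fin n) (p : MvPolynomial (Fin n) ℂ) :
    MvPolynomial.pderiv i (MvPolynomial.pderiv j p) =
      MvPolynomial.pderiv j (MvPolynomial.pderiv i p) := by
  classical
  let D : Fin n → Derivation ℂ (MvPolynomial (Fin n) ℂ) (MvPolynomial (Fin n) ℂ) :=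
    fun k => MvPolynomial.pderiv k
  have h : ⁅D i, D j⁆ = 0 := by
    apply MvPolynomial.derivation_ext
    intro k
    rw [Derivation.commutator_apply]
    simp only [D, MvPolynomial.pderiv_X, Pi.single_apply]
    split_ifs <;> simp
  have h2 := congrArg (fun D : Derivation ℂ (MvPolynomial (Fin n) ℂ) (MvPolynomial (Fin n) ℂ) => D p) h
  rw [Derivation.commutator_apply] at h2
  exact sub_eq_zero.1 h2

theorem IsHarmonicHomogeneous.dirDeriv {n m : ℕ} {p : MvPolynomial (Fin n) ℂ}
    (hp : IsHarmonicHomogeneous m p) (y : E n) :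
    IsHarmonicHomogeneous (m - 1) (dirDeriv y p) := by
  rw [dirDeriv_apply]
  refine ⟨MvPolynomial.IsHomogeneous.sum _ _ _ fun i _ => (hp.1.pderiv).C_mul _, ?_⟩
  simp only [map_sum, MvPolynomial.pderiv_C_mul]
  rw [Finset.sum_comm]
  refine Finset.sum_eq_zero fun i _ => ?_
  rw [← Finset.mul_sum]
  have h : ∑ j, MvPolynomial.pderiv j (MvPolynomial.pderiv j (MvPolynomial.pderiv i p)) =
      MvPolynomial.pderiv i (∑ j, MvPolynomial.pderiv j (MvPolynomial.pderiv j p)) := by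
    rw [map_sum]
    refine Finset.sum_congr rfl fun j _ => ?_
    rw [pderiv_comm j i, pderiv_comm j i]
  rw [h, hp.2, map_zero, mul_zero]

/-! ### The reproducing property and bounds for zonal harmonics -/

/-- The reciprocal of the dimension of the space of spherical harmonics. -/
noncomputable def invDim (n : ℕ) : ℕ → ℝ
  | 0 => 1
  | m + 1 => (2 * m + n - 2) * (m + 1) / ((m + n - 2) * (n + 2 * m)) * invDim n m

theorem invDim_pos {n : ℕ} (hn : 2 < n) (m : ℕ) : 0 < invDim n m := by
  have h : (2 : ℝ) < n := by exact_mod_cast hn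
  induction m with
  | zero => simp [invDim]
  | succ m ih =>
    have h1 : (0 : ℝ) < 2 * m + n - 2 := by linarith [m.cast_nonneg (α := ℝ)]
    have h2 : (0 : ℝ) < m + n - 2 := by linarith [m.cast_nonneg (α := ℝ)]
    rw [invDim]; positivity

theorem sphereMean_linForm_mul {n m : ℕ} (hn : 0 < n) (y : E n) {p : MvPolynomial (Fin n) ℂ}
    (hp : p.IsHomogeneous m) :
    sphereMean (dirDeriv y p) = (n + m - 1) * sphereMean (linForm y * p) := by
  rw [dirDeriv_apply, linForm, Finset.sum_mul, sphereMean_sum, sphereMean_sum, Finset.mul_sum]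
  refine Finset.sum_congr rfl fun i _ => ?_
  rw [sphereMean_C_mul, sphereMean_pderiv hn hp, mul_assoc, sphereMean_C_mul]
  ring

theorem polyEval_dirDeriv_self {n m : ℕ} {p : MvPolynomial (Fin n) ℂ} (hp : p.IsHomogeneous m)
    (y : E n) : polyEval (dirDeriv y p) y = m * polyEval p y := by
  rw [dirDeriv_apply, ← sum_mul_polyEval_pderiv hp]
  simp

/-- The reproducing property of the zonal harmonics. -/
theorem sphereMean_zonalPoly_mul {n : ℕ} (hn : 2 < n) (y : E n) (m : ℕ) :
    ∀ {p : MvPolynomial (Fin n) ℂ}, IsHarmonicHomogeneous m p →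
      sphereMean (zonalPoly y m * p) = invDim n m * polyEval p y := by
  have hn0 : 0 < n := by omega
  have hnC : (n : ℂ) ≠ 0 := by exact_mod_cast hn0.ne'
  induction m with
  | zero =>
    intro p hp
    have : p.totalDegree = 0 := Nat.le_zero.1 hp.1.totalDegree_le
    rw [MvPolynomial.totalDegree_eq_zero_iff_eq_C] at this
    rw [this]
    simp [zonalPoly, invDim, sphereMean_C hn0]
  | succ m ih =>
    intro p hp
    have hD := hp.dirDeriv y
    rw [Nat.add_sub_cancel] at hD
    have h1 := ih hD
    rw [polyEval_dirDeriv_self hp.1] at h1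
    -- The divergence theorem in direction y applied to Z_m p. In the product rule the term Z_m ∂_y
    -- p is known by induction, and (∂_y Z_m) p is a multiple of Z_{m-1} p, orthogonal by degree.
    have h2 := sphereMean_linForm_mul hn0 y ((isHomogeneous_zonalPoly y m).mul hp.1)
    rw [dirDeriv_mul, sphereMean_add, h1] at h2
    rcases m with _ | m
    · simp only [zonalPoly, Derivation.map_one_eq_zero, zero_mul, sphereMean_zero] at h2 ⊢
      rw [invDim]
      have h3 : (n : ℂ) - 2 ≠ 0 := by
        have : (n : ℂ) - 2 = ((n - 2 : ℕ) : ℂ) := by rw [Nat.cast_sub (by omega)]; simp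
        rw [this, Nat.cast_ne_zero]; omega
      push_cast at h2 ⊢
      simp only [one_mul, mul_zero, zero_add, add_zero, mul_one] at h2 ⊢
      field_simp
      linear_combination -h2
    · have h4 : sphereMean (dirDeriv y (zonalPoly y (m + 1)) * p) = 0 := by
        rw [dirDeriv_zonalPoly_succ hn]
        have : ((m : MvPolynomial (Fin n) ℂ) + 1) *
            (MvPolynomial.C ((‖y‖ ^ 2 : ℝ) : ℂ) * zonalPoly y m) * p =
            MvPolynomial.C (((m : ℂ) + 1) * ((‖y‖ ^ 2 : ℝ) : ℂ)) * (zonalPoly y m * p) := by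
          simp only [map_mul, map_add, map_natCast, map_one]; ring
        rw [this, sphereMean_C_mul, sphereMean_mul_eq_zero hn hp
          (isHarmonicHomogeneous_zonalPoly hn y m) (by omega), mul_zero]
      have h5 : ((m : ℂ) + n - 1) * sphereMean (zonalPoly y (m + 2) * p) =
          (2 * m + n) * sphereMean (linForm y * (zonalPoly y (m + 1) * p)) := by
        have e1 : sphereMean (((m : MvPolynomial (Fin n) ℂ) + (n : MvPolynomial (Fin n) ℂ) - 1) * zonalPoly y (m + 2) * p) =
            ((m : ℂ) + n - 1) * sphereMean (zonalPoly y (m + 2) * p) := by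
          rw [← sphereMean_C_mul]
          congr 1
          simp only [map_sub, map_add, map_natCast, map_one]; ring
        rw [← e1, zonalPoly_add_two hn]
        have e2 : sphereMean (((2 * (m : MvPolynomial (Fin n) ℂ) + (n : MvPolynomial (Fin n) ℂ)) * (linForm y * zonalPoly y (m + 1)) -
            ((m : MvPolynomial (Fin n) ℂ) + 1) * (MvPolynomial.C ((‖y‖ ^ 2 : ℝ) : ℂ) * (normSqPoly n * zonalPoly y m))) * p) =
            sphereMean (MvPolynomial.C (2 * (m : ℂ) + n) *
              (linForm y * (zonalPoly y (m + 1) * p)) +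
              MvPolynomial.C (-((m : ℂ) + 1) * ((‖y‖ ^ 2 : ℝ) : ℂ)) * (zonalPoly y m * p)) := by
          refine sphereMean_congr fun ζ hζ => ?_
          have hζ1 : ‖ζ‖ = 1 := by simpa using hζ
          have c1 : (2 * (m : MvPolynomial (Fin n) ℂ) + (n : MvPolynomial (Fin n) ℂ)) = ((2 * m + n : ℕ) : MvPolynomial (Fin n) ℂ) := by
            push_cast; rfl
          have c2 : ((m : MvPolynomial (Fin n) ℂ) + 1) = ((m + 1 : ℕ) : MvPolynomial (Fin n) ℂ) := by
            push_cast; rfl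
          rw [c1, c2]
          simp only [polyEval_mul, polyEval_sub, polyEval_add, polyEval_C, polyEval_natCast,
            polyEval_normSqPoly, hζ1]
          push_cast
          ring
        rw [e2, sphereMean_add, sphereMean_C_mul, sphereMean_C_mul, sphereMean_mul_eq_zero hn hp
          (isHarmonicHomogeneous_zonalPoly hn y m) (by omega), mul_zero, add_zero]
      rw [h4] at h2
      rw [invDim]
      have p1 : (m : ℂ) + n - 1 ≠ 0 := by
        have := (cast_add_sub_one_pos hn m).ne'
        exact_mod_cast this
      have p2 : (n : ℂ) + 2 * (m + 1) ≠ 0 := by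
        have : (n : ℝ) + 2 * (m + 1) ≠ 0 := by positivity
        exact_mod_cast this
      push_cast at h2 h5 ⊢
      have p3 : (m : ℂ) + 1 + n - 2 ≠ 0 := by
        convert p1 using 1; ring
      field_simp
      linear_combination (n + 2 * (m + 1) : ℂ) * h5 - (2 * m + n : ℂ) * h2

theorem re_sphereMean_nonneg {n : ℕ} {p : MvPolynomial (Fin n) ℂ}
    (h : ∀ ζ ∈ sphere (0 : E n) 1, 0 ≤ (polyEval p ζ).re) : 0 ≤ (sphereMean p).re := by
  rw [sphereMean_eq, Complex.re_ofReal_mul]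
  refine mul_nonneg (by positivity) ?_
  have := integral_re (𝕜 := ℂ) (integrable_sphere_of_continuous (continuous_polyEval_sphere p))
  have h2 : (∫ ζ : sphere (0 : E n) 1, polyEval p ζ ∂(volume : Measure (E n)).toSphere).re =
      ∫ ζ : sphere (0 : E n) 1, (polyEval p ζ).re ∂(volume : Measure (E n)).toSphere := this.symm
  rw [h2]
  exact integral_nonneg fun ζ => h ζ ζ.2

/-- The mean of the square of Z_ζ + s Z_η, for s = ±1, is nonnegative; by the reproducing property
it equals 2(1 + s Z_m(ζ, η)) times the reciprocal of the dimension. -/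
theorem abs_zonal_le_one {n : ℕ} (hn : 2 < n) {ζ η : E n} (hζ : ‖ζ‖ = 1) (hη : ‖η‖ = 1) (m : ℕ) :
    |zonal n m (inner ℝ ζ η) 1| ≤ 1 := by
  have hself : ∀ ξ : E n, ‖ξ‖ = 1 → polyEval (zonalPoly ξ m) ξ = 1 := by
    intro ξ hξ
    rw [polyEval_zonalPoly, real_inner_self_eq_norm_sq, hξ]
    simp [zonal_one_one hn]
  have hcross1 : polyEval (zonalPoly ζ m) η = (zonal n m (inner ℝ ζ η) 1 : ℝ) := by
    rw [polyEval_zonalPoly, hζ, hη, real_inner_comm]; simp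
  have hcross2 : polyEval (zonalPoly η m) ζ = (zonal n m (inner ℝ ζ η) 1 : ℝ) := by
    rw [polyEval_zonalPoly, hζ, hη]; simp
  have key : ∀ s : ℝ, s ^ 2 = 1 → 0 ≤ 1 + s * zonal n m (inner ℝ ζ η) 1 := by
    intro s hs
    have hsC : (s : ℂ) ^ 2 = 1 := by exact_mod_cast hs
    have h1 := re_sphereMean_nonneg
      (p := (zonalPoly ζ m + MvPolynomial.C (s : ℂ) * zonalPoly η m) ^ 2) (fun ξ _ => by
        simp only [polyEval_pow, polyEval_add, polyEval_mul, polyEval_C, polyEval_zonalPoly]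
        rw [← Complex.ofReal_mul, ← Complex.ofReal_add, ← Complex.ofReal_pow, Complex.ofReal_re]
        positivity)
    have e : (zonalPoly ζ m + MvPolynomial.C (s : ℂ) * zonalPoly η m) ^ 2 =
        zonalPoly ζ m * zonalPoly ζ m + (MvPolynomial.C (s : ℂ) * (zonalPoly ζ m * zonalPoly η m) +
          (MvPolynomial.C (s : ℂ) * (zonalPoly η m * zonalPoly ζ m) +
          MvPolynomial.C ((s : ℂ) ^ 2) * (zonalPoly η m * zonalPoly η m))) := by
      rw [map_pow]; ring
    have hz := isHarmonicHomogeneous_zonalPoly hn ζ m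
    have hh := isHarmonicHomogeneous_zonalPoly hn η m
    rw [e, sphereMean_add, sphereMean_add, sphereMean_add, sphereMean_C_mul, sphereMean_C_mul,
      sphereMean_C_mul, sphereMean_zonalPoly_mul hn ζ m hz, sphereMean_zonalPoly_mul hn ζ m hh,
      sphereMean_zonalPoly_mul hn η m hz, sphereMean_zonalPoly_mul hn η m hh, hself ζ hζ,
      hself η hη, hcross1, hcross2, hsC] at h1
    have e2 : (invDim n m * 1 + (s * (invDim n m * (zonal n m (inner ℝ ζ η) 1 : ℝ)) +
        (s * (invDim n m * (zonal n m (inner ℝ ζ η) 1 : ℝ)) + 1 * (invDim n m * 1))) : ℂ) =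
        ((2 * invDim n m * (1 + s * zonal n m (inner ℝ ζ η) 1) : ℝ) : ℂ) := by
      push_cast; ring
    rw [e2, Complex.ofReal_re] at h1
    have := invDim_pos hn m
    exact nonneg_of_mul_nonneg_right h1 (by positivity)
  rw [abs_le]
  constructor <;> linarith [key 1 (by norm_num), key (-1) (by norm_num)]

theorem abs_zonal_le {n : ℕ} (hn : 2 < n) {ζ : E n} (hζ : ‖ζ‖ = 1) (y : E n) (m : ℕ) :
    |zonal n m (inner ℝ ζ y) (‖y‖ ^ 2)| ≤ ‖y‖ ^ m := by
  by_cases hy : y = 0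
  · have := zonal_mul_sq (n := n) 0 0 0 m
    rcases m with _ | m
    · simp [zonal]
    · simp [hy] at this ⊢
      exact this
  · have hy' : ‖y‖ ≠ 0 := norm_ne_zero_iff.2 hy
    have h1 := abs_zonal_le_one hn hζ (η := ‖y‖⁻¹ • y) (by simp [norm_smul, hy']) m
    have h2 := zonal_mul_sq (n := n) ‖y‖ (inner ℝ ζ (‖y‖⁻¹ • y)) 1 m
    rw [inner_smul_right, ← mul_assoc, mul_inv_cancel₀ hy', one_mul, mul_one] at h2
    rw [h2, abs_mul, abs_of_nonneg (by positivity)]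
    rw [inner_smul_right] at h1
    exact mul_le_of_le_one_right (by positivity) h1

/-! ### Zonal expansion of cosines and of the logarithm -/

/-- The ratio `(j - 1)! / (l)ⱼ₊₁`, with value `0` for `j = 0`. -/
noncomputable def gammaRatio (l : ℝ) (j : ℕ) : ℝ :=
  if j = 0 then 0 else (j - 1).factorial / poch l (j + 1)

theorem gammaRatio_succ (l : ℝ) (j : ℕ) : gammaRatio l (j + 1) = j.factorial / poch l (j + 2) := by
  simp [gammaRatio]

theorem gammaRatio_add_two {l : ℝ} (hl : 0 < l) (j : ℕ) :
    gammaRatio l (j + 2) = (j + 1) / (l + j + 2) * gammaRatio l (j + 1) := by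
  have := poch_pos hl (j + 2)
  have h2 : 0 < l + j + 2 := by positivity
  rw [gammaRatio_succ, gammaRatio_succ, poch_succ l (j + 2), Nat.factorial_succ]
  push_cast
  have h3 : l + (j + 2 : ℝ) ≠ 0 := by positivity
  field_simp
  ring

/-- The coefficient of `r ^ (m + 2 k)` times the zonal harmonic of degree `m` in the expansion of
`-log (1 - 2 r t + r²)`. -/
noncomputable def logCoeff (l : ℝ) (m k : ℕ) : ℝ :=
  poch (2 * l) m / m.factorial * (m + l) * gammaRatio l (m + k) * binCoeff l k

/-- The coefficient of the zonal harmonic of degree `m` in `2 cos ((m + 2 k) θ)`. -/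
noncomputable def cosCoeff (l : ℝ) (m k : ℕ) : ℝ := (m + 2 * k) * logCoeff l m k

theorem poch_div_factorial_succ (a : ℝ) (m : ℕ) :
    poch a (m + 1) / (m + 1).factorial = poch a m / m.factorial * ((a + m) / (m + 1)) := by
  rw [poch_succ, Nat.factorial_succ]
  push_cast
  field_simp

theorem binCoeff_succ_eq (l : ℝ) (k : ℕ) :
    binCoeff l (k + 1) = (k - l) / (k + 1) * binCoeff l k := by
  have := binCoeff_succ l k
  field_simp
  linarith

/-- This is the coefficient of degree m + 1 in cos((N+1)θ) + cos((N-1)θ) = 2 cos θ cos(Nθ), N =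
m+2k+2, when cos θ times a zonal harmonic is resolved by the three-term recurrence. The two lemmas
that follow are the boundary cases. -/
theorem cosCoeff_recurrence {l : ℝ} (hl : 0 < l) (m k : ℕ) :
    cosCoeff l (m + 1) (k + 1) + cosCoeff l (m + 1) k =
      (m + 2 * l) / (m + l) * cosCoeff l m (k + 1) +
        (m + 2) / (m + 2 + l) * cosCoeff l (m + 2) k := by
  simp only [cosCoeff, logCoeff]
  rw [show m + 1 + (k + 1) = m + k + 2 by ring, show m + 1 + k = m + k + 1 by ring,
    show m + (k + 1) = m + k + 1 by ring, show m + 2 + k = m + k + 2 by ring,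
    gammaRatio_add_two hl, poch_div_factorial_succ _ (m + 1), poch_div_factorial_succ,
    binCoeff_succ_eq]
  generalize poch (2 * l) m / m.factorial = P
  generalize gammaRatio l (m + k + 1) = G
  generalize binCoeff l k = q
  push_cast
  have h1 : (m : ℝ) + l ≠ 0 := by positivity
  have h2 : (m : ℝ) + 2 + l ≠ 0 := by positivity
  have h3 : l + (m + k) + 2 ≠ 0 := by positivity
  field_simp
  ring

theorem cosCoeff_recurrence_left {l : ℝ} (hl : 0 < l) (m : ℕ) :
    cosCoeff l (m + 2) 0 = (m + 1 + 2 * l) / (m + 1 + l) * cosCoeff l (m + 1) 0 := by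
  simp only [cosCoeff, logCoeff, add_zero]
  rw [gammaRatio_add_two hl, poch_div_factorial_succ _ (m + 1)]
  generalize poch (2 * l) (m + 1) / (m + 1).factorial = P
  generalize gammaRatio l (m + 1) = G
  push_cast
  have h1 : (m : ℝ) + 1 + l ≠ 0 := by positivity
  have h2 : l + (m : ℝ) + 2 ≠ 0 := by positivity
  field_simp
  ring

theorem cosCoeff_recurrence_right {l : ℝ} (hl : 0 < l) (k : ℕ) :
    cosCoeff l 0 (k + 2) + cosCoeff l 0 (k + 1) = 1 / (1 + l) * cosCoeff l 1 (k + 1) := by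
  simp only [cosCoeff, logCoeff]
  rw [show 0 + (k + 2) = k + 2 by ring, show 0 + (k + 1) = k + 1 by ring,
    show 1 + (k + 1) = k + 2 by ring, gammaRatio_add_two hl, binCoeff_succ_eq l (k + 1)]
  generalize gammaRatio l (k + 1) = G
  generalize binCoeff l (k + 1) = q
  have h2 : l + (k : ℝ) + 2 ≠ 0 := by positivity
  simp only [poch_zero, Nat.factorial, poch_succ]
  push_cast
  field_simp
  ring

/-- The `k`-th term of the expansion of `2 cos (N θ)` into zonal harmonics. -/
noncomputable def cosTerm (l : ℝ) (c : ℕ → ℝ) (N k : ℕ) : ℝ :=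
  if 2 * k ≤ N then cosCoeff l (N - 2 * k) k * c (N - 2 * k) else 0

theorem cosTerm_of_le {l : ℝ} {c : ℕ → ℝ} {N k m : ℕ} (h : N = m + 2 * k) :
    cosTerm l c N k = cosCoeff l m k * c m := by
  subst h; simp [cosTerm]

theorem cosTerm_of_lt {l : ℝ} {c : ℕ → ℝ} {N k : ℕ} (h : N < 2 * k) : cosTerm l c N k = 0 :=
  if_neg (by omega)

/-- Both sides satisfy the Chebyshev recurrence in N, so two initial cases suffice. Frequency 0 is
excluded: the coefficient for m = k = 0 is 0, whereas 2 cos 0 = 2. -/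
theorem sum_cosTerm_eq_cos {l : ℝ} (hl : 0 < l) {c : ℕ → ℝ} {θ : ℝ} (h0 : c 0 = 1)
    (h1 : c 1 = Real.cos θ)
    (hc : ∀ m : ℕ, 2 * (m + 1 + l) * Real.cos θ * c (m + 1) =
      (m + 1 + 2 * l) * c (m + 2) + (m + 1) * c m) (N : ℕ) :
    ∑ k ∈ Finset.range (N + 2), cosTerm l c (N + 1) k = 2 * Real.cos ((N + 1 : ℕ) * θ) := by
  have hc' : ∀ m : ℕ, 2 * Real.cos θ * c (m + 1) =
      (m + 1 + 2 * l) / (m + 1 + l) * c (m + 2) + (m + 1) / (m + 1 + l) * c m := by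
    intro m
    have : (m : ℝ) + 1 + l ≠ 0 := by positivity
    have := hc m
    field_simp
    linarith
  -- The parts of 2 cos θ times a term that raise (u) and lower (v) the zonal degree by one. For m =
  -- 0 the lowering part has factor 0, so the truncated index m - 1 does no harm.
  set u : ℕ → ℕ → ℝ := fun N k => if 2 * k ≤ N then cosCoeff l (N - 2 * k) k *
    (((N - 2 * k : ℕ) + 2 * l) / ((N - 2 * k : ℕ) + l) * c (N - 2 * k + 1)) else 0 with hu
  set v : ℕ → ℕ → ℝ := fun N k => if 2 * k ≤ N then cosCoeff l (N - 2 * k) k *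
    (((N - 2 * k : ℕ) : ℝ) / ((N - 2 * k : ℕ) + l) * c (N - 2 * k - 1)) else 0 with hv
  have hu1 : ∀ {N k m : ℕ}, N = m + 2 * k →
      u N k = cosCoeff l m k * ((m + 2 * l) / (m + l) * c (m + 1)) := by
    intro N k m h; subst h; simp [hu]
  have hv1 : ∀ {N k m : ℕ}, N = m + 2 * k →
      v N k = cosCoeff l m k * (m / (m + l) * c (m - 1)) := by
    intro N k m h; subst h; simp [hv]
  have hu0 : ∀ {N k : ℕ}, N < 2 * k → u N k = 0 := fun h => if_neg (by omega)
  have hv0 : ∀ {N k : ℕ}, N < 2 * k → v N k = 0 := fun h => if_neg (by omega)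
  have huv : ∀ N k, 2 * Real.cos θ * cosTerm l c N k = u N k + v N k := by
    intro N k
    rcases le_or_gt (2 * k) N with h | h
    · obtain ⟨m, rfl⟩ := Nat.exists_eq_add_of_le' h
      rw [cosTerm_of_le rfl, hu1 rfl, hv1 rfl]
      rcases m with _ | m
      · rw [h0, zero_add, h1]
        push_cast
        field_simp
        ring
      · have := hc' m
        rw [Nat.add_sub_cancel]
        push_cast
        linear_combination cosCoeff l (m + 1) k * this
    · rw [cosTerm_of_lt h, hu0 h, hv0 h]; simp
  have hpt0 : ∀ M, cosTerm l c (M + 3) 0 = u (M + 2) 0 := by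
    intro M
    rw [cosTerm_of_le (m := M + 3) (by ring), hu1 (m := M + 2) (by ring),
      cosCoeff_recurrence_left hl]
    push_cast
    ring
  have hpt : ∀ M k, cosTerm l c (M + 3) (k + 1) + cosTerm l c (M + 1) k =
      u (M + 2) (k + 1) + v (M + 2) k := by
    intro M k
    rcases le_or_gt (2 * k) M with h | h
    · obtain ⟨m, rfl⟩ := Nat.exists_eq_add_of_le' h
      rw [cosTerm_of_le (m := m + 1) (by ring), cosTerm_of_le (m := m + 1) (by ring),
        hu1 (m := m) (by ring), hv1 (m := m + 2) (by ring)]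
      have := cosCoeff_recurrence hl m k
      rw [show m + 2 - 1 = m + 1 by omega]
      push_cast
      linear_combination c (m + 1) * this
    · rw [hu0 (by omega)]
      rcases eq_or_lt_of_le (Nat.succ_le_of_lt h) with h' | h'
      · obtain ⟨j, rfl⟩ : ∃ j, k = j + 1 := ⟨k - 1, by omega⟩
        rw [cosTerm_of_le (m := 0) (by omega), cosTerm_of_le (m := 0) (by omega),
          hv1 (m := 1) (by omega)]
        have := cosCoeff_recurrence_right hl j
        rw [Nat.sub_self, h0]
        push_cast
        linear_combination this
      · rw [cosTerm_of_lt (by omega), cosTerm_of_lt (by omega)]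
        rcases eq_or_lt_of_le (Nat.succ_le_of_lt h') with h'' | h''
        · rw [hv1 (m := 0) (by omega)]; simp
        · rw [hv0 (by omega)]
  have hrec : ∀ M, ∑ k ∈ Finset.range (M + 4), cosTerm l c (M + 3) k +
      ∑ k ∈ Finset.range (M + 2), cosTerm l c (M + 1) k =
      2 * Real.cos θ * ∑ k ∈ Finset.range (M + 3), cosTerm l c (M + 2) k := by
    intro M
    have e1 : ∑ k ∈ Finset.range (M + 2), cosTerm l c (M + 1) k =
        ∑ k ∈ Finset.range (M + 3), cosTerm l c (M + 1) k := by
      rw [Finset.sum_range_succ _ (M + 2), cosTerm_of_lt (by omega), add_zero]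
    have e2 : ∑ k ∈ Finset.range (M + 3), u (M + 2) k =
        ∑ k ∈ Finset.range (M + 4), u (M + 2) k := by
      rw [Finset.sum_range_succ _ (M + 3), hu0 (by omega), add_zero]
    rw [Finset.mul_sum]
    simp_rw [huv]
    rw [Finset.sum_add_distrib, e1, e2, Finset.sum_range_succ' _ (M + 3),
      Finset.sum_range_succ' _ (M + 3), hpt0]
    have := Finset.sum_congr rfl fun k (_ : k ∈ Finset.range (M + 3)) => hpt M k
    rw [Finset.sum_add_distrib, Finset.sum_add_distrib] at this
    linarith
  induction N using Nat.twoStepInduction with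
  | zero =>
    rw [Finset.sum_range_succ, Finset.sum_range_one, cosTerm_of_le (m := 1) (by ring),
      cosTerm_of_lt (by omega), h1]
    simp [cosCoeff, logCoeff, gammaRatio, poch_succ, binCoeff]
    field_simp
    exact Or.inl (add_comm _ _)
  | one =>
    have h2 := hc' 0
    rw [Finset.sum_range_succ, Finset.sum_range_succ, Finset.sum_range_one,
      cosTerm_of_le (m := 2) (by ring), cosTerm_of_le (m := 0) (by ring),
      cosTerm_of_lt (by omega)]
    have e : Real.cos ((1 + 1 : ℕ) * θ) = 2 * Real.cos θ ^ 2 - 1 := by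
      push_cast; rw [← Real.cos_two_mul]
    simp only [zero_add, h1, h0, CharP.cast_eq_zero] at h2
    have h3 : c 2 = (2 * (1 + l) * Real.cos θ ^ 2 - 1) / (1 + 2 * l) := by
      field_simp at h2 ⊢
      linarith
    rw [e, h3, h0]
    simp [cosCoeff, logCoeff, gammaRatio, poch_succ, binCoeff]
    field_simp
    ring
  | more M ih0 ih1 =>
    have h := hrec M
    rw [ih0, ih1] at h
    have e : Real.cos ((M + 2 + 1 : ℕ) * θ) + Real.cos ((M + 1 : ℕ) * θ) =
        2 * Real.cos θ * Real.cos ((M + 1 + 1 : ℕ) * θ) := by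
      rw [Real.cos_add_cos]
      push_cast
      rw [show ((M : ℝ) + 2 + 1) * θ + (M + 1) * θ = 2 * ((M + 1 + 1) * θ) by ring,
        show ((M : ℝ) + 2 + 1) * θ - (M + 1) * θ = 2 * θ by ring,
        mul_div_cancel_left₀ _ two_ne_zero, mul_div_cancel_left₀ _ two_ne_zero]
      ring
    linarith

/-- Twice the real part of the series of -log(1-z) at z = r e^{iθ}; the term N = 0 is 0 by division
by zero. -/
theorem hasSum_neg_log_one_sub_two_mul_cos {r : ℝ} (hr : 0 ≤ r) (hr1 : r < 1) (θ : ℝ) :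
    HasSum (fun N : ℕ => 2 * Real.cos (N * θ) * r ^ N / N)
      (-Real.log (1 - 2 * r * Real.cos θ + r ^ 2)) := by
  have hz : ‖(r : ℂ) * Complex.exp (θ * Complex.I)‖ < 1 := by
    rw [norm_mul, Complex.norm_exp_ofReal_mul_I, mul_one, Complex.norm_real, Real.norm_eq_abs,
      abs_of_nonneg hr]
    exact hr1
  have h := (Complex.hasSum_re (Complex.hasSum_taylorSeries_neg_log hz)).mul_left 2
  have e1 : (fun N : ℕ => 2 * Real.cos (N * θ) * r ^ N / N) =
      fun N : ℕ => 2 * (((r : ℂ) * Complex.exp (θ * Complex.I)) ^ N / N).re := by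
    funext N
    have : ((r : ℂ) * Complex.exp (θ * Complex.I)) ^ N / N =
        ((r ^ N / N : ℝ) : ℂ) * Complex.exp (((N * θ : ℝ) : ℂ) * Complex.I) := by
      rw [mul_pow, ← Complex.exp_nat_mul]
      push_cast
      rw [mul_assoc (N : ℂ)]
      ring
    rw [this, Complex.re_ofReal_mul, Complex.exp_ofReal_mul_I_re]
    ring
  have e2 : -Real.log (1 - 2 * r * Real.cos θ + r ^ 2) =
      2 * (-Complex.log (1 - (r : ℂ) * Complex.exp (θ * Complex.I))).re := by
    rw [Complex.neg_re, Complex.log_re]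
    have : 1 - 2 * r * Real.cos θ + r ^ 2 = ‖1 - (r : ℂ) * Complex.exp (θ * Complex.I)‖ ^ 2 := by
      have hre : (1 - (r : ℂ) * Complex.exp (θ * Complex.I)).re = 1 - r * Real.cos θ := by
        rw [Complex.sub_re, Complex.re_ofReal_mul, Complex.exp_ofReal_mul_I_re, Complex.one_re]
      have him : (1 - (r : ℂ) * Complex.exp (θ * Complex.I)).im = -(r * Real.sin θ) := by
        rw [Complex.sub_im, Complex.im_ofReal_mul, Complex.exp_ofReal_mul_I_im, Complex.one_im,
          zero_sub]
      rw [Complex.sq_norm, Complex.normSq_apply, hre, him]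
      linear_combination (-r ^ 2) * Real.sin_sq_add_cos_sq θ
    rw [this, Real.log_pow]
    push_cast
    ring
  rw [e1, e2]
  exact h

theorem logCoeff_zero_left {l : ℝ} (hl : 0 < l) (k : ℕ) : logCoeff l 0 k = -regCoeff l k := by
  rcases k with _ | k
  · simp [logCoeff, gammaRatio]
  · have h1 := (poch_pos (show 0 < l + 1 by linarith) (k + 1)).ne'
    rw [logCoeff, regCoeff, zero_add, gammaRatio_succ, pochRatio, binCoeff, poch_succ_left l (k + 1),
      Nat.factorial_succ]
    simp only [poch_zero, Nat.factorial_zero]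
    push_cast
    field_simp
    ring

/-- The coefficient `(2l)ₘ / ((l)ₘ m)`. -/
noncomputable def betaCoeff (l : ℝ) (m : ℕ) : ℝ := poch (2 * l) m / (poch l m * m)

theorem betaCoeff_nonneg {l : ℝ} (hl : 0 < l) (m : ℕ) : 0 ≤ betaCoeff l m := by
  have := poch_pos hl m
  have := poch_pos (show 0 < 2 * l by linarith) m
  rw [betaCoeff]; positivity

theorem betaCoeff_pos {l : ℝ} (hl : 0 < l) {m : ℕ} (hm : m ≠ 0) : 0 < betaCoeff l m := by
  have := poch_pos hl m
  have := poch_pos (show 0 < 2 * l by linarith) m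
  have : (0 : ℝ) < m := by exact_mod_cast Nat.pos_of_ne_zero hm
  rw [betaCoeff]; positivity

/-- This factorization is why the radial function of an H-harmonic of degree m appears in the
Euclidean expansion of the logarithm; degree 0 produces the regular part of the profile instead. -/
theorem logCoeff_of_ne_zero {l : ℝ} (hl : 0 < l) {m : ℕ} (hm : m ≠ 0) (k : ℕ) :
    logCoeff l m k = betaCoeff l m * hypCoeff l m k := by
  obtain ⟨j, rfl⟩ := Nat.exists_eq_succ_of_ne_zero hm
  have h1 := (poch_pos hl (j + 1)).ne'
  have h2 := (poch_pos (show 0 < l + (j + 1 : ℕ) + 1 by positivity) k).ne'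
  have h3 : ((j + k).factorial : ℝ) = j.factorial * poch (j + 1 : ℕ) k := by
    have := poch_add 1 j k
    rw [poch_one, poch_one] at this
    rw [this, add_comm (1 : ℝ)]
    push_cast; rfl
  have h4 : l + (j + 1 : ℕ) ≠ 0 := by positivity
  rw [logCoeff, betaCoeff, hypCoeff, show j.succ + k = j + k + 1 by omega, gammaRatio_succ,
    show j + k + 2 = j + 1 + (k + 1) by ring, poch_add l (j + 1), poch_succ_left _ k, h3,
    Nat.factorial_succ, show ((j.succ : ℕ) : ℝ) + l + 1 = l + (j + 1 : ℕ) + 1 by push_cast; ring]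
  push_cast at h1 h2 h4 ⊢
  field_simp
  ring

theorem convergesInside_of_ratio {a : ℕ → ℝ} (ha : ∀ᶠ m in atTop, 0 < a m)
    (hr : Tendsto (fun m => a (m + 1) / a m) atTop (𝓝 1)) : ConvergesInside a := by
  intro r hr0 hr1
  rcases hr0.eq_or_lt with rfl | hr0
  · exact summable_of_ne_finset_zero (s := {0}) fun m hm => by
      rw [zero_pow (by simpa using hm), mul_zero]
  refine summable_of_ratio_test_tendsto_lt_one hr1 ?_ ?_
  · filter_upwards [ha] with m hm
    positivity
  · have := hr.mul_const r
    rw [one_mul] at this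
    refine this.congr' ?_
    filter_upwards [ha, (tendsto_add_atTop_nat 1).eventually ha] with m hm hm1
    simp only [norm_mul, norm_pow, Real.norm_eq_abs, abs_of_pos hm, abs_of_pos hm1,
      abs_of_pos hr0]
    rw [pow_succ]
    field_simp

theorem tendsto_natCast_add_div_natCast_add (a b : ℝ) :
    Tendsto (fun m : ℕ => ((m : ℝ) + a) / (m + b)) atTop (𝓝 1) := by
  have := tendsto_add_mul_div_add_mul_atTop_nhds a b (1 : ℝ) one_ne_zero
  simpa [add_comm] using this

theorem convergesInside_betaCoeff {l : ℝ} (hl : 0 < l) : ConvergesInside (betaCoeff l) := by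
  refine convergesInside_of_ratio ?_ ?_
  · filter_upwards [eventually_ne_atTop 0] with m hm using betaCoeff_pos hl hm
  · have := (tendsto_natCast_add_div_natCast_add (2 * l) l).mul
      (tendsto_natCast_add_div_natCast_add 0 1)
    rw [one_mul] at this
    refine this.congr' ?_
    filter_upwards [eventually_ne_atTop 0] with m hm
    have h1 := (poch_pos hl m).ne'
    have h2 := (poch_pos (show 0 < 2 * l by linarith) m).ne'
    have h3 : (m : ℝ) + l ≠ 0 := by positivity
    have h4 : l + (m : ℝ) ≠ 0 := by positivity
    have h5 : (m : ℝ) ≠ 0 := by exact_mod_cast hm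
    rw [betaCoeff, betaCoeff, poch_succ, poch_succ]
    push_cast
    field_simp
    ring

/-- The radial coefficient of the zonal harmonic of degree `m` in the expansion of
`-log (1 - 2 r t + r²)`. -/
noncomputable def logRadial (l : ℝ) (m : ℕ) (r : ℝ) : ℝ :=
  if m = 0 then -regPart l (r ^ 2) else betaCoeff l m * hypSum l m (r ^ 2) * r ^ m

theorem hasSum_logRadial {l : ℝ} (hl : 0 < l) {r : ℝ} (hr : 0 ≤ r) (hr1 : r < 1) (m : ℕ) :
    HasSum (fun k => logCoeff l m k * r ^ (m + 2 * k)) (logRadial l m r) := by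
  have hr2 : |r ^ 2| < 1 := by
    rw [abs_of_nonneg (by positivity)]
    exact pow_lt_one₀ hr hr1 two_ne_zero
  rw [logRadial]
  split_ifs with hm
  · subst hm
    have := ((convergesInside_regCoeff hl).hasSum hr2).neg
    refine this.congr_fun fun k => ?_
    rw [logCoeff_zero_left hl, zero_add, pow_mul]; ring
  · have := (((convergesInside_hypCoeff hl m).hasSum hr2).mul_left (betaCoeff l m)).mul_right (r ^ m)
    refine this.congr_fun fun k => ?_
    rw [logCoeff_of_ne_zero hl hm, pow_add, pow_mul]; ring

theorem abs_logCoeff_le {l : ℝ} (hl : 0 < l) (m k : ℕ) :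
    |logCoeff l m k| ≤ ((if m = 0 then 1 else 0) + betaCoeff l m) * binBound l := by
  split_ifs with hm
  · subst hm
    have hβ : betaCoeff l 0 = 0 := by simp [betaCoeff]
    rw [logCoeff_zero_left hl, abs_neg, hβ, add_zero, one_mul]
    refine le_trans ?_ (abs_binCoeff_le hl k)
    refine le_trans ?_ (abs_pochRatio_le hl k)
    rw [regCoeff, abs_neg, abs_div, Nat.abs_cast]
    rcases k with _ | k
    · simp
    · exact div_le_self (abs_nonneg _) (by push_cast; linarith [k.cast_nonneg (α := ℝ)])
  · rw [logCoeff_of_ne_zero hl hm, abs_mul, abs_of_nonneg (betaCoeff_nonneg hl m), zero_add]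
    exact mul_le_mul_of_nonneg_left ((abs_hypCoeff_le hl m k).trans (abs_binCoeff_le hl k))
      (betaCoeff_nonneg hl m)

/-- The coefficients are bounded by a function of m alone, of subexponential growth, so r^m and
r^(2k) give absolute convergence; this licenses the regrouping by degree. -/
theorem summable_logCoeff {l : ℝ} (hl : 0 < l) {r : ℝ} (hr : 0 ≤ r) (hr1 : r < 1) {c : ℕ → ℝ}
    (hc : ∀ m, |c m| ≤ 1) :
    Summable fun p : ℕ × ℕ => logCoeff l p.1 p.2 * r ^ (p.1 + 2 * p.2) * c p.1 := by
  have h1 : Summable fun m : ℕ => ((if m = 0 then 1 else 0) + betaCoeff l m) * r ^ m := by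
    simp_rw [add_mul]
    refine Summable.add (summable_of_ne_finset_zero (s := {0}) fun m hm => ?_) ?_
    · rw [if_neg (by simpa using hm), zero_mul]
    · have := convergesInside_betaCoeff hl r hr hr1
      simpa only [abs_of_nonneg (betaCoeff_nonneg hl _)] using this
  have h2 : Summable fun k : ℕ => binBound l * (r ^ 2) ^ k :=
    (summable_geometric_of_lt_one (by positivity) (pow_lt_one₀ hr hr1 two_ne_zero)).mul_left _
  have hB := one_le_binBound hl
  have hA : ∀ m, 0 ≤ (if m = 0 then (1 : ℝ) else 0) + betaCoeff l m := fun m =>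
    add_nonneg (by split_ifs <;> norm_num) (betaCoeff_nonneg hl m)
  refine Summable.of_norm_bounded (h1.mul_of_nonneg h2 (fun m => mul_nonneg (hA m) (by positivity))
    fun k => by positivity) fun p => ?_
  rw [Real.norm_eq_abs, abs_mul, abs_mul, abs_of_nonneg (show 0 ≤ r ^ (p.1 + 2 * p.2) by positivity)]
  calc |logCoeff l p.1 p.2| * r ^ (p.1 + 2 * p.2) * |c p.1|
      ≤ ((if p.1 = 0 then 1 else 0) + betaCoeff l p.1) * binBound l * r ^ (p.1 + 2 * p.2) * 1 := by
        have := abs_logCoeff_le hl p.1 p.2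
        have := hc p.1
        have := hA p.1
        gcongr
    _ = _ := by rw [pow_add, pow_mul]; ring

/-- The expansion of `-log (1 - 2 r cos θ + r²)` into zonal harmonics. -/
theorem hasSum_logRadial_mul {l : ℝ} (hl : 0 < l) {r : ℝ} (hr : 0 ≤ r) (hr1 : r < 1) {c : ℕ → ℝ}
    {θ : ℝ} (h0 : c 0 = 1) (h1 : c 1 = Real.cos θ)
    (hrec : ∀ m : ℕ, 2 * (m + 1 + l) * Real.cos θ * c (m + 1) =
      (m + 1 + 2 * l) * c (m + 2) + (m + 1) * c m) (hc : ∀ m, |c m| ≤ 1) :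
    HasSum (fun m => logRadial l m r * c m) (-Real.log (1 - 2 * r * Real.cos θ + r ^ 2)) := by
  have hS := (summable_logCoeff hl hr hr1 hc).hasSum
  set S := ∑' p : ℕ × ℕ, logCoeff l p.1 p.2 * r ^ (p.1 + 2 * p.2) * c p.1
  have hS1 := hS.prod_fiberwise (g := fun m => logRadial l m r * c m)
    fun m => (hasSum_logRadial hl hr hr1 m).mul_right (c m)
  -- The same double family indexed by the frequency N = m + 2k in place of m, extended by 0 where
  -- 2k > N: rows sum to cosines, while the original rows sum to radial functions.
  let g : ℕ × ℕ → ℝ := fun p =>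
    if 2 * p.2 ≤ p.1 then logCoeff l (p.1 - 2 * p.2) p.2 * r ^ p.1 * c (p.1 - 2 * p.2) else 0
  have hinj : Function.Injective fun p : ℕ × ℕ => (p.1 + 2 * p.2, p.2) := by
    rintro ⟨a, b⟩ ⟨a', b'⟩ h
    simp only [Prod.mk.injEq] at h ⊢
    omega
  have hg : HasSum g S := by
    rw [← hinj.hasSum_iff]
    · refine hS.congr_fun fun p => ?_
      simp [g]
    · rintro ⟨N, k⟩ hx
      refine if_neg fun hle => hx ⟨(N - 2 * k, k), ?_⟩
      simp only [Prod.mk.injEq, and_true] at hle ⊢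
      omega
  have hN : ∀ N, HasSum (fun k => g (N, k)) (2 * Real.cos (N * θ) * r ^ N / N) := by
    intro N
    have h2 : HasSum (fun k => g (N, k)) (∑ k ∈ Finset.range (N + 1), g (N, k)) :=
      hasSum_sum_of_ne_finset_zero fun k hk => if_neg (by simp at hk ⊢; omega)
    convert h2 using 1
    rcases N with _ | N
    · simp [g, logCoeff, gammaRatio]
    · rw [← sum_cosTerm_eq_cos hl h0 h1 hrec N, Finset.sum_mul, Finset.sum_div]
      refine Finset.sum_congr rfl fun k _ => ?_
      rcases le_or_gt (2 * k) (N + 1) with h | h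
      · obtain ⟨m, hm⟩ := Nat.exists_eq_add_of_le' h
        have e : g (N + 1, k) = logCoeff l m k * r ^ (N + 1) * c m := by
          simp only [g]; rw [if_pos h, hm, Nat.add_sub_cancel]
        have h3 : ((N + 1 : ℕ) : ℝ) ≠ 0 := by positivity
        have h4 : ((N + 1 : ℕ) : ℝ) = m + 2 * k := by exact_mod_cast hm
        rw [e, cosTerm_of_le hm, cosCoeff, ← h4]
        field_simp
      · rw [cosTerm_of_lt h]
        simp only [g]
        rw [if_neg (by omega)]
        simp
  have hS2 := hg.prod_fiberwise hN
  rw [← hS2.unique (hasSum_neg_log_one_sub_two_mul_cos hr hr1 θ)]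
  exact hS1

/-! ### Uniqueness of expansions into solid H-harmonics -/

theorem abs_hypSum_sub_one_le {l : ℝ} (hl : 0 < l) (m : ℕ) {t : ℝ} (ht : 0 ≤ t) (ht1 : t < 1) :
    |hypSum l m t - 1| ≤ binBound l * (t / (1 - t)) := by
  have h1 := (convergesInside_hypCoeff hl m).hasSum (t := t) (by rwa [abs_of_nonneg ht])
  have h2 : HasSum (fun k => hypCoeff l m (k + 1) * t ^ (k + 1)) (hypSum l m t - 1) := by
    have := (hasSum_nat_add_iff' 1).2 h1
    simpa [hypSum] using this
  have h3 : HasSum (fun k : ℕ => binBound l * (t * t ^ k)) (binBound l * (t / (1 - t))) := by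
    have := ((hasSum_geometric_of_lt_one ht ht1).mul_left t).mul_left (binBound l)
    rwa [← div_eq_mul_inv] at this
  refine h2.norm_le_of_bounded h3 fun k => ?_
  rw [Real.norm_eq_abs, abs_mul, abs_of_nonneg (show 0 ≤ t ^ (k + 1) by positivity), pow_succ']
  exact mul_le_mul_of_nonneg_right ((abs_hypCoeff_le hl m _).trans (abs_binCoeff_le hl _))
    (by positivity)

/-- The term of index m must balance the tail, which is smaller by a factor of order ρ. The weights
stay between 1/2 and 3/2, whose quotient is the constant 3. -/
theorem norm_le_mul_div_of_hasSum_zero {a : ℕ → ℂ} {w : ℕ → ℝ} {C ρ : ℝ} {m : ℕ} (hρ : 0 < ρ)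
    (hρ1 : ρ < 1) (ha : ∀ j, ‖a j‖ ≤ C) (h0 : ∀ j < m, a j = 0) (hw : ∀ j, |w j - 1| ≤ 1 / 2)
    (h : HasSum (fun j => (w j * ρ ^ j : ℂ) * a j) 0) : ‖a m‖ ≤ 3 * C * (ρ / (1 - ρ)) := by
  have h1 := (hasSum_nat_add_iff' (m + 1)).2 h
  have h2 : ∑ j ∈ Finset.range (m + 1), (w j * ρ ^ j : ℂ) * a j = (w m * ρ ^ m : ℂ) * a m := by
    rw [Finset.sum_range_succ, Finset.sum_eq_zero fun j hj => ?_, zero_add]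
    rw [h0 j (Finset.mem_range.1 hj), mul_zero]
  rw [h2, zero_sub] at h1
  have h3 : HasSum (fun k : ℕ => 3 / 2 * ρ ^ (m + 1) * C * ρ ^ k)
      (3 / 2 * ρ ^ (m + 1) * C * (1 - ρ)⁻¹) := (hasSum_geometric_of_lt_one hρ.le hρ1).mul_left _
  have h4 := h1.norm_le_of_bounded h3 fun k => by
    have hwk : |w (k + (m + 1))| ≤ 3 / 2 := by
      have := abs_le.1 (hw (k + (m + 1)))
      rw [abs_le]; constructor <;> linarith
    rw [norm_mul, norm_mul, norm_pow, Complex.norm_real, Complex.norm_real, Real.norm_eq_abs,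
      Real.norm_eq_abs, abs_of_pos hρ]
    calc |w (k + (m + 1))| * ρ ^ (k + (m + 1)) * ‖a (k + (m + 1))‖
        ≤ 3 / 2 * ρ ^ (k + (m + 1)) * C := by
          have := ha (k + (m + 1))
          gcongr
      _ = _ := by rw [pow_add]; ring
  rw [norm_neg, norm_mul, norm_mul, norm_pow, Complex.norm_real, Complex.norm_real,
    Real.norm_eq_abs, Real.norm_eq_abs, abs_of_pos hρ] at h4
  have h5 : 1 / 2 ≤ |w m| := by
    have := abs_le.1 (hw m)
    exact le_trans (by linarith) (le_abs_self _)
  have h6 : 0 < ρ ^ m := by positivity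
  have h7 : 1 / 2 * ρ ^ m * ‖a m‖ ≤ 3 / 2 * ρ ^ (m + 1) * C * (1 - ρ)⁻¹ :=
    le_trans (by gcongr) h4
  have h8 : 3 / 2 * ρ ^ (m + 1) * C * (1 - ρ)⁻¹ =
      1 / 2 * ρ ^ m * (3 * C * (ρ / (1 - ρ))) := by
    rw [pow_succ]; ring
  rw [h8] at h7
  exact le_of_mul_le_mul_left h7 (by positivity)

/-- Uniqueness of the coefficients of a perturbed power series. -/
theorem eq_zero_of_hasSum_zero {a : ℕ → ℂ} {w : ℕ → ℝ → ℝ} {r₀ : ℝ} (hr₀ : 0 < r₀)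
    (hw : ∀ j, ∀ r, 0 < r → r ≤ r₀ → |w j r - 1| ≤ 1 / 2)
    (h : ∀ r : ℝ, 0 < r → r ≤ r₀ → HasSum (fun j => (w j r * r ^ j : ℂ) * a j) 0) (m : ℕ) :
    a m = 0 := by
  -- Terms of the convergent series at r₀ are bounded, and weights of modulus at least 1/2 can be
  -- divided out. Rescaling by r₀ and letting ρ tend to 0 then kills the coefficients one after
  -- another.
  obtain ⟨C, hC⟩ : ∃ C : ℝ, ∀ j, ‖(r₀ : ℂ) ^ j * a j‖ ≤ C := by
    have h1 := (h r₀ hr₀ le_rfl).summable.tendsto_atTop_zero.norm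
    obtain ⟨C, hC⟩ := h1.bddAbove_range
    refine ⟨2 * C, fun j => ?_⟩
    have h2 : ‖(w j r₀ * r₀ ^ j : ℂ) * a j‖ ≤ C := hC ⟨j, rfl⟩
    have h3 : 1 / 2 ≤ |w j r₀| := by
      have := abs_le.1 (hw j r₀ hr₀ le_rfl)
      exact le_trans (by linarith) (le_abs_self _)
    rw [mul_assoc, norm_mul, Complex.norm_real, Real.norm_eq_abs] at h2
    nlinarith [norm_nonneg ((r₀ : ℂ) ^ j * a j)]
  induction m using Nat.strong_induction_on with
  | _ m ih =>
    have hb : ∀ ρ : ℝ, 0 < ρ → ρ < 1 → ‖(r₀ : ℂ) ^ m * a m‖ ≤ 3 * C * (ρ / (1 - ρ)) := by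
      intro ρ hρ hρ1
      have hle : ρ * r₀ ≤ r₀ := mul_le_of_le_one_left hr₀.le hρ1.le
      refine norm_le_mul_div_of_hasSum_zero (a := fun j => (r₀ : ℂ) ^ j * a j)
        (w := fun j => w j (ρ * r₀)) hρ hρ1 hC (fun j hj => by rw [ih j hj, mul_zero])
        (fun j => hw j _ (by positivity) hle) ?_
      refine (h (ρ * r₀) (by positivity) hle).congr_fun fun j => ?_
      push_cast
      rw [mul_pow]; ring
    have ht : Tendsto (fun ρ : ℝ => 3 * C * (ρ / (1 - ρ))) (𝓝[>] 0) (𝓝 0) := by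
      have : ContinuousAt (fun ρ : ℝ => 3 * C * (ρ / (1 - ρ))) 0 := by
        refine continuousAt_const.mul (continuousAt_id.div (by fun_prop) (by norm_num))
      have h2 := this.tendsto.mono_left (nhdsWithin_le_nhds (s := Ioi 0))
      simpa using h2
    have h0 : ‖(r₀ : ℂ) ^ m * a m‖ ≤ 0 := by
      refine ge_of_tendsto ht ?_
      filter_upwards [Ioo_mem_nhdsGT (show (0 : ℝ) < 1 by norm_num)] with ρ hρ using hb ρ hρ.1 hρ.2
    have h1 := norm_le_zero_iff.1 h0
    exact (mul_eq_zero.1 h1).resolve_left (pow_ne_zero _ (by exact_mod_cast hr₀.ne'))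

theorem solidExt_smul {n m : ℕ} (l r : ℝ) {p : MvPolynomial (Fin n) ℂ} (hp : p.IsHomogeneous m)
    {ζ : E n} (hζ : ζ ∈ sphere (0 : E n) 1) :
    solidExt l m p (r • ζ) =
      ((hypSum l m (r ^ 2) : ℝ) * (r : ℂ) ^ m : ℂ) * (((hypSum l m 1 : ℝ) : ℂ)⁻¹ * polyEval p ζ) := by
  have : ‖ζ‖ = 1 := by simpa using hζ
  rw [solidExt, polyEval_smul hp, norm_smul, this, mul_one, Real.norm_eq_abs, sq_abs]
  push_cast
  ring

theorem solidExt_of_mem_sphere {n m : ℕ} {l : ℝ} (hl : 0 < l) {p : MvPolynomial (Fin n) ℂ}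
    {ζ : E n} (hζ : ζ ∈ sphere (0 : E n) 1) : solidExt l m p ζ = polyEval p ζ := by
  have : ‖ζ‖ = 1 := by simpa using hζ
  rw [solidExt, this, one_pow, div_self (hypSum_one_pos hl m).ne']
  simp

/-- Along a ray rζ the difference of two expansions is a power series in r with terms multiplied by
S_m(r²). These factors tend to 1 uniformly in m as r → 0, so the coefficients still vanish. -/
theorem IsDirichletExpansion.eqOn_sphere {n : ℕ} (hn2 : 2 < n) {l : ℝ} (hl : 0 < l)
    (hn : (n : ℝ) = 2 * (l + 1)) {f : E n → ℂ} {F G : ℕ → E n → ℂ} (hF : IsDirichletExpansion f F)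
    (hG : IsDirichletExpansion f G) (m : ℕ) {ζ : E n} (hζ : ζ ∈ sphere (0 : E n) 1) :
    F m ζ = G m ζ := by
  choose p hp hpF using fun m => eqOn_solidExt hn2 hl hn (hF.mem m)
  choose q hq hqG using fun m => eqOn_solidExt hn2 hl hn (hG.mem m)
  have hζ1 : ‖ζ‖ = 1 := by simpa using hζ
  have hB := one_le_binBound hl
  -- Chosen so that the bound B r²/(1-r²) for |S_m(r²) - 1| is at most 1/2 when r ≤ r₀, using 1 - r²
  -- ≥ 3/4.
  set r₀ : ℝ := Real.sqrt (1 / (4 * binBound l)) with hr₀def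
  have hr₀ : 0 < r₀ := Real.sqrt_pos.2 (by positivity)
  have hr₀sq : r₀ ^ 2 = 1 / (4 * binBound l) := Real.sq_sqrt (by positivity)
  have hr₀q : r₀ ^ 2 ≤ 1 / 4 := by
    rw [hr₀sq]; exact one_div_le_one_div_of_le (by norm_num) (by linarith)
  have hr₀1 : r₀ < 1 := by nlinarith
  have hBr : binBound l * r₀ ^ 2 = 1 / 4 := by rw [hr₀sq]; field_simp
  have key := eq_zero_of_hasSum_zero hr₀
    (a := fun j => ((hypSum l j 1 : ℝ) : ℂ)⁻¹ * (polyEval (p j) ζ - polyEval (q j) ζ))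
    (w := fun j r => hypSum l j (r ^ 2)) ?_ ?_ m
  · have hs : ((hypSum l m 1 : ℝ) : ℂ)⁻¹ ≠ 0 :=
      inv_ne_zero (by exact_mod_cast (hypSum_one_pos hl m).ne')
    have h1 := sub_eq_zero.1 ((mul_eq_zero.1 key).resolve_left hs)
    rw [hpF m ζ (sphere_subset_closedBall hζ), hqG m ζ (sphere_subset_closedBall hζ),
      solidExt_of_mem_sphere hl hζ, solidExt_of_mem_sphere hl hζ, h1]
  · intro j r hr hr'
    have hrr : r ^ 2 ≤ r₀ ^ 2 := by gcongr
    refine (abs_hypSum_sub_one_le hl j (by positivity) (by linarith)).trans ?_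
    have h1 : r ^ 2 / (1 - r ^ 2) ≤ r₀ ^ 2 * 2 := by
      rw [div_le_iff₀ (by linarith)]
      nlinarith
    calc binBound l * (r ^ 2 / (1 - r ^ 2)) ≤ binBound l * (r₀ ^ 2 * 2) := by gcongr
      _ = 1 / 2 := by rw [← mul_assoc, hBr]; norm_num
  · intro r hr hr'
    have hx : r • ζ ∈ unitBall n := by
      rw [mem_ball_zero_iff, norm_smul, hζ1, mul_one, Real.norm_eq_abs, abs_of_pos hr]
      linarith
    have h1 := (hF.hasSum _ hx).sub (hG.hasSum _ hx)
    rw [sub_self] at h1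
    refine h1.congr_fun fun j => ?_
    rw [hpF j _ (ball_subset_closedBall hx), hqG j _ (ball_subset_closedBall hx),
      solidExt_smul l r (hp j).1 hζ, solidExt_smul l r (hq j).1 hζ]
    ring

/-! ### Normalizing constants and the expansion of the kernel -/

theorem sphereInner_congr {n : ℕ} {f f' g g' : E n → ℂ} (hf : ∀ ζ ∈ sphere (0 : E n) 1, f ζ = f' ζ)
    (hg : ∀ ζ ∈ sphere (0 : E n) 1, g ζ = g' ζ) : sphereInner f g = sphereInner f' g' := by
  rw [sphereInner, sphereInner]
  congr 1
  funext ζ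
  rw [hf ζ ζ.2, hg ζ ζ.2]

theorem conj_sphereInner {n : ℕ} (f g : E n → ℂ) :
    conj (sphereInner f g) = sphereInner g f := by
  rw [sphereInner, sphereInner, average_eq, average_eq, Complex.real_smul, Complex.real_smul,
    map_mul, Complex.conj_ofReal, ← integral_conj]
  simp [mul_comm]

theorem ofReal_sphereNormSq {n : ℕ} (f : E n → ℂ) : (sphereNormSq f : ℂ) = sphereInner f f := by
  rw [sphereInner, sphereNormSq, average_eq, average_eq, Complex.real_smul, smul_eq_mul,
    Complex.ofReal_mul, ← integral_complex_ofReal]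
  simp [Complex.mul_conj, Complex.normSq_eq_norm_sq]

theorem invDim_eq {n : ℕ} {l : ℝ} (hl : 0 < l) (hn : (n : ℝ) = 2 * (l + 1)) (m : ℕ) :
    invDim n m = l / (l + m) * (m.factorial / poch (2 * l) m) := by
  induction m with
  | zero => simp [invDim, hl.ne']
  | succ m ih =>
    have h1 := (poch_pos (show 0 < 2 * l by linarith) m).ne'
    have h2 : (m : ℝ) + 2 * (l + 1) - 2 ≠ 0 := by
      have : (0 : ℝ) ≤ m := m.cast_nonneg
      linarith
    have h3 : 2 * l + (m : ℝ) ≠ 0 := by positivity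
    rw [invDim, ih, hn, poch_succ, Nat.factorial_succ]
    push_cast
    field_simp
    ring

/-- The normalizing constant depending on the parity of the dimension. -/
noncomputable def parityFactor (n : ℕ) : ℝ := if Even n then 1 else 1 / 2

theorem parityFactor_pos (n : ℕ) : 0 < parityFactor n := by
  rw [parityFactor]; split_ifs <;> norm_num

/-- The weights I_m are matched here to the logarithmic expansion: the dimension, the coefficient of
the expansion and Gauss's value S_m(1) multiply to the reciprocal weight. -/
theorem weight_mul_eq_one {n : ℕ} {l : ℝ} (hl : 0 < l) (hn : (n : ℝ) = 2 * (l + 1)) {m : ℕ}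
    (hm : m ≠ 0) :
    weight n m * (parityFactor n * betaCoeff l m * invDim n m) * hypSum l m 1 = 1 := by
  obtain ⟨j, rfl⟩ := Nat.exists_eq_succ_of_ne_zero hm
  have h1 := (poch_pos (show 0 < 2 * l by linarith) (j + 1)).ne'
  have h2 := (poch_pos (show 0 < 2 * l + 1 by linarith) (j + 1)).ne'
  have h3 := (poch_pos hl (j + 1)).ne'
  have h4 : (ascPochhammer ℝ (j + 1)).eval ((n : ℝ) - 1) = poch (2 * l + 1) (j + 1) := by
    rw [poch, hn]; congr 1; ring
  have h5 : poch (l + 1) (j + 1) = poch l (j + 1) * (l + (j + 1)) / l := by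
    have e1 := poch_succ l (j + 1)
    rw [poch_succ_left l (j + 1)] at e1
    push_cast at e1
    field_simp
    linarith
  have h6 : l + ((j : ℝ) + 1) ≠ 0 := by positivity
  have h7 : (if Even n then (1 : ℝ) else 2) * parityFactor n = 1 := by
    rw [parityFactor]; split_ifs <;> norm_num
  rw [weight, if_neg hm, h4, invDim_eq hl hn, betaCoeff, hypSum_one hl, h5, Nat.succ_eq_add_one,
    Nat.cast_succ, Real.Gamma_nat_eq_factorial, Nat.factorial_succ]
  push_cast
  have h8 : (j.factorial : ℝ) ≠ 0 := by positivity
  field_simp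
  linear_combination h7

theorem abs_hypSum_le {l : ℝ} (hl : 0 < l) (m : ℕ) {t : ℝ} (ht : 0 ≤ t) (ht1 : t < 1) :
    |hypSum l m t| ≤ 1 + binBound l * (t / (1 - t)) := by
  have h := abs_hypSum_sub_one_le hl m ht ht1
  have h2 := abs_add_le (hypSum l m t - 1) 1
  rw [sub_add_cancel, abs_one] at h2
  linarith

/-- The zonal expansion of the logarithm of `[ζ, y]²` for `ζ` on the sphere. -/
theorem hasSum_neg_log_bracketSq {n : ℕ} (hn2 : 2 < n) {l : ℝ} (hl : 0 < l)
    (hn : (n : ℝ) = 2 * (l + 1)) {ζ y : E n} (hζ : ‖ζ‖ = 1) (hy : y ∈ unitBall n) :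
    HasSum (fun m => betaCoeff l m * hypSum l m (‖y‖ ^ 2) * zonal n m (inner ℝ ζ y) (‖y‖ ^ 2))
      (regPart l (‖y‖ ^ 2) - Real.log (bracketSq ζ y)) := by
  have hy1 : ‖y‖ < 1 := by simpa using hy
  obtain ⟨η, hη, hηy⟩ : ∃ η : E n, ‖η‖ = 1 ∧ ‖y‖ • η = y := by
    by_cases h : y = 0
    · exact ⟨ζ, hζ, by simp [h]⟩
    · have h' := norm_ne_zero_iff.2 h
      exact ⟨‖y‖⁻¹ • y, by simp [norm_smul, h'], by rw [smul_smul, mul_inv_cancel₀ h', one_smul]⟩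
  set r := ‖y‖ with hr
  have hin : |inner ℝ ζ η| ≤ 1 := by
    have := abs_real_inner_le_norm ζ η
    rwa [hζ, hη, one_mul] at this
  have hcos : Real.cos (Real.arccos (inner ℝ ζ η)) = inner ℝ ζ η :=
    Real.cos_arccos (abs_le.1 hin).1 (abs_le.1 hin).2
  have hiy : inner ℝ ζ y = r * inner ℝ ζ η := by
    conv_lhs => rw [← hηy]
    rw [inner_smul_right]
  have hz : ∀ m, zonal n m (inner ℝ ζ y) (r ^ 2) = r ^ m * zonal n m (inner ℝ ζ η) 1 := by
    intro m
    rw [hiy, ← zonal_mul_sq, mul_one]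
  have h := hasSum_logRadial_mul hl (norm_nonneg y) hy1
    (c := fun m => zonal n m (inner ℝ ζ η) 1) (θ := Real.arccos (inner ℝ ζ η))
    (by simp [zonal]) (by simp [zonal, hcos]) (fun m => by
      have := zonal_add_two hn2 m (inner ℝ ζ η) 1
      rw [hcos]
      rw [hn] at this
      linear_combination -this) (abs_zonal_le_one hn2 hζ hη)
  rw [hcos, ← hr] at h
  -- Adding the regular part to the term m = 0 cancels it exactly, so the expansion starts in degree
  -- 1.
  have h2 := h.add (hasSum_ite_eq 0 (regPart l (r ^ 2)))
  have e : -Real.log (1 - 2 * r * inner ℝ ζ η + r ^ 2) + regPart l (r ^ 2) =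
      regPart l (r ^ 2) - Real.log (bracketSq ζ y) := by
    rw [bracketSq, hiy, hζ, ← hr]; ring_nf
  rw [e] at h2
  refine h2.congr_fun fun m => ?_
  rw [hz, logRadial]
  rcases eq_or_ne m 0 with rfl | hm
  · simp [zonal, betaCoeff]
  · rw [if_neg hm, if_neg hm]; ring

theorem kernelExt_of_mem_sphere {n : ℕ} {l : ℝ} {ζ y : E n} (hζ : ‖ζ‖ = 1) :
    kernelExt l y ζ = regPart l (‖y‖ ^ 2) - Real.log (bracketSq ζ y) := by
  rw [kernelExt, moebiusSq, hζ]
  simp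

/-- The zonal components of the boundary values of the kernel. -/
noncomputable def kernelPoly {n : ℕ} (l : ℝ) (y : E n) (m : ℕ) : MvPolynomial (Fin n) ℂ :=
  MvPolynomial.C ((parityFactor n * betaCoeff l m * hypSum l m (‖y‖ ^ 2) : ℝ) : ℂ) * zonalPoly y m

theorem isHarmonicHomogeneous_kernelPoly {n : ℕ} (hn : 2 < n) (l : ℝ) (y : E n) (m : ℕ) :
    IsHarmonicHomogeneous m (kernelPoly l y m) := by
  obtain ⟨h1, h2⟩ := isHarmonicHomogeneous_zonalPoly hn y m
  refine ⟨h1.C_mul _, ?_⟩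
  have := polyLaplacian_C_mul
    ((parityFactor n * betaCoeff l m * hypSum l m (‖y‖ ^ 2) : ℝ) : ℂ) (zonalPoly y m)
  rw [polyLaplacian_zonalPoly hn, mul_zero] at this
  exact this

theorem polyEval_kernelPoly {n : ℕ} (l : ℝ) {ζ : E n} (hζ : ‖ζ‖ = 1) (y : E n) (m : ℕ) :
    polyEval (kernelPoly l y m) ζ = ((parityFactor n * (betaCoeff l m * hypSum l m (‖y‖ ^ 2) *
      zonal n m (inner ℝ ζ y) (‖y‖ ^ 2)) : ℝ) : ℂ) := by
  rw [kernelPoly, polyEval_mul, polyEval_C, polyEval_zonalPoly, hζ, ← Complex.ofReal_mul]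
  congr 1
  ring_nf

/-- On the sphere the series converges uniformly by a majorant built from |y|^m with |y| < 1. The
kernel minus a partial sum is H-harmonic and continuous up to the boundary, so the maximum principle
transfers the estimate to x. -/
theorem hasSum_solidExt_kernelPoly {n : ℕ} (hn2 : 2 < n) {l : ℝ} (hl : 0 < l)
    (hn : (n : ℝ) = 2 * (l + 1)) {x y : E n} (hx : x ∈ closedBall (0 : E n) 1)
    (hy : y ∈ unitBall n) :
    HasSum (fun m => solidExt l m (kernelPoly l y m) x)
      ((parityFactor n * kernelExt l y x : ℝ) : ℂ) := by
  have hy1 : ‖y‖ < 1 := by simpa using hy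
  have hε := parityFactor_pos n
  have hmem := fun m => solidExt_mem hl hn (isHarmonicHomogeneous_kernelPoly hn2 l y m)
  have hdiff : ∀ s : Finset ℕ, IsHHarmonic (fun x => ((parityFactor n * kernelExt l y x : ℝ) : ℂ) -
      ∑ m ∈ s, solidExt l m (kernelPoly l y m) x) := by
    intro s
    classical
    induction s using Finset.induction_on with
    | empty =>
      simpa using (isHHarmonic_kernelExt hl hn hy).const_mul (parityFactor n : ℂ)
    | insert a s ha ih =>
      have := ih.sub (hmem a).2.1
      simp_rw [Finset.sum_insert ha]
      simpa only [sub_sub, add_comm] using this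
  have hcont : ∀ s : Finset ℕ, ContinuousOn (fun x =>
      ((parityFactor n * kernelExt l y x : ℝ) : ℂ) -
      ∑ m ∈ s, solidExt l m (kernelPoly l y m) x) (closedBall 0 1) := fun s =>
    (Complex.continuous_ofReal.comp_continuousOn
      ((continuousOn_kernelExt hl hy).const_smul (parityFactor n))).sub
      (continuousOn_finsetSum _ fun m _ => (hmem m).1)
  have hsph : ∀ ζ ∈ sphere (0 : E n) 1, HasSum (fun m => solidExt l m (kernelPoly l y m) ζ)
      ((parityFactor n * kernelExt l y ζ : ℝ) : ℂ) := by
    intro ζ hζ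
    have hζ1 : ‖ζ‖ = 1 := by simpa using hζ
    rw [kernelExt_of_mem_sphere hζ1]
    refine (Complex.hasSum_ofReal.2
      ((hasSum_neg_log_bracketSq hn2 hl hn hζ1 hy).mul_left (parityFactor n))).congr_fun fun m => ?_
    rw [solidExt_of_mem_sphere hl hζ, polyEval_kernelPoly l hζ1]
  set C : ℝ := 1 + binBound l * (‖y‖ ^ 2 / (1 - ‖y‖ ^ 2)) with hC
  have hu : Summable fun m => parityFactor n * C * (|betaCoeff l m| * ‖y‖ ^ m) :=
    (convergesInside_betaCoeff hl ‖y‖ (norm_nonneg y) hy1).mul_left _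
  have hbound : ∀ (m : ℕ) (ζ : E n), ζ ∈ sphere (0 : E n) 1 →
      ‖solidExt l m (kernelPoly l y m) ζ‖ ≤ parityFactor n * C * (|betaCoeff l m| * ‖y‖ ^ m) := by
    intro m ζ hζ
    have hζ1 : ‖ζ‖ = 1 := by simpa using hζ
    rw [solidExt_of_mem_sphere hl hζ, polyEval_kernelPoly l hζ1, Complex.norm_real,
      Real.norm_eq_abs, abs_mul, abs_mul, abs_mul, abs_of_pos hε]
    have h1 := abs_hypSum_le hl m (sq_nonneg ‖y‖) (by linarith [one_sub_normSq_pos hy])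
    have h2 := abs_zonal_le hn2 hζ1 y m
    have hC0 : 0 ≤ C := (abs_nonneg _).trans h1
    calc parityFactor n * (|betaCoeff l m| * |hypSum l m (‖y‖ ^ 2)| *
          |zonal n m (inner ℝ ζ y) (‖y‖ ^ 2)|)
        ≤ parityFactor n * (|betaCoeff l m| * C * ‖y‖ ^ m) := by gcongr
      _ = _ := by ring
  have hunif := tendstoUniformlyOn_tsum hu hbound
  rw [Metric.tendstoUniformlyOn_iff] at hunif
  rw [HasSum, SummationFilter.unconditional_filter, Metric.tendsto_nhds]
  intro ε hε0
  filter_upwards [hunif (ε / 2) (half_pos hε0)] with s hs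
  rw [dist_comm, dist_eq_norm]
  refine lt_of_le_of_lt ((hdiff s).norm_le hn2 (hcont s) (M := ε / 2) (fun ζ hζ => ?_) hx)
    (half_lt_self hε0)
  have := hs ζ hζ
  rw [(hsph ζ hζ).tsum_eq, dist_eq_norm] at this
  exact this.le

/-! ### The reproducing kernel and its uniqueness -/

theorem weight_mul_sphereInner_kernelPoly {n : ℕ} (hn2 : 2 < n) {l : ℝ} (hl : 0 < l)
    (hn : (n : ℝ) = 2 * (l + 1)) {m : ℕ} (hm : m ≠ 0) {p : MvPolynomial (Fin n) ℂ}
    (hp : IsHarmonicHomogeneous m p) (y : E n) :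
    (weight n m : ℂ) * sphereInner (solidExt l m p) (solidExt l m (kernelPoly l y m)) =
      solidExt l m p y := by
  have h1 : sphereInner (solidExt l m p) (solidExt l m (kernelPoly l y m)) =
      sphereMean (kernelPoly l y m * p) := by
    rw [sphereInner, sphereMean]
    congr 1
    funext ζ
    have hζ : (ζ : E n) ∈ sphere (0 : E n) 1 := ζ.2
    have hζ1 : ‖(ζ : E n)‖ = 1 := by simp
    rw [solidExt_of_mem_sphere hl hζ, solidExt_of_mem_sphere hl hζ, polyEval_mul,
      polyEval_kernelPoly l hζ1, Complex.conj_ofReal, mul_comm]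
  rw [h1, kernelPoly, mul_assoc, sphereMean_C_mul, sphereMean_zonalPoly_mul hn2 y m hp, solidExt]
  have h2 := weight_mul_eq_one hl hn hm
  have h3 := (hypSum_one_pos hl m).ne'
  have h4 : weight n m * (parityFactor n * betaCoeff l m * hypSum l m (‖y‖ ^ 2)) * invDim n m =
      hypSum l m (‖y‖ ^ 2) / hypSum l m 1 := by
    field_simp
    linear_combination hypSum l m (‖y‖ ^ 2) * h2
  rw [← h4]
  push_cast
  ring

theorem weight_zero (n : ℕ) : weight n 0 = 0 := if_pos rfl

theorem solidExt_kernelPoly_zero {n : ℕ} (l : ℝ) (y x : E n) :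
    solidExt l 0 (kernelPoly l y 0) x = 0 := by
  simp [solidExt, kernelPoly, betaCoeff]

theorem isDirichletExpansion_kernel {n : ℕ} (hn2 : 2 < n) {l : ℝ} (hl : 0 < l)
    (hn : (n : ℝ) = 2 * (l + 1)) {y : E n} (hy : y ∈ unitBall n) {f : E n → ℂ}
    (hf : ∀ x ∈ unitBall n, f x = ((parityFactor n * kernelExt l y x : ℝ) : ℂ)) :
    IsDirichletExpansion f fun m => solidExt l m (kernelPoly l y m) where
  mem m := solidExt_mem hl hn (isHarmonicHomogeneous_kernelPoly hn2 l y m)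
  hasSum x hx := by
    rw [hf x hx]
    exact hasSum_solidExt_kernelPoly hn2 hl hn (ball_subset_closedBall hx) hy
  summable := by
    rw [← Complex.summable_ofReal]
    -- By the reproducing property the weighted squared norms of the components are their values at
    -- y, so this is the expansion at x = y.
    refine (hasSum_solidExt_kernelPoly hn2 hl hn
      (ball_subset_closedBall hy) hy).summable.congr fun m => ?_
    rw [Complex.ofReal_mul, ofReal_sphereNormSq]
    rcases eq_or_ne m 0 with rfl | hm
    · simp [weight_zero, solidExt_kernelPoly_zero]
    · exact (weight_mul_sphereInner_kernelPoly hn2 hl hn hm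
        (isHarmonicHomogeneous_kernelPoly hn2 l y m) y).symm

theorem solidExt_apply_zero {n m : ℕ} (l : ℝ) {p : MvPolynomial (Fin n) ℂ}
    (hp : p.IsHomogeneous m) (hm : m ≠ 0) : solidExt l m p 0 = 0 := by
  have := polyEval_smul hp 0 0
  rw [smul_zero, Complex.ofReal_zero, zero_pow hm, zero_mul] at this
  rw [solidExt, this, mul_zero]

theorem solidExt_zero_left {n : ℕ} (l : ℝ) {p : MvPolynomial (Fin n) ℂ} (hp : p.IsHomogeneous 0)
    (x : E n) : solidExt l 0 p x = solidExt l 0 p 0 := by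
  have h := polyEval_smul hp 0 x
  rw [zero_smul, pow_zero, one_mul] at h
  rw [solidExt, solidExt, h]
  simp [hypSum_zero_left]

theorem hasDirichletInner_kernel {n : ℕ} (hn2 : 2 < n) {l : ℝ} (hl : 0 < l)
    (hn : (n : ℝ) = 2 * (l + 1)) {y : E n} (hy : y ∈ unitBall n) {f k : E n → ℂ}
    (hk : ∀ x ∈ unitBall n, k x = ((parityFactor n * kernelExt l y x : ℝ) : ℂ)) (hf : f 0 = 0) :
    HasDirichletInner f k (f y) := by
  intro F G hF hG
  refine (hF.hasSum y hy).congr_fun fun m => ?_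
  obtain ⟨p, hp, hpF⟩ := eqOn_solidExt hn2 hl hn (hF.mem m)
  -- Degree 0 has weight 0, so its component must vanish. It is constant, and equals f(0) = 0
  -- because components of positive degree vanish at the origin.
  rcases eq_or_ne m 0 with rfl | hm
  · have h0 : F 0 0 = f 0 := by
      refine (hasSum_single (f := fun m => F m 0) 0 fun m hm => ?_).unique
        (hF.hasSum 0 (by simp))
      obtain ⟨q, hq, hqF⟩ := eqOn_solidExt hn2 hl hn (hF.mem m)
      rw [hqF 0 (by simp), solidExt_apply_zero l hq.1 hm]
    rw [hpF 0 (by simp), hf] at h0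
    rw [hpF y (ball_subset_closedBall hy), solidExt_zero_left l hp.1, h0, weight_zero]
    simp
  · rw [hpF y (ball_subset_closedBall hy), ← weight_mul_sphereInner_kernelPoly hn2 hl hn hm hp y]
    congr 1
    -- The given expansion of the kernel is arbitrary; uniqueness on the sphere replaces it by the
    -- explicit one.
    exact sphereInner_congr (fun ζ hζ => hpF ζ (sphere_subset_closedBall hζ)) fun ζ hζ =>
      hG.eqOn_sphere hn2 hl hn (isDirichletExpansion_kernel hn2 hl hn hy hk) m hζ

theorem kernelExt_zero {n : ℕ} (l : ℝ) (y : E n) : kernelExt l y 0 = 0 := by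
  simp [kernelExt, moebiusSq, bracketSq]

theorem isReproducingKernel_of_eq {n : ℕ} (hn2 : 2 < n) {l : ℝ} (hl : 0 < l)
    (hn : (n : ℝ) = 2 * (l + 1)) {K : E n → E n → ℂ}
    (hK : ∀ x ∈ unitBall n, ∀ y ∈ unitBall n,
      K x y = ((parityFactor n * kernelExt l y x : ℝ) : ℂ)) : IsReproducingKernel K := by
  intro y hy
  have hk : ∀ x ∈ unitBall n, K x y = ((parityFactor n * kernelExt l y x : ℝ) : ℂ) :=
    fun x hx => hK x hx y hy
  refine ⟨⟨⟨_, isDirichletExpansion_kernel hn2 hl hn hy hk⟩, ?_⟩, fun f hf =>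
    hasDirichletInner_kernel hn2 hl hn hy hk hf.2⟩
  simp [hK 0 (by simp) y hy, kernelExt_zero]

theorem HasDirichletInner.conj_eq {n : ℕ} {f g : E n → ℂ} {c d : ℂ} (hf : f ∈ dirichletSpace n)
    (hg : g ∈ dirichletSpace n) (h : HasDirichletInner f g c) (h' : HasDirichletInner g f d) :
    conj c = d := by
  obtain ⟨F, hF⟩ := hf
  obtain ⟨G, hG⟩ := hg
  have h1 := Complex.hasSum_conj'.2 (h F G hF hG)
  refine h1.unique ((h' G F hG hF).congr_fun fun m => ?_)
  simp [conj_sphereInner]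

/-- The reproducing kernel of the Dirichlet space. -/
theorem isReproducingKernel_iff {n : ℕ} (hn2 : 2 < n) {l : ℝ} (hl : 0 < l)
    (hn : (n : ℝ) = 2 * (l + 1)) (K : E n → E n → ℂ) :
    IsReproducingKernel K ↔ ∀ x ∈ unitBall n, ∀ y ∈ unitBall n,
      K x y = ((parityFactor n * kernelExt l y x : ℝ) : ℂ) := by
  refine ⟨fun h x hx y hy => ?_, isReproducingKernel_of_eq hn2 hl hn⟩
  let K₀ : E n → E n → ℂ := fun x y => ((parityFactor n * kernelExt l y x : ℝ) : ℂ)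
  have h₀ : IsReproducingKernel K₀ :=
    isReproducingKernel_of_eq hn2 hl hn fun _ _ _ _ => rfl
  -- Each kernel reproduces the other: pairing K₀(·,x) with K(·,y) gives K₀(y,x) in one order and
  -- K(x,y) in the other, so they are conjugate, and K₀ is real and symmetric.
  have h1 := (h y hy).2 _ (h₀ x hx).1
  have h2 := (h₀ x hx).2 _ (h y hy).1
  have h3 := h1.conj_eq (h₀ x hx).1.1 (h y hy).1.1 h2
  rw [← h3, kernelExt_comm]
  exact Complex.conj_ofReal _

end HHarmonic

/-! ### The theorem, with l = n/2 - 1 -/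

theorem mainTheorem2 (n : ℕ) (hn : 2 < n) :
    (∀ K : HHarmonic.E n → HHarmonic.E n → ℂ,
      HHarmonic.IsReproducingKernel K ↔
        ∀ x ∈ HHarmonic.unitBall n, ∀ y ∈ HHarmonic.unitBall n,
          K x y = (((if Even n then 2 * ((n : ℝ) - 1) / n else ((n : ℝ) - 1) / n) *
            (HHarmonic.fn n (‖x‖ ^ 2) + HHarmonic.fn n (‖y‖ ^ 2)
              - HHarmonic.fn n (‖HHarmonic.moebius y x‖ ^ 2)) : ℝ) : ℂ)) ∧
    (∀ x : ℝ, -1 < x → x < 1 →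
      HHarmonic.fn n x =
        ((n : ℝ) - 2) / (2 * ((n : ℝ) - 1)) * x
            * HHarmonic.hyp32 (2 - (n : ℝ) / 2) 1 1 2 (1 + (n : ℝ) / 2) x
          + (n : ℝ) / (2 * ((n : ℝ) - 1)) * Real.log (1 / (1 - x))) := by
  have hn' : (2 : ℝ) < n := by exact_mod_cast hn
  have hl : 0 < (n : ℝ) / 2 - 1 := by linarith
  have hnl : (n : ℝ) = 2 * ((n : ℝ) / 2 - 1 + 1) := by ring
  refine ⟨fun K => ?_, fun x hx hx1 => ?_⟩
  · rw [HHarmonic.isReproducingKernel_iff hn hl hnl]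
    refine forall₂_congr fun x hx => forall₂_congr fun y hy => ?_
    rw [← HHarmonic.kernelExt_eq_fn hn hl hnl hx hy, ← mul_assoc]
    have : HHarmonic.parityFactor n * (2 * ((n : ℝ) - 1) / n) =
        if Even n then 2 * ((n : ℝ) - 1) / n else ((n : ℝ) - 1) / n := by
      rw [HHarmonic.parityFactor]
      split_ifs <;> ring
    rw [this]
  · rw [HHarmonic.fn_eq_regPart hl hn.le hnl (abs_lt.2 ⟨hx, hx1⟩), HHarmonic.regPart_eq_hyp32 hl,
      one_div, Real.log_inv, show 1 - ((n : ℝ) / 2 - 1) = 2 - (n : ℝ) / 2 by ring,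
      show (n : ℝ) / 2 - 1 + 2 = 1 + (n : ℝ) / 2 by ring]
    have h1 : 2 * ((n : ℝ) / 2 - 1) + 1 = n - 1 := by ring
    have h2 : (n : ℝ) - 1 ≠ 0 := by linarith
    have h3 : (n : ℝ) ≠ 0 := by linarith
    have h4 : (n : ℝ) / 2 - 1 + 1 = n / 2 := by ring
    rw [h1, h4]
    generalize HHarmonic.hyp32 _ _ _ _ _ _ = F
    field_simp
    ring
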